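/- **Conventions.** Positions in strings are 1-based; $T[i:j]$ is the substring of $T$ from position $i$ to position $j$. For a string $T$ and a nonempty string $P$, $\mathit{Occ}(T,P)=\{k>0 : T[k:k+|P|-1]=P\}$; two occurrences $k_1<k_2$ overlap if $k_1+|P|-1\ge k_2$, and $\mathit{nOcc}(T,P)$ is the size of a largest set of pairwise non-overlapping occurrences. For $P=T[j:j+q-1]$, the longest overlapping cover $\mathit{loc}_q(T,j)$ is the pair $(b,e)$ that maximizes $e-b$ among all pairs with $b\in \mathit{Occ}(T,P)$, $e-(q-1)\in \mathit{Occ}(T,P)$, $b\le j\le j+q-1\le e$, such that for every $k\in[b:e-q]\cap \mathit{Occ}(T,P)$ there is an occurrence of $P$ in $[k+1:\min\{k+q-1,e-q+1\}]$. A straight line program (SLP) of size $n\ge 1$ is a sequence of assignments $X_1=\mathit{expr}_1,\dots,X_n=\mathit{expr}_n$, where each $\mathit{expr}_i$ is a letter of $\Sigma=\{0,\dots,\sigma-1\}$ or $X_\ell X_r$ with $\ell,r<i$; each $X_i$ is identified with the string that it derives, and $T=X_n$. The machine is a deterministic word RAM with $B$-bit words. It has memory that is initially zero outside the input, and its operations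 (addition, subtraction and multiplication modulo $2^B$, comparison, reading and writing memory) have unit cost. **Theorem.** There are a program for this machine and absolute constants $C,K$ such that the following holds for all $\sigma$, every SLP of size $n$ over $\Sigma$ that describes a string $T$, every integer $q\ge 1$ and every word size $B$ with $2^B\ge K(|T|+q^2n+\sigma)$. Suppose that the memory holds the SLP, $n$ and $q$ and that, for all variables $X_i=X_\ell X_r$ with $|X_i|\ge q$ and all $j$ with $$\max\{1,|X_\ell|-2(q-1)+1\}\le j\le \min\{|X_\ell|+q-1,\ |X_i|-q+1\},$$ the values $(b,e)=\mathit{loc}_q(X_i,j)$ and $\mathit{nOcc}(X_i[b:e],X_i[j:j+q-1])$ are already computed and stored in memory. (Numbers are stored modulo $2^B$; this affects only variables that do not occur in the derivation of $T$.) Then the program halts after at most $C q^2 n$ steps and outputs a list, without repetitions, of all $q$-grams $P\in\Sigma^q$ that occur in $T$, each with its non-overlapping frequency $\mathit{nOcc}(T,P)$. (All other $q$-grams have frequency $0$.) That is, all non-overlapping $q$-gram frequencies of $T$ are computed in $O(q^2n)$ time. -/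

import Mathlib

/-! ## Strings, occurrences and non-overlapping frequencies (positions are 1-based) -/

/-- The substring `T[i:j]` (1-based, both ends included; empty if `j < i`). -/
def slice {α : Type} (T : List α) (i j : ℕ) : List α :=
  (T.drop (i - 1)).take (j + 1 - i)

/-- `Occ(T,P)`: the positions `k` with `T[k:k+|P|-1] = P` (for nonempty `P`). -/
def Occ {α : Type} [DecidableEq α] (T P : List α) : Finset ℕ :=
  (Finset.Icc 1 T.length).filter fun k => slice T k (k + P.length - 1) = P

/-- `A` contains no two overlapping occurrences of a string of length `m`. -/
def NonOverlapping (m : ℕ) (A : Finset ℕ) : Prop :=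
  ∀ k₁ ∈ A, ∀ k₂ ∈ A, k₁ < k₂ → ¬ (k₂ ≤ k₁ + m - 1)

instance (m : ℕ) (A : Finset ℕ) : Decidable (NonOverlapping m A) := by
  unfold NonOverlapping; infer_instance

/-- `nOcc(T,P)`: the size of a largest set of pairwise non-overlapping occurrences of `P` in `T`. -/
def nOcc {α : Type} [DecidableEq α] (T P : List α) : ℕ :=
  ((Occ T P).powerset.filter (NonOverlapping P.length)).sup Finset.card

/-- `(b,e)` delimits a chain of overlapping occurrences of the `q`-gram `P = T[j:j+q-1]` that
contains the occurrence `j`: `b` is an occurrence of `P`, `e` is the end of an occurrence of `P`,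
`b ≤ j ≤ j+q-1 ≤ e`, and every occurrence `k ∈ [b:e-q]` is followed by an occurrence in
`[k+1 : min{k+q-1, e-q+1}]`. -/
def IsOverlappingCover {α : Type} [DecidableEq α] (q : ℕ) (T : List α) (j b e : ℕ) : Prop :=
  b ∈ Occ T (slice T j (j + q - 1)) ∧
  (∃ k ∈ Occ T (slice T j (j + q - 1)), e = (q - 1) + k) ∧
  b ≤ j ∧ j + q - 1 ≤ e ∧
  ∀ k ∈ Occ T (slice T j (j + q - 1)), b ≤ k → k + q ≤ e →
    ∃ k' ∈ Occ T (slice T j (j + q - 1)), k + 1 ≤ k' ∧ k' ≤ min (k + q - 1) (e + 1 - q)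

/-- `(b,e)` is the longest overlapping cover `loc_q(T,j)`. -/
def IsLongestCover {α : Type} [DecidableEq α] (q : ℕ) (T : List α) (j b e : ℕ) : Prop :=
  IsOverlappingCover q T j b e ∧
  ∀ b' e', IsOverlappingCover q T j b' e' → e' - b' ≤ e - b

/-! ## Straight line programs -/

/-- Right-hand side of the `i`-th assignment: a letter, or a pair of earlier variables. -/
inductive SLPRule (α : Type) (i : ℕ) where
  | letter (a : α) : SLPRule α i
  | pair (l r : Fin i) : SLPRule α i

/-- A straight line program with variables `X_0, …, X_{size-1}`. -/
structure SLP (α : Type) where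
  size : ℕ
  size_pos : 0 < size
  rule : (i : Fin size) → SLPRule α i

/-- The string derived from the variable `X_i`. -/
def SLP.val {α : Type} (S : SLP α) (i : Fin S.size) : List α :=
  match S.rule i with
  | .letter a => [a]
  | .pair l r => S.val ⟨l, l.2.trans i.2⟩ ++ S.val ⟨r, r.2.trans i.2⟩
termination_by i.1
decreasing_by
  · exact l.2
  · exact r.2

/-- The string `T` described by the program: the one derived from the last variable. -/
def SLP.text {α : Type} (S : SLP α) : List α :=
  S.val ⟨S.size - 1, Nat.sub_lt S.size_pos Nat.one_pos⟩

/-! ## A word RAM with unit-cost operations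

The memory consists of `b`-bit words: scalar registers and arrays of words, both named by numerals
that are fixed in the program (so that a program uses a fixed number of each). Programs are
structured; they do not depend on the word size `b`. -/

namespace RAM

/-- Word operations: arithmetic modulo `2 ^ b` and comparisons of unsigned words. -/
inductive Op where
  | add | sub | mul | lt | eq

inductive Expr where
  | lit (c : ℕ) : Expr
  | var (x : ℕ) : Expr
  | get (a : ℕ) (i : Expr) : Expr
  | op (o : Op) (e f : Expr) : Expr

inductive Cmd where
  | skip : Cmd
  | assign (x : ℕ) (e : Expr) : Cmd
  | put (a : ℕ) (i e : Expr) : Cmd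
  | seq (c d : Cmd) : Cmd
  | ite (e : Expr) (c d : Cmd) : Cmd
  | while (e : Expr) (c : Cmd) : Cmd

/-- Contents of the memory: `reg x` is a register, `mem a i` the `i`-th cell of the array `a`. -/
structure State (b : ℕ) where
  reg : ℕ → BitVec b
  mem : ℕ → BitVec b → BitVec b

def Op.eval {b : ℕ} : Op → BitVec b → BitVec b → BitVec b
  | .add, u, v => u + v
  | .sub, u, v => u - v
  | .mul, u, v => u * v
  | .lt, u, v => if u.toNat < v.toNat then BitVec.ofNat b 1 else BitVec.ofNat b 0
  | .eq, u, v => if u = v then BitVec.ofNat b 1 else BitVec.ofNat b 0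

def Expr.eval {b : ℕ} (s : State b) : Expr → BitVec b
  | .lit c => BitVec.ofNat b c
  | .var x => s.reg x
  | .get a i => s.mem a (i.eval s)
  | .op o e f => o.eval (e.eval s) (f.eval s)

/-- Number of elementary operations needed to evaluate an expression. -/
def Expr.cost : Expr → ℕ
  | .lit _ => 1
  | .var _ => 1
  | .get _ i => i.cost + 1
  | .op _ e f => e.cost + f.cost + 1

/-- `Exec c s t s'`: started in `s`, the program `c` halts in `s'` after exactly `t` steps. -/
inductive Exec {b : ℕ} : Cmd → State b → ℕ → State b → Prop where
  | skip (s : State b) : Exec .skip s 1 s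
  | assign (s : State b) (x : ℕ) (e : Expr) :
      Exec (.assign x e) s (e.cost + 1)
        ⟨Function.update s.reg x (e.eval s), s.mem⟩
  | put (s : State b) (a : ℕ) (i e : Expr) :
      Exec (.put a i e) s (i.cost + e.cost + 1)
        ⟨s.reg, Function.update s.mem a (Function.update (s.mem a) (i.eval s) (e.eval s))⟩
  | seq {c d : Cmd} {s s' s'' : State b} {t u : ℕ}
      (h₁ : Exec c s t s') (h₂ : Exec d s' u s'') : Exec (.seq c d) s (t + u) s''
  | ite_true {e : Expr} {c d : Cmd} {s s' : State b} {t : ℕ}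
      (he : e.eval s ≠ 0) (h : Exec c s t s') : Exec (.ite e c d) s (e.cost + 1 + t) s'
  | ite_false {e : Expr} {c d : Cmd} {s s' : State b} {t : ℕ}
      (he : e.eval s = 0) (h : Exec d s t s') : Exec (.ite e c d) s (e.cost + 1 + t) s'
  | while_false {e : Expr} {c : Cmd} {s : State b}
      (he : e.eval s = 0) : Exec (.while e c) s (e.cost + 1) s
  | while_true {e : Expr} {c : Cmd} {s s' s'' : State b} {t u : ℕ}
      (he : e.eval s ≠ 0) (h₁ : Exec c s t s') (h₂ : Exec (.while e c) s' u s'') :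
      Exec (.while e c) s (e.cost + 1 + t + u) s''

end RAM

/-! ## Input and output of the problem -/

/-- The memory `s` holds the input.
* Register 0 holds the size `n`, register 1 holds `q`.
* Arrays 0, 1, 2 hold the assignments: `0, a` for `X_i = a` and `1, l, r` for `X_i = X_l X_r`.
* Arrays 3, 4, 5 hold the values that are already computed. For every `X_i = X_l X_r` with
  `|X_i| ≥ q` and every `j` with
  `max{1, |X_l|-2(q-1)+1} ≤ j ≤ min{|X_l|+q-1, |X_i|-q+1}`, the entries `b`, `e` of
  `(b,e) = loc_q(X_i,j)` and `nOcc(X_i[b:e], X_i[j:j+q-1])` are in the cell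
  `3q·i + (j + 2(q-1) - |X_l|)`, where `1 ≤ j + 2(q-1) - |X_l| ≤ 3(q-1)`.
* All other registers and arrays are zero. -/
structure IsInput {σ b : ℕ} (S : SLP (Fin σ)) (q : ℕ) (s : RAM.State b) : Prop where
  size_eq : s.reg 0 = BitVec.ofNat b S.size
  q_eq : s.reg 1 = BitVec.ofNat b q
  letter_rule : ∀ (i : Fin S.size) (a : Fin σ), S.rule i = .letter a →
    s.mem 0 (BitVec.ofNat b i) = BitVec.ofNat b 0 ∧
    s.mem 1 (BitVec.ofNat b i) = BitVec.ofNat b a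
  pair_rule : ∀ (i : Fin S.size) (l r : Fin i), S.rule i = .pair l r →
    s.mem 0 (BitVec.ofNat b i) = BitVec.ofNat b 1 ∧
    s.mem 1 (BitVec.ofNat b i) = BitVec.ofNat b l ∧
    s.mem 2 (BitVec.ofNat b i) = BitVec.ofNat b r
  given : ∀ (i : Fin S.size) (l r : Fin i), S.rule i = .pair l r →
    q ≤ (S.val i).length →
    ∀ j m : ℕ, m = (S.val ⟨l, l.2.trans i.2⟩).length →
      1 ≤ j → m + 1 ≤ j + 2 * (q - 1) → j ≤ m + (q - 1) → j + q ≤ (S.val i).length + 1 →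
      ∃ x y : ℕ, IsLongestCover q (S.val i) j x y ∧
        s.mem 3 (BitVec.ofNat b (3 * q * i + (j + 2 * (q - 1) - m))) = BitVec.ofNat b x ∧
        s.mem 4 (BitVec.ofNat b (3 * q * i + (j + 2 * (q - 1) - m))) = BitVec.ofNat b y ∧
        s.mem 5 (BitVec.ofNat b (3 * q * i + (j + 2 * (q - 1) - m))) =
          BitVec.ofNat b (nOcc (slice (S.val i) x y) (slice (S.val i) j (j + q - 1)))
  reg_zero : ∀ x, 2 ≤ x → s.reg x = 0
  mem_zero : ∀ a, 6 ≤ a → ∀ i, s.mem a i = 0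

/-- The memory `s` holds the output: a list `G`, without repetitions, of all `q`-grams that occur
in `T`, together with their non-overlapping frequencies (all other `q`-grams have frequency 0).
Register 0 holds the number of entries, the letters of the `k`-th `q`-gram are in the cells
`kq, …, kq+q-1` of array 0, and its frequency is in the cell `k` of array 1. -/
def IsOutput {σ b : ℕ} (S : SLP (Fin σ)) (q : ℕ) (s : RAM.State b) : Prop :=
  ∃ G : List (List (Fin σ)), G.Nodup ∧
    (∀ P : List (Fin σ), P ∈ G ↔ P.length = q ∧ (Occ S.text P).Nonempty) ∧
    s.reg 0 = BitVec.ofNat b G.length ∧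
    ∀ (k : ℕ) (hk : k < G.length),
      (∀ (t : ℕ) (ht : t < G[k].length),
        s.mem 0 (BitVec.ofNat b (k * q + t)) = BitVec.ofNat b (G[k][t] : Fin σ)) ∧
      s.mem 1 (BitVec.ofNat b k) = BitVec.ofNat b (nOcc S.text G[k])

/-!
Let `P` be a `q`-gram. Its occurrences in `T` split into clusters, the maximal chains of overlapping
occurrences. Occurrences in different clusters never overlap, so `nOcc(T, P)` is the sum over the
clusters of the largest number of non-overlapping occurrences in a cluster
(`maxSep_eq_sum_clusters`). A longest overlapping cover is a cluster, so the given tables describe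
clusters of variables, and the task is to count every cluster of `T` exactly once.

**Counting.** Consider an occurrence of a variable in the derivation of `T`. A cluster of the variable
is there a cluster of `T`, whatever surrounds it, if at least `q - 1` positions separate it from
every border of the occurrence that is not a border of `T`. Call it safe then. So every variable
carries four counts, the numbers of its occurrences in the derivation of `T` by whether they begin
where `T` begins and whether they end where `T` ends (`Counts`), and `freq` sums the non-overlapping
occurrences in the safe clusters over these occurrences of the variable. A safe cluster of
`X_i = X_l X_r` either is a safe cluster of one child, which is accounted for by passing the counts
of `X_i` on to its children, or it comes close to the border between `X_l` and `X_r`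
(`freq_append`). The latter clusters are found by looking up the given tables at fewer than `3q`
positions (`crossFreq_eq`). A cluster may be found more than once;
only the first time counts, and the first positions of the clusters that were found are stamped to
detect this. Once all counts have been passed on, from `T = X_n` downwards
(`CountInv.step_pair`), `nOcc(T, P)` is a sum over all lookups that yield `P`.

**Grouping.** The lookups yield a list of `O(qn)` weighted `q`-grams. To write them down, the program
computes the first and the last `2q` letters of every variable (`affixCmd_run`); a `q`-gram close to
the border of `X_l` and `X_r` is then read off from the suffix of `X_l` and the prefix of `X_r`
(`itemCmd_run`). Equal `q`-grams of the list are grouped in `q` rounds, one for each position. A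
round splits every class according to the letter at that position: the members of a class are
linked, and a table indexed by letters proposes a representative of the new class. A proposal is
accepted only if it belongs to the class that is being split and has the right letter, so the table
need not be cleared between classes, and a round takes time linear in the number of `q`-grams,
whatever the size of the alphabet (`groupCmd_run`). The sums of the weights over the groups are the
frequencies, and the representatives are the `q`-grams to be printed (`output_of_groups`).

**Words.** All of this is proved for registers and cells that hold natural numbers of any size. `Run`
transfers it to words modulo `2 ^ b`: addition and multiplication respect the reduction, and for
comparisons, subtractions and addresses the bound on `2 ^ b` keeps the operands small. The variables
that do not occur in the derivation of `T` may have lengths that do not fit into a word. For this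
reason the program marks, from `X_n` downwards, the variables that occur in the derivation of `T`,
and treats only those.
-/

/-! ### Clusters of occurrences -/

/-- The largest size of a subset of `O` whose elements are pairwise at distance at least `q`. -/
def maxSep (q : ℕ) (O : Finset ℕ) : ℕ :=
  (O.powerset.filter (NonOverlapping q)).sup Finset.card

theorem card_le_maxSep {q : ℕ} {O A : Finset ℕ} (hA : A ⊆ O) (h : NonOverlapping q A) :
    A.card ≤ maxSep q O :=
  Finset.le_sup (f := Finset.card) (by simp [hA, h])

theorem exists_maxSep (q : ℕ) (O : Finset ℕ) :
    ∃ A ⊆ O, NonOverlapping q A ∧ A.card = maxSep q O := by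
  have hne : (O.powerset.filter (NonOverlapping q)).Nonempty :=
    ⟨∅, by simp [NonOverlapping]⟩
  obtain ⟨A, hA, h⟩ := Finset.exists_mem_eq_sup _ hne Finset.card
  simp only [Finset.mem_filter, Finset.mem_powerset] at hA
  exact ⟨A, hA.1, hA.2, h.symm⟩

theorem maxSep_le_of_shift {q c : ℕ} {O O' : Finset ℕ} (h : ∀ k ∈ O, k + c ∈ O') :
    maxSep q O ≤ maxSep q O' := by
  obtain ⟨A, hA, hn, hc⟩ := exists_maxSep q O
  rw [← hc, ← Finset.card_map (addRightEmbedding c)]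
  apply card_le_maxSep
  · intro k hk
    simp only [Finset.mem_map, addRightEmbedding_apply] at hk
    obtain ⟨a, ha, rfl⟩ := hk
    exact h a (hA ha)
  · intro k₁ h₁ k₂ h₂ hlt
    simp only [Finset.mem_map, addRightEmbedding_apply] at h₁ h₂
    obtain ⟨a, ha, rfl⟩ := h₁
    obtain ⟨a', ha', rfl⟩ := h₂
    have := hn a ha a' ha' (by omega)
    omega

theorem maxSep_eq_of_shift {q c : ℕ} {O O' : Finset ℕ} (h : ∀ k, k ∈ O ↔ k + c ∈ O')
    (h' : ∀ k ∈ O', c ≤ k) : maxSep q O = maxSep q O' := by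
  apply le_antisymm (maxSep_le_of_shift fun k hk => (h k).1 hk)
  obtain ⟨A, hA, hn, hc⟩ := exists_maxSep q O'
  have hinj : Set.InjOn (fun k => k - c) (A : Set ℕ) := by
    intro a ha a' ha' e
    have := h' a (hA ha)
    have := h' a' (hA ha')
    simp only at e
    omega
  rw [← hc, ← Finset.card_image_of_injOn hinj]
  apply card_le_maxSep
  · intro k hk
    simp only [Finset.mem_image] at hk
    obtain ⟨a, ha, rfl⟩ := hk
    rw [h, Nat.sub_add_cancel (h' a (hA ha))]
    exact hA ha
  · intro k₁ h₁ k₂ h₂ hlt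
    simp only [Finset.mem_image] at h₁ h₂
    obtain ⟨a, ha, rfl⟩ := h₁
    obtain ⟨a', ha', rfl⟩ := h₂
    have := h' a (hA ha)
    have := h' a' (hA ha')
    have := hn a ha a' ha' (by omega)
    omega

/-- `[b, f]` delimits a cluster of `O`: a maximal set of elements of `O` in which consecutive
elements are at distance less than `q`. If `O` consists of the occurrences of a `q`-gram, a cluster
is a maximal chain of overlapping occurrences, the first one at `b` and the last one at `f`. -/
def IsCluster (q : ℕ) (O : Finset ℕ) (b f : ℕ) : Prop :=
  b ∈ O ∧ f ∈ O ∧ b ≤ f ∧ (∀ o ∈ O, o < b → o + q ≤ b) ∧ (∀ o ∈ O, f < o → f + q ≤ o) ∧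
  ∀ k ∈ O, b ≤ k → k < f → ∃ k' ∈ O, k < k' ∧ k' < k + q ∧ k' ≤ f

/-- A chain that reaches beyond `h` crosses `h` by a single step of length less than `q`. -/
theorem exists_chain_step {q : ℕ} {O : Finset ℕ} {b f h : ℕ} (hb : b ∈ O)
    (hch : ∀ k ∈ O, b ≤ k → k < f → ∃ k' ∈ O, k < k' ∧ k' < k + q ∧ k' ≤ f)
    (hbh : b ≤ h) (hhf : h < f) :
    ∃ p ∈ O, ∃ p' ∈ O, b ≤ p ∧ p ≤ h ∧ h < p' ∧ p' < p + q ∧ p' ≤ f := by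
  have hne : (O.filter fun k => b ≤ k ∧ k ≤ h).Nonempty := ⟨b, by simp [hb, hbh]⟩
  obtain ⟨p, hp, hmax⟩ := Finset.exists_max_image _ id hne
  simp only [Finset.mem_filter, id] at hp hmax
  obtain ⟨p', hp', h1, h2, h3⟩ := hch p hp.1 hp.2.1 (by omega)
  refine ⟨p, hp.1, p', hp', hp.2.1, hp.2.2, ?_, h2, h3⟩
  by_contra hcon
  have := hmax p' ⟨hp', by omega, by omega⟩
  omega

theorem exists_isCluster {q : ℕ} {O : Finset ℕ} {o : ℕ} (ho : o ∈ O) :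
    ∃ b f, IsCluster q O b f ∧ b ≤ o ∧ o ≤ f := by
  classical
  let ch : ℕ → ℕ → Prop := fun b f =>
    ∀ k ∈ O, b ≤ k → k < f → ∃ k' ∈ O, k < k' ∧ k' < k + q ∧ k' ≤ f
  have hne : (O.filter fun f => o ≤ f ∧ ch o f).Nonempty :=
    ⟨o, by simp only [Finset.mem_filter]; exact ⟨ho, le_rfl, fun k _ h1 h2 => by omega⟩⟩
  obtain ⟨f, hf, hmax⟩ := Finset.exists_max_image _ id hne
  simp only [Finset.mem_filter, id] at hf hmax
  obtain ⟨hfO, hof, hcf⟩ := hf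
  have hend : ∀ o' ∈ O, f < o' → f + q ≤ o' := by
    intro o' ho' hlt
    by_contra hcon
    have := hmax o' ⟨ho', by omega, by
      intro k hk h1 h2
      by_cases hkf : k < f
      · obtain ⟨k', a, b, c, d⟩ := hcf k hk h1 hkf
        exact ⟨k', a, b, c, by omega⟩
      · exact ⟨o', ho', h2, by omega, le_rfl⟩⟩
    omega
  have hne' : (O.filter fun b => b ≤ o ∧ ch b f).Nonempty := ⟨o, by simp [ho, hcf]⟩
  obtain ⟨b, hb, hmin⟩ := Finset.exists_min_image _ id hne'
  simp only [Finset.mem_filter, id] at hb hmin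
  obtain ⟨hbO, hbo, hcb⟩ := hb
  refine ⟨b, f, ⟨hbO, hfO, by omega, ?_, hend, hcb⟩, hbo, hof⟩
  intro o' ho' hlt
  by_contra hcon
  have := hmin o' ⟨ho', by omega, by
    intro k hk h1 h2
    by_cases hkb : b ≤ k
    · exact hcb k hk hkb h2
    · exact ⟨b, hbO, by omega, by omega, by omega⟩⟩
  omega

theorem IsCluster.start_eq {q : ℕ} {O : Finset ℕ} {b f b' f' : ℕ} (h : IsCluster q O b f)
    (h' : IsCluster q O b' f') (hb : b ≤ b') (hf : b' ≤ f) : b = b' := by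
  by_contra hne
  obtain ⟨p, hp, p', -, h1, h2, h3, h4, h5⟩ :=
    exists_chain_step h.1 h.2.2.2.2.2 (h := b' - 1) (by omega) (by omega)
  have := h'.2.2.2.1 p hp (by omega)
  omega

theorem IsCluster.end_eq {q : ℕ} {O : Finset ℕ} {b f f' : ℕ} (h : IsCluster q O b f)
    (h' : IsCluster q O b f') : f = f' := by
  have key : ∀ {f f'}, IsCluster q O b f → IsCluster q O b f' → ¬ f < f' := by
    intro f f' h h' hlt
    obtain ⟨k, hk, h1, h2, h3⟩ := h'.2.2.2.2.2 f h.2.1 h.2.2.1 hlt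
    have := h.2.2.2.2.1 k hk h1
    omega
  have := key h h'
  have := key h' h
  omega

/-- Distinct clusters are at distance at least `q`. -/
theorem IsCluster.eq_or_far {q : ℕ} {O : Finset ℕ} {b f b' f' : ℕ} (h : IsCluster q O b f)
    (h' : IsCluster q O b' f') : (b = b' ∧ f = f') ∨ f + q ≤ b' ∨ f' + q ≤ b := by
  have key : ∀ {b f b' f'}, IsCluster q O b f → IsCluster q O b' f' → b ≤ b' →
      (b = b' ∧ f = f') ∨ f + q ≤ b' := by
    intro b f b' f' h h' hb
    by_cases hf : b' ≤ f
    · obtain rfl := h.start_eq h' hb hf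
      exact .inl ⟨rfl, h.end_eq h'⟩
    · exact .inr (h.2.2.2.2.1 b' h'.1 (by omega))
  rcases le_total b b' with hb | hb
  · rcases key h h' hb with h | h
    · exact .inl h
    · exact .inr (.inl h)
  · rcases key h' h hb with h | h
    · exact .inl ⟨h.1.symm, h.2.symm⟩
    · exact .inr (.inr h)

/-- Being a cluster depends only on the elements in the interval, enlarged by `q - 1` on both
sides. -/
theorem isCluster_congr_shift {q c b f : ℕ} {O O' : Finset ℕ} (hc : q ≤ b ∨ c = 0)
    (h : ∀ k, b ≤ k + (q - 1) → k ≤ f + (q - 1) → (k ∈ O ↔ k + c ∈ O')) :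
    IsCluster q O b f ↔ IsCluster q O' (b + c) (f + c) := by
  constructor
  · rintro ⟨h1, h2, h3, h4, h5, h6⟩
    refine ⟨(h b (by omega) (by omega)).1 h1, (h f (by omega) (by omega)).1 h2, by omega, ?_, ?_, ?_⟩
    · intro o ho hlt
      by_contra hcon
      obtain ⟨o, rfl⟩ : ∃ o', o = o' + c := ⟨o - c, by omega⟩
      have := h4 o ((h o (by omega) (by omega)).2 ho) (by omega)
      omega
    · intro o ho hlt
      by_contra hcon
      obtain ⟨o, rfl⟩ : ∃ o', o = o' + c := ⟨o - c, by omega⟩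
      have := h5 o ((h o (by omega) (by omega)).2 ho) (by omega)
      omega
    · intro k hk hbk hkf
      obtain ⟨k, rfl⟩ : ∃ o', k = o' + c := ⟨k - c, by omega⟩
      obtain ⟨k', a, b, c, d⟩ := h6 k ((h k (by omega) (by omega)).2 hk) (by omega) (by omega)
      exact ⟨k' + _, (h k' (by omega) (by omega)).1 a, by omega, by omega, by omega⟩
  · rintro ⟨h1, h2, h3, h4, h5, h6⟩
    refine ⟨(h b (by omega) (by omega)).2 h1, (h f (by omega) (by omega)).2 h2, by omega, ?_, ?_, ?_⟩
    · intro o ho hlt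
      by_contra hcon
      have := h4 (o + c) ((h o (by omega) (by omega)).1 ho) (by omega)
      omega
    · intro o ho hlt
      by_contra hcon
      have := h5 (o + c) ((h o (by omega) (by omega)).1 ho) (by omega)
      omega
    · intro k hk hbk hkf
      obtain ⟨k', m1, m2, m3, m4⟩ :=
        h6 (k + c) ((h k (by omega) (by omega)).1 hk) (by omega) (by omega)
      obtain ⟨k', rfl⟩ : ∃ o', k' = o' + c := ⟨k' - c, by omega⟩
      exact ⟨k', (h k' (by omega) (by omega)).2 m1, by omega, by omega, by omega⟩

open Classical in
/-- The clusters of `O`, as pairs `(b, f)`. -/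
noncomputable def clusters (q : ℕ) (O : Finset ℕ) : Finset (ℕ × ℕ) :=
  (O ×ˢ O).filter fun p => IsCluster q O p.1 p.2

theorem mem_clusters {q : ℕ} {O : Finset ℕ} {p : ℕ × ℕ} :
    p ∈ clusters q O ↔ IsCluster q O p.1 p.2 := by
  simp only [clusters, Finset.mem_filter, Finset.mem_product, and_iff_right_iff_imp]
  exact fun h => ⟨h.1, h.2.1⟩

/-- The elements of `O` in the interval `[b, f]`. -/
def between (O : Finset ℕ) (b f : ℕ) : Finset ℕ := O.filter fun k => b ≤ k ∧ k ≤ f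

/-- A largest separated set is a union of largest separated sets, one in each cluster. -/
theorem maxSep_eq_sum_clusters {q : ℕ} (hq : 1 ≤ q) (O : Finset ℕ) :
    maxSep q O = ∑ p ∈ clusters q O, maxSep q (between O p.1 p.2) := by
  apply le_antisymm
  · obtain ⟨A, hA, hn, hc⟩ := exists_maxSep q O
    rw [← hc]
    calc A.card ≤ ((clusters q O).biUnion fun p => between A p.1 p.2).card := by
          apply Finset.card_le_card
          intro k hk
          obtain ⟨b, f, hcl, h1, h2⟩ := exists_isCluster (q := q) (hA hk)
          simp only [Finset.mem_biUnion]
          exact ⟨(b, f), mem_clusters.2 hcl, by simp [between, hk, h1, h2]⟩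
      _ ≤ ∑ p ∈ clusters q O, (between A p.1 p.2).card := Finset.card_biUnion_le
      _ ≤ _ := by
          apply Finset.sum_le_sum
          intro p _
          apply card_le_maxSep
          · exact Finset.filter_subset_filter _ hA
          · exact fun k₁ h₁ k₂ h₂ =>
              hn k₁ (Finset.mem_filter.1 h₁).1 k₂ (Finset.mem_filter.1 h₂).1
  · choose A hA hn hc using fun p : ℕ × ℕ => exists_maxSep q (between O p.1 p.2)
    have hmem : ∀ p, ∀ k ∈ A p, k ∈ O ∧ p.1 ≤ k ∧ k ≤ p.2 := fun p k hk => by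
      simpa [between] using hA p hk
    rw [Finset.sum_congr rfl fun p _ => (hc p).symm, ← Finset.card_biUnion]
    · apply card_le_maxSep
      · intro k hk
        obtain ⟨p, -, hk⟩ := Finset.mem_biUnion.1 hk
        exact (hmem p k hk).1
      · intro k₁ h₁ k₂ h₂ hlt
        obtain ⟨p, hp, h₁⟩ := Finset.mem_biUnion.1 h₁
        obtain ⟨p', hp', h₂⟩ := Finset.mem_biUnion.1 h₂
        have m₁ := hmem p k₁ h₁
        have m₂ := hmem p' k₂ h₂
        rcases (mem_clusters.1 hp).eq_or_far (mem_clusters.1 hp') with h | h | h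
        · obtain rfl : p = p' := Prod.ext h.1 h.2
          exact hn p k₁ h₁ k₂ h₂ hlt
        · omega
        · omega
    · intro p hp p' hp' hne
      rw [Function.onFun, Finset.disjoint_left]
      intro k h₁ h₂
      have m₁ := hmem p k h₁
      have m₂ := hmem p' k h₂
      have c₁ := (mem_clusters.1 hp).2.2.1
      have c₂ := (mem_clusters.1 hp').2.2.1
      rcases (mem_clusters.1 hp).eq_or_far (mem_clusters.1 hp') with h | h | h
      · exact hne (Prod.ext h.1 h.2)
      · omega
      · omega

/-! ### Occurrences in concatenations -/

section Occurrences

variable {α : Type} [DecidableEq α]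

theorem mem_Occ {w P : List α} (hP : P ≠ []) {k : ℕ} :
    k ∈ Occ w P ↔ 1 ≤ k ∧ P <+: w.drop (k - 1) := by
  have hl : 0 < P.length := List.length_pos_iff.2 hP
  have e : k + P.length - 1 + 1 - k = P.length := by omega
  rw [Occ, Finset.mem_filter, Finset.mem_Icc, slice, e, List.prefix_iff_eq_take]
  constructor
  · rintro ⟨h1, h2⟩
    exact ⟨h1.1, h2.symm⟩
  · rintro ⟨h1, h2⟩
    refine ⟨⟨h1, ?_⟩, h2.symm⟩
    have := congrArg List.length h2
    simp only [List.length_take, List.length_drop] at this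
    omega

theorem le_length_of_mem_Occ {w P : List α} {k : ℕ} (h : k ∈ Occ w P) :
    1 ≤ k ∧ k + P.length ≤ w.length + 1 := by
  rw [Occ, Finset.mem_filter, Finset.mem_Icc, slice] at h
  have := congrArg List.length h.2
  simp only [List.length_take, List.length_drop] at this
  omega

theorem mem_Occ_append_left {u v P : List α} (hP : P ≠ []) {k : ℕ}
    (hk : k + P.length ≤ u.length + 1) : k ∈ Occ (u ++ v) P ↔ k ∈ Occ u P := by
  rw [mem_Occ hP, mem_Occ hP]
  refine and_congr_right fun h1 => ?_
  rw [List.drop_append_of_le_length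
    (by have := List.length_pos_iff.2 hP; omega)]
  constructor
  · intro h
    exact List.prefix_of_prefix_length_le h (List.prefix_append _ _)
      (by rw [List.length_drop]; omega)
  · exact fun h => h.trans (List.prefix_append _ _)

theorem mem_Occ_append_right {u v P : List α} (hP : P ≠ []) {k : ℕ} (hk : 1 ≤ k) :
    k + u.length ∈ Occ (u ++ v) P ↔ k ∈ Occ v P := by
  rw [mem_Occ hP, mem_Occ hP, show k + u.length - 1 = u.length + (k - 1) by omega,
    List.drop_append]
  simp only [Nat.add_sub_cancel_left]
  rw [List.drop_eq_nil_of_le (by omega : u.length ≤ u.length + (k - 1)), List.nil_append]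
  exact and_congr_left fun _ => by omega

theorem slice_mem_Occ {w : List α} {j q : ℕ} (hq : 1 ≤ q) (hj : 1 ≤ j)
    (hjq : j + q ≤ w.length + 1) :
    (slice w j (j + q - 1)).length = q ∧ j ∈ Occ w (slice w j (j + q - 1)) := by
  have hl : (slice w j (j + q - 1)).length = q := by
    simp only [slice, List.length_take, List.length_drop]
    omega
  refine ⟨hl, ?_⟩
  simp only [Occ, Finset.mem_filter, Finset.mem_Icc, hl, and_true]
  omega

theorem slice_eq_of_mem_Occ {w P : List α} {k : ℕ} (h : k ∈ Occ w P) :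
    slice w k (k + P.length - 1) = P := (Finset.mem_filter.1 h).2

/-- The occurrences in a substring are the occurrences that lie in it. -/
theorem nOcc_slice {w P : List α} (hP : P ≠ []) {x y : ℕ} (hx : 1 ≤ x) (hy : y ≤ w.length) :
    nOcc (slice w x y) P = maxSep P.length (between (Occ w P) x (y + 1 - P.length)) := by
  have hl : 0 < P.length := List.length_pos_iff.2 hP
  have key : ∀ k, k ∈ Occ (slice w x y) P ↔
      k + (x - 1) ∈ between (Occ w P) x (y + 1 - P.length) := by
    intro k
    rcases Nat.eq_zero_or_pos k with rfl | hk
    · simp only [between, Finset.mem_filter]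
      constructor
      · intro h
        have := le_length_of_mem_Occ h
        omega
      · omega
    · by_cases hfit : k + (x - 1) + P.length ≤ y + 1
      · have e : w = (w.take (x - 1) ++ slice w x y) ++ (w.drop (x - 1)).drop (y + 1 - x) := by
          rw [slice, List.append_assoc, List.take_append_drop, List.take_append_drop]
        have l1 : (w.take (x - 1)).length = x - 1 := by rw [List.length_take]; omega
        have l2 : (slice w x y).length = y + 1 - x := by
          simp only [slice, List.length_take, List.length_drop]; omega
        have h1 : k + (x - 1) ∈ Occ w P ↔ k ∈ Occ (slice w x y) P := by
          conv_lhs => rw [e]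
          rw [mem_Occ_append_left hP (by rw [List.length_append, l1, l2]; omega)]
          have := mem_Occ_append_right (u := w.take (x - 1)) (v := slice w x y) hP hk
          rwa [l1] at this
        simp only [between, Finset.mem_filter, h1]
        constructor
        · exact fun h => ⟨h, by omega, by omega⟩
        · exact fun h => h.1
      · constructor
        · intro h
          have := le_length_of_mem_Occ h
          simp only [slice, List.length_take, List.length_drop] at this
          omega
        · simp only [between, Finset.mem_filter]
          omega
  exact maxSep_eq_of_shift key fun k hk => by
    simp only [between, Finset.mem_filter] at hk
    omega

/-- The longest overlapping cover of an occurrence is the cluster that contains it. -/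
theorem IsLongestCover.isCluster {w : List α} {q j x y : ℕ} (hq : 1 ≤ q)
    (h : IsLongestCover q w j x y) :
    IsCluster q (Occ w (slice w j (j + q - 1))) x (y - (q - 1)) ∧ x ≤ j ∧ j + (q - 1) ≤ y := by
  obtain ⟨⟨h1, ⟨f, hf, rfl⟩, h3, h4, h5⟩, hmax⟩ := h
  have hy : q - 1 + f - (q - 1) = f := by omega
  rw [hy]
  have hch : ∀ k ∈ Occ w (slice w j (j + q - 1)), x ≤ k → k < f →
      ∃ k' ∈ Occ w (slice w j (j + q - 1)), k < k' ∧ k' < k + q ∧ k' ≤ f := by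
    intro k hk hxk hkf
    obtain ⟨k', a, b, c⟩ := h5 k hk hxk (by omega)
    exact ⟨k', a, by omega, by omega, by omega⟩
  refine ⟨⟨h1, hf, by omega, ?_, ?_, hch⟩, h3, by omega⟩
  · intro o ho hlt
    by_contra hcon
    have := hmax o (q - 1 + f) ⟨ho, ⟨f, hf, rfl⟩, by omega, h4, by
      intro k hk h6 h7
      by_cases hxk : x ≤ k
      · exact h5 k hk hxk h7
      · exact ⟨x, h1, by omega, by omega⟩⟩
    omega
  · intro o ho hlt
    by_contra hcon
    have := hmax x (q - 1 + o) ⟨h1, ⟨o, ho, rfl⟩, h3, by omega, by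
      intro k hk h6 h7
      by_cases hkf : k < f
      · obtain ⟨k', a, b, c, d⟩ := hch k hk h6 hkf
        exact ⟨k', a, by omega, by omega⟩
      · exact ⟨o, ho, by omega, by omega⟩⟩
    omega

end Occurrences

/-! ### Weighted frequencies and their recursion along a straight line program -/

/-- How often a variable occurs in the derivation tree of the text, split into four kinds: `tt` for
occurrences that span the whole text, `tf` for those that are proper prefixes of the text, `ft` for
those that are proper suffixes, `ff` for the others. A border of the variable that is
also a border of the text is never crossed by a cluster. -/
structure Counts where
  tt : ℕ
  tf : ℕ
  ft : ℕ
  ff : ℕ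

namespace Counts

/-- The contribution of `c` occurrences of `X_l X_r` to the counts of `X_l`. -/
def left (c : Counts) : Counts := ⟨0, c.tt + c.tf, 0, c.ft + c.ff⟩

/-- The contribution of `c` occurrences of `X_l X_r` to the counts of `X_r`. -/
def right (c : Counts) : Counts := ⟨0, 0, c.tt + c.ft, c.tf + c.ff⟩

instance : Add Counts := ⟨fun c d => ⟨c.tt + d.tt, c.tf + d.tf, c.ft + d.ft, c.ff + d.ff⟩⟩

instance : Zero Counts := ⟨⟨0, 0, 0, 0⟩⟩

theorem add_def (c d : Counts) :
    c + d = ⟨c.tt + d.tt, c.tf + d.tf, c.ft + d.ft, c.ff + d.ff⟩ := rfl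

theorem zero_def : (0 : Counts) = ⟨0, 0, 0, 0⟩ := rfl

/-- The number of occurrences of a variable of length `len` at which a cluster with first
occurrence `b` and last occurrence `f` is at distance at least `q - 1` from both borders of the
variable; borders of the text do not matter. Whatever surrounds the variable, such a cluster cannot
be extended. -/
def weight (c : Counts) (q len b f : ℕ) : ℕ :=
  c.tt + (if q ≤ b then c.ft else 0) + (if f + 2 * (q - 1) ≤ len then c.tf else 0) +
    (if q ≤ b ∧ f + 2 * (q - 1) ≤ len then c.ff else 0)

end Counts

section Freq

variable {α : Type} [DecidableEq α]

/-- The number of non-overlapping occurrences of `P` that lie in clusters of `w`, where each cluster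
is counted with its weight. -/
noncomputable def freq (c : Counts) (w P : List α) : ℕ :=
  ∑ p ∈ clusters P.length (Occ w P),
    c.weight P.length w.length p.1 p.2 * maxSep P.length (between (Occ w P) p.1 p.2)

/-- The part of `freq c (u ++ v) P` that is due to clusters close to the border of `u` and `v`. -/
noncomputable def crossFreq (c : Counts) (u v P : List α) : ℕ :=
  ∑ p ∈ (clusters P.length (Occ (u ++ v) P)).filter
      fun p => p.1 < u.length + P.length ∧ u.length < p.2 + 2 * (P.length - 1),
    c.weight P.length (u ++ v).length p.1 p.2 *
      maxSep P.length (between (Occ (u ++ v) P) p.1 p.2)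

theorem freq_add (c d : Counts) (w P : List α) : freq (c + d) w P = freq c w P + freq d w P := by
  rw [freq, freq, freq, ← Finset.sum_add_distrib]
  refine Finset.sum_congr rfl fun p _ => ?_
  rw [← add_mul]
  congr 1
  simp only [Counts.weight, Counts.add_def]
  split_ifs <;> omega

theorem freq_zero (w P : List α) : freq 0 w P = 0 := by
  simp [freq, Counts.weight, Counts.zero_def]

/-- At the root, whose borders are the borders of the text, all clusters count. -/
theorem freq_text {P : List α} (hP : P ≠ []) (w : List α) :
    freq ⟨1, 0, 0, 0⟩ w P = nOcc w P := by
  rw [show nOcc w P = maxSep P.length (Occ w P) from rfl,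
    maxSep_eq_sum_clusters (List.length_pos_iff.2 hP)]
  simp [freq, Counts.weight]

/-- The recursion along `X_i = X_l X_r`: a cluster that ends at least `q - 1` positions before
the border of `u` and `v` is a cluster of `u`, one that begins at least `q - 1` positions after it
is a cluster of `v`, and the weights agree. -/
theorem freq_append {P : List α} (hP : P ≠ []) (c : Counts) (u v : List α) :
    freq c (u ++ v) P = crossFreq c u v P + (freq c.left u P + freq c.right v P) := by
  classical
  have hl : 0 < P.length := List.length_pos_iff.2 hP
  set q := P.length with hq
  have hO : ∀ k, k ∈ Occ (u ++ v) P → 1 ≤ k ∧ k + q ≤ (u ++ v).length + 1 := fun k h =>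
    le_length_of_mem_Occ h
  rw [freq, ← Finset.sum_filter_add_sum_filter_not _
    fun p : ℕ × ℕ => p.1 < u.length + q ∧ u.length < p.2 + 2 * (q - 1)]
  rw [← hq]
  congr 1
  rw [← Finset.sum_filter_add_sum_filter_not _ fun p : ℕ × ℕ => p.2 + 2 * (q - 1) ≤ u.length]
  rw [Finset.filter_filter, Finset.filter_filter]
  congr 1
  · -- clusters inside `u`, sufficiently far from its right end
    have hcl : ∀ p : ℕ × ℕ, p.2 + 2 * (q - 1) ≤ u.length →
        (p ∈ clusters q (Occ (u ++ v) P) ↔ p ∈ clusters q (Occ u P)) := by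
      intro p hp
      rw [mem_clusters, mem_clusters]
      exact isCluster_congr_shift (c := 0) (.inr rfl) fun k _ hk =>
        mem_Occ_append_left hP (by omega)
    rw [freq, ← hq, ← Finset.sum_filter_add_sum_filter_not (clusters q (Occ u P))
      fun p : ℕ × ℕ => p.2 + 2 * (q - 1) ≤ u.length]
    rw [Finset.sum_eq_zero
      (s := (clusters q (Occ u P)).filter fun p => ¬ p.2 + 2 * (q - 1) ≤ u.length), add_zero]
    · apply Finset.sum_congr
      · ext p
        simp only [Finset.mem_filter]
        constructor
        · rintro ⟨h1, -, h3⟩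
          exact ⟨(hcl p h3).1 h1, h3⟩
        · rintro ⟨h1, h3⟩
          exact ⟨(hcl p h3).2 h1, by omega, h3⟩
      · intro p hp
        simp only [Finset.mem_filter] at hp
        congr 1
        · simp only [Counts.weight, Counts.left, List.length_append]
          split_ifs <;> omega
        · congr 1
          ext k
          simp only [between, Finset.mem_filter]
          refine and_congr_left fun hk => mem_Occ_append_left hP (by omega)
    · intro p hp
      simp only [Finset.mem_filter] at hp
      simp [Counts.weight, Counts.left, hp.2]
  · -- clusters inside `v`, sufficiently far from its left end
    have hmem : ∀ k, 1 ≤ k → (k ∈ Occ v P ↔ k + u.length ∈ Occ (u ++ v) P) := fun k hk =>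
      (mem_Occ_append_right hP hk).symm
    have hcl : ∀ p : ℕ × ℕ, q ≤ p.1 →
        (p ∈ clusters q (Occ v P) ↔ (p.1 + u.length, p.2 + u.length) ∈
          clusters q (Occ (u ++ v) P)) := by
      intro p hp
      rw [mem_clusters, mem_clusters]
      exact isCluster_congr_shift (.inl hp) fun k hk _ => hmem k (by omega)
    rw [freq, ← hq, ← Finset.sum_filter_add_sum_filter_not (clusters q (Occ v P))
      fun p : ℕ × ℕ => q ≤ p.1]
    rw [Finset.sum_eq_zero (s := (clusters q (Occ v P)).filter fun p => ¬ q ≤ p.1), add_zero]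
    · symm
      refine Finset.sum_nbij' (fun p => (p.1 + u.length, p.2 + u.length))
        (fun p => (p.1 - u.length, p.2 - u.length)) ?_ ?_ ?_ ?_ ?_
      · intro p hp
        simp only [Finset.mem_filter] at hp ⊢
        have := (mem_clusters.1 hp.1).2.2.1
        exact ⟨(hcl p hp.2).1 hp.1, by omega, by omega⟩
      · intro p hp
        simp only [Finset.mem_filter] at hp ⊢
        have hc := (mem_clusters.1 hp.1).2.2.1
        have hb : q ≤ p.1 - u.length := by omega
        refine ⟨(hcl _ hb).2 ?_, hb⟩
        convert hp.1 using 1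
        ext <;> simp only <;> omega
      · intro p _
        simp
      · intro p hp
        simp only [Finset.mem_filter] at hp
        have hc := (mem_clusters.1 hp.1).2.2.1
        ext <;> simp only <;> omega
      · intro p hp
        simp only [Finset.mem_filter] at hp
        congr 1
        · simp only [Counts.weight, Counts.right, List.length_append]
          split_ifs <;> omega
        · refine maxSep_eq_of_shift (c := u.length) ?_ ?_
          · intro k
            simp only [between, Finset.mem_filter]
            constructor
            · rintro ⟨h1, h2, h3⟩
              exact ⟨(hmem k (by omega)).1 h1, by omega, by omega⟩
            · rintro ⟨h1, h2, h3⟩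
              exact ⟨(hmem k (by omega)).2 h1, by omega, by omega⟩
          · intro k hk
            simp only [between, Finset.mem_filter] at hk
            omega
    · intro p hp
      simp only [Finset.mem_filter] at hp
      simp [Counts.weight, Counts.right, hp.2]

/-- Letters contribute only if `q = 1`. -/
theorem freq_singleton (c : Counts) (a : α) {P : List α} (hP : P ≠ []) :
    freq c [a] P = if P = [a] then c.tt + c.tf + c.ft + c.ff else 0 := by
  have hl : 0 < P.length := List.length_pos_iff.2 hP
  split_ifs with h
  · subst h
    have hO : Occ [a] [a] = {1} := by
      ext k
      simp only [Finset.mem_singleton]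
      constructor
      · intro h
        have := le_length_of_mem_Occ h
        simp only [List.length_singleton] at this
        omega
      · rintro rfl
        exact (mem_Occ (by simp)).2 ⟨le_rfl, by simp⟩
    have hc : clusters 1 {1} = {(1, 1)} := by
      ext p
      rw [mem_clusters, Finset.mem_singleton]
      constructor
      · intro h
        exact Prod.ext (Finset.mem_singleton.1 h.1) (Finset.mem_singleton.1 h.2.1)
      · rintro rfl
        simp [IsCluster]
    have hb : maxSep 1 (between {1} 1 1) = 1 := by decide
    simp [freq, hO, hc, hb, Counts.weight]
    omega
  · have hO : Occ [a] P = ∅ := by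
      ext k
      simp only [Finset.notMem_empty, iff_false]
      intro hk
      have h1 := le_length_of_mem_Occ hk
      simp only [List.length_singleton] at h1
      have h2 := ((mem_Occ hP).1 hk).2
      rw [show k - 1 = 0 by omega, List.drop_zero] at h2
      exact h (h2.eq_of_length (by simp only [List.length_singleton]; omega))
    simp [freq, hO, clusters]

end Freq

section Crossing

variable {α : Type} [DecidableEq α]

/-- The `o`-th position at which a `q`-gram of a string of length `len` is looked up, when the
string is the concatenation of a string of length `m` and another one. -/
def lookupPos (q m o : ℕ) : ℕ := o + 1 + m - 2 * (q - 1)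

/-- The `o`-th position to be looked up is the position of a `q`-gram. -/
def ValidLookup (q m len o : ℕ) : Prop :=
  2 * (q - 1) < o + 1 + m ∧ o + 1 + m + q < len + 2 + 2 * (q - 1)

instance (q m len o : ℕ) : Decidable (ValidLookup q m len o) := by
  unfold ValidLookup; infer_instance

/-- The `q`-gram of `w` at the `o`-th position to be looked up. -/
def lookupGram (q m : ℕ) (w : List α) (o : ℕ) : List α :=
  slice w (lookupPos q m o) (lookupPos q m o + q - 1)

/-- The cluster found by the `o`-th lookup has not been found by an earlier one. Clusters of
different `q`-grams have different first positions. -/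
def FreshLookup (q m len : ℕ) (xs : ℕ → ℕ) (o : ℕ) : Prop :=
  ∀ o' < o, ValidLookup q m len o' → xs o' ≠ xs o

theorem lookup_spec {q : ℕ} (hq : 1 ≤ q) {u v : List α} {o : ℕ}
    (ho : ValidLookup q u.length (u ++ v).length o) :
    (lookupGram q u.length (u ++ v) o).length = q ∧
      lookupPos q u.length o ∈ Occ (u ++ v) (lookupGram q u.length (u ++ v) o) := by
  unfold ValidLookup at ho
  apply slice_mem_Occ hq <;> unfold lookupPos <;> omega

open Classical in
/-- Every cluster close to the border of `u` and `v` is found by a lookup: it has an occurrence in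
the range of positions that are looked up, because a chain cannot jump over `q - 1` consecutive
positions. Only the first lookup that finds it is counted. -/
theorem crossFreq_eq {q : ℕ} (hq : 1 ≤ q) (c : Counts) (u v P : List α) (hP : P.length = q)
    (xs ys : ℕ → ℕ)
    (h : ∀ o < 3 * (q - 1), ValidLookup q u.length (u ++ v).length o →
      IsLongestCover q (u ++ v) (lookupPos q u.length o) (xs o) (ys o)) :
    crossFreq c u v P = ∑ o ∈ (Finset.range (3 * (q - 1))).filter fun o =>
        (ValidLookup q u.length (u ++ v).length o ∧
          FreshLookup q u.length (u ++ v).length xs o) ∧ lookupGram q u.length (u ++ v) o = P,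
      c.weight q (u ++ v).length (xs o) (ys o - (q - 1)) *
        nOcc (slice (u ++ v) (xs o) (ys o)) (lookupGram q u.length (u ++ v) o) := by
  have hP0 : P ≠ [] := by rintro rfl; simp at hP; omega
  set w := u ++ v with hw
  set m := u.length with hm
  have hdat : ∀ o < 3 * (q - 1), ValidLookup q m w.length o →
      IsCluster q (Occ w (lookupGram q m w o)) (xs o) (ys o - (q - 1)) ∧
      xs o ≤ lookupPos q m o ∧ lookupPos q m o + (q - 1) ≤ ys o :=
    fun o ho hv => (h o ho hv).isCluster hq
  symm
  rw [crossFreq, hP]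
  refine Finset.sum_nbij (fun o => (xs o, ys o - (q - 1))) ?_ ?_ ?_ ?_
  · intro o ho
    simp only [Finset.mem_filter, Finset.mem_range] at ho
    obtain ⟨ho, ⟨hv, -⟩, hg⟩ := ho
    have hd := hdat o ho hv
    rw [hg] at hd
    simp only [Finset.mem_filter, mem_clusters]
    refine ⟨hd.1, ?_⟩
    simp only [lookupPos, ValidLookup] at hd hv
    omega
  · intro o ho o' ho' he
    simp only [Finset.coe_filter, Set.mem_ofPred_eq, Finset.mem_range, Prod.mk.injEq] at ho ho' he
    by_contra hne
    rcases Nat.lt_or_gt_of_ne hne with hlt | hlt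
    · exact ho'.2.1.2 o hlt ho.2.1.1 he.1
    · exact ho.2.1.2 o' hlt ho'.2.1.1 he.1.symm
  · intro p hp
    simp only [Finset.coe_filter, Set.mem_ofPred_eq, mem_clusters] at hp
    obtain ⟨hc, hb, hf⟩ := hp
    -- An occurrence in the range that is looked up: the first one of the cluster, or the first one
    -- after the left end of the range.
    obtain ⟨j, hj, hj1, hj2, hj3, hj4⟩ : ∃ j ∈ Occ w P, p.1 ≤ j ∧ j ≤ p.2 ∧
        m + 1 ≤ j + 2 * (q - 1) ∧ j ≤ m + (q - 1) := by
      by_cases hlo : m + 1 ≤ p.1 + 2 * (q - 1)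
      · exact ⟨p.1, hc.1, le_rfl, hc.2.2.1, hlo, by omega⟩
      · obtain ⟨a, -, j, hj, h1, h2, h3, h4, h5⟩ :=
          exists_chain_step hc.1 hc.2.2.2.2.2 (h := m - 2 * (q - 1)) (by omega) (by omega)
        exact ⟨j, hj, by omega, h5, by omega, by omega⟩
    have hjl := le_length_of_mem_Occ hj
    rw [hP] at hjl
    have hex : ∃ o, o < 3 * (q - 1) ∧ ValidLookup q m w.length o ∧ xs o = p.1 := by
      have hpos : lookupPos q m (j + 2 * (q - 1) - m - 1) = j := by unfold lookupPos; omega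
      have hv : ValidLookup q m w.length (j + 2 * (q - 1) - m - 1) := by
        unfold ValidLookup; omega
      have hlt : j + 2 * (q - 1) - m - 1 < 3 * (q - 1) := by omega
      refine ⟨_, hlt, hv, ?_⟩
      have hd := hdat _ hlt hv
      have hg : lookupGram q m w (j + 2 * (q - 1) - m - 1) = P := by
        rw [lookupGram, hpos, ← slice_eq_of_mem_Occ hj, hP]
      rw [hg, hpos] at hd
      rcases hd.1.eq_or_far hc with h | h | h
      · exact h.1
      · omega
      · omega
    obtain ⟨ho, hv, hx⟩ := Nat.find_spec hex
    have hmin := fun {o} => Nat.find_min (m := o) hex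
    set o := Nat.find hex
    have hd := hdat o ho hv
    have hgl : (lookupGram q m w o).length = q := (lookup_spec hq hv).1
    have hg : lookupGram q m w o = P := by
      have h1 := slice_eq_of_mem_Occ hd.1.1
      have h2 := slice_eq_of_mem_Occ hc.1
      rw [← h1, ← h2, hgl, hP, hx]
    rw [hg] at hd
    refine ⟨o, ?_, Prod.ext hx ?_⟩
    · simp only [Finset.coe_filter, Set.mem_ofPred_eq, Finset.mem_range]
      exact ⟨ho, ⟨hv, fun o' ho' hv' he => hmin ho' ⟨by omega, hv', he.trans hx⟩⟩, hg⟩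
    · rw [hx] at hd
      exact hd.1.end_eq hc
  · intro o ho
    simp only [Finset.mem_filter, Finset.mem_range] at ho
    obtain ⟨ho, ⟨hv, -⟩, hg⟩ := ho
    have hd := hdat o ho hv
    have hf := le_length_of_mem_Occ hd.1.2.1
    have hb := le_length_of_mem_Occ hd.1.1
    rw [hg, hP] at hf hb
    rw [hg, nOcc_slice hP0 hb.1 (by omega), hP]
    congr 3
    omega

end Crossing

/-! ### Reasoning about programs over the natural numbers -/

namespace RAM

/-- A memory whose registers and cells hold natural numbers of any size. -/
structure NState where
  reg : ℕ → ℕ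
  mem : ℕ → ℕ → ℕ

namespace NState

/-- Writes `v` to the register `x`. -/
def setReg (N : NState) (x v : ℕ) : NState := ⟨Function.update N.reg x v, N.mem⟩

/-- Writes `v` to the cell `i` of the array `a`. -/
def setMem (N : NState) (a i v : ℕ) : NState :=
  ⟨N.reg, Function.update N.mem a (Function.update (N.mem a) i v)⟩

theorem setReg_reg (N : NState) (x v y : ℕ) :
    (N.setReg x v).reg y = if y = x then v else N.reg y := by
  simp [setReg, Function.update_apply]

theorem setReg_mem (N : NState) (x v : ℕ) : (N.setReg x v).mem = N.mem := rfl

theorem setMem_reg (N : NState) (a i v : ℕ) : (N.setMem a i v).reg = N.reg := rfl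

theorem setMem_mem (N : NState) (a i v a' j : ℕ) :
    (N.setMem a i v).mem a' j = if a' = a then (if j = i then v else N.mem a j) else N.mem a' j := by
  simp only [setMem, Function.update_apply]
  split_ifs <;> simp_all

theorem setMem_mem_of_ne (N : NState) (a i v a' : ℕ) (h : a' ≠ a) :
    (N.setMem a i v).mem a' = N.mem a' := by
  simp [setMem, h]

end NState

/-- The words in `s` are the remainders of the numbers in `N` modulo `2 ^ b`. -/
structure Represents {b : ℕ} (s : State b) (N : NState) : Prop where
  reg : ∀ x, s.reg x = BitVec.ofNat b (N.reg x)
  mem : ∀ a i, i < 2 ^ b → s.mem a (BitVec.ofNat b i) = BitVec.ofNat b (N.mem a i)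

/-- Word operations on natural numbers. -/
def Op.nev : Op → ℕ → ℕ → ℕ
  | .add, u, v => u + v
  | .sub, u, v => u - v
  | .mul, u, v => u * v
  | .lt, u, v => if u < v then 1 else 0
  | .eq, u, v => if u = v then 1 else 0

/-- The operands are such that the operation on words of size `W` agrees with the one on natural
numbers. Sums and products need no bound, since reduction modulo `W` respects them. -/
def Op.Safe (W : ℕ) : Op → ℕ → ℕ → Prop
  | .add, _, _ => True
  | .sub, u, v => v ≤ u
  | .mul, _, _ => True
  | .lt, u, v => u < W ∧ v < W
  | .eq, u, v => u < W ∧ v < W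

/-- The value of an expression over the natural numbers. -/
def Expr.nev (N : NState) : Expr → ℕ
  | .lit c => c
  | .var x => N.reg x
  | .get a i => N.mem a (i.nev N)
  | .op o e f => o.nev (e.nev N) (f.nev N)

/-- The evaluation of an expression on words agrees with the one on natural numbers. -/
def Expr.Safe (W : ℕ) (N : NState) : Expr → Prop
  | .lit _ => True
  | .var _ => True
  | .get _ i => i.Safe W N ∧ i.nev N < W
  | .op o e f => e.Safe W N ∧ f.Safe W N ∧ o.Safe W (e.nev N) (f.nev N)

theorem ofNat_inj {b u v : ℕ} (hu : u < 2 ^ b) (hv : v < 2 ^ b) :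
    BitVec.ofNat b u = BitVec.ofNat b v ↔ u = v := by
  constructor
  · intro h
    have := congrArg BitVec.toNat h
    rwa [BitVec.toNat_ofNat, BitVec.toNat_ofNat, Nat.mod_eq_of_lt hu, Nat.mod_eq_of_lt hv] at this
  · rintro rfl
    rfl

theorem Op.eval_ofNat {b u v : ℕ} (o : Op) (h : o.Safe (2 ^ b) u v) :
    o.eval (BitVec.ofNat b u) (BitVec.ofNat b v) = BitVec.ofNat b (o.nev u v) := by
  cases o with
  | add => exact (BitVec.ofNat_add ..).symm
  | mul => exact (BitVec.ofNat_mul ..).symm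
  | sub =>
    simp only [Op.eval, Op.nev, Op.Safe] at *
    obtain ⟨d, rfl⟩ := Nat.exists_eq_add_of_le h
    rw [BitVec.ofNat_add, Nat.add_sub_cancel_left]
    rw [BitVec.add_comm, BitVec.add_sub_cancel]
  | lt =>
    simp only [Op.eval, Op.nev, Op.Safe] at *
    rw [BitVec.toNat_ofNat, BitVec.toNat_ofNat, Nat.mod_eq_of_lt h.1, Nat.mod_eq_of_lt h.2]
    split_ifs <;> rfl
  | eq =>
    simp only [Op.eval, Op.nev, Op.Safe] at *
    simp only [ofNat_inj h.1 h.2]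
    split_ifs <;> rfl

theorem Expr.eval_eq {b : ℕ} {s : State b} {N : NState} (hr : Represents s N) (e : Expr)
    (h : e.Safe (2 ^ b) N) : e.eval s = BitVec.ofNat b (e.nev N) := by
  induction e with
  | lit c => rfl
  | var x => exact hr.reg x
  | get a i ih =>
    simp only [Expr.eval, Expr.nev]
    rw [ih h.1, hr.mem a _ h.2]
  | op o e f ihe ihf =>
    simp only [Expr.eval, Expr.nev]
    rw [ihe h.1, ihf h.2.1, Op.eval_ofNat o h.2.2]

theorem Represents.setReg {b : ℕ} {s : State b} {N : NState} (h : Represents s N) (x v : ℕ) :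
    Represents (⟨Function.update s.reg x (BitVec.ofNat b v), s.mem⟩ : State b) (N.setReg x v) where
  reg y := by
    simp only [NState.setReg, Function.update_apply]
    split_ifs
    · rfl
    · exact h.reg y
  mem := h.mem

theorem Represents.setMem {b : ℕ} {s : State b} {N : NState} (h : Represents s N) (a v : ℕ) {i : ℕ}
    (hi : i < 2 ^ b) :
    Represents (⟨s.reg, Function.update s.mem a
      (Function.update (s.mem a) (BitVec.ofNat b i) (BitVec.ofNat b v))⟩ : State b)
      (N.setMem a i v) where
  reg := h.reg
  mem a' j hj := by
    rw [NState.setMem_mem]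
    simp only [Function.update_apply]
    split_ifs with h1 h2
    · subst h1
      rw [← ofNat_inj hj hi] at h2
      simp [h2]
    · subst h1
      rw [← ofNat_inj hj hi] at h2
      simp only [Function.update_apply, if_neg h2]
      exact h.mem a' j hj
    · exact h.mem a' j hj

/-- The program may write to the register `x`. -/
def Cmd.writesReg : Cmd → ℕ → Bool
  | .skip, _ => false
  | .assign y _, x => x == y
  | .put _ _ _, _ => false
  | .seq c d, x => c.writesReg x || d.writesReg x
  | .ite _ c d, x => c.writesReg x || d.writesReg x
  | .while _ c, x => c.writesReg x

/-- The program may write to the array `a`. -/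
def Cmd.writesMem : Cmd → ℕ → Bool
  | .skip, _ => false
  | .assign _ _, _ => false
  | .put a' _ _, a => a == a'
  | .seq c d, a => c.writesMem a || d.writesMem a
  | .ite _ c d, a => c.writesMem a || d.writesMem a
  | .while _ c, a => c.writesMem a

/-- The states agree on all registers and arrays to which the program does not write. -/
structure Frame (c : Cmd) (N N' : NState) : Prop where
  reg : ∀ x, c.writesReg x = false → N'.reg x = N.reg x
  mem : ∀ a, c.writesMem a = false → N'.mem a = N.mem a

theorem Frame.refl (c : Cmd) (N : NState) : Frame c N N := ⟨fun _ _ => rfl, fun _ _ => rfl⟩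

theorem Frame.trans {c : Cmd} {N N' N'' : NState} (h : Frame c N N') (h' : Frame c N' N'') :
    Frame c N N'' :=
  ⟨fun x hx => (h'.reg x hx).trans (h.reg x hx), fun a ha => (h'.mem a ha).trans (h.mem a ha)⟩

theorem Frame.mono {c d : Cmd} {N N' : NState} (h : Frame c N N')
    (hr : ∀ x, d.writesReg x = false → c.writesReg x = false)
    (hm : ∀ a, d.writesMem a = false → c.writesMem a = false) : Frame d N N' :=
  ⟨fun x hx => h.reg x (hr x hx), fun a ha => h.mem a (hm a ha)⟩

/-- Total correctness with a time bound: on words of size `W`, started in a state represented by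
`N`, the program `c` halts after at most `T` steps in a state represented by some `N'` with
`Q N'`. -/
def Run (W : ℕ) (c : Cmd) (N : NState) (T : ℕ) (Q : NState → Prop) : Prop :=
  ∀ b, 2 ^ b = W → ∀ s : State b, Represents s N → ∃ t s' N',
    Exec c s t s' ∧ t ≤ T ∧ Represents s' N' ∧ Frame c N N' ∧ Q N'

variable {W T T' : ℕ} {N : NState} {Q Q' : NState → Prop} {c d : Cmd} {e : Expr}

theorem Run.conseq (h : Run W c N T Q) (hT : T ≤ T')
    (hQ : ∀ N', Frame c N N' → Q N' → Q' N') : Run W c N T' Q' := by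
  intro b hb s hs
  obtain ⟨t, s', N', h1, h2, h3, h4, h5⟩ := h b hb s hs
  exact ⟨t, s', N', h1, h2.trans hT, h3, h4, hQ N' h4 h5⟩

theorem Run.seq (h : Run W c N T fun N' => Frame c N N' → Run W d N' T' Q) :
    Run W (.seq c d) N (T + T') Q := by
  intro b hb s hs
  obtain ⟨t, s', N', h1, h2, h3, h4, h5⟩ := h b hb s hs
  obtain ⟨t', s'', N'', g1, g2, g3, g4, g5⟩ := h5 h4 b hb s' h3
  refine ⟨t + t', s'', N'', .seq h1 g1, by omega, g3, ?_, g5⟩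
  refine (h4.mono ?_ ?_).trans (g4.mono ?_ ?_) <;> intro x hx <;>
    simp only [Cmd.writesReg, Cmd.writesMem, Bool.or_eq_false_iff] at hx <;> simp [hx]

/-- Both branches have the same time bound and the same postcondition. -/
theorem Run.ite (hs : e.Safe W N) (hlt : e.nev N < W) (h1 : e.nev N ≠ 0 → Run W c N T Q)
    (h2 : e.nev N = 0 → Run W d N T Q) (hT : e.cost + 1 + T ≤ T') :
    Run W (.ite e c d) N T' Q := by
  intro b hb s hr
  have he := Expr.eval_eq hr e (hb ▸ hs)
  have hz : e.eval s = 0 ↔ e.nev N = 0 := by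
    rw [he]
    exact ofNat_inj (hb ▸ hlt) (by positivity)
  by_cases h : e.nev N = 0
  · obtain ⟨t, s', N', g1, g2, g3, g4, g5⟩ := h2 h b hb s hr
    refine ⟨_, s', N', .ite_false (hz.2 h) g1, by omega, g3, ?_, g5⟩
    refine g4.mono ?_ ?_ <;> intro x hx <;>
      simp only [Cmd.writesReg, Cmd.writesMem, Bool.or_eq_false_iff] at hx <;> simp [hx]
  · obtain ⟨t, s', N', g1, g2, g3, g4, g5⟩ := h1 h b hb s hr
    refine ⟨_, s', N', .ite_true (mt hz.1 h) g1, by omega, g3, ?_, g5⟩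
    refine g4.mono ?_ ?_ <;> intro x hx <;>
      simp only [Cmd.writesReg, Cmd.writesMem, Bool.or_eq_false_iff] at hx <;> simp [hx]

theorem Run.skip : Run W .skip N 1 (· = N) := fun _ _ s hs =>
  ⟨1, s, N, .skip s, le_rfl, hs, .refl _ _, rfl⟩

theorem Run.assign {x : ℕ} (hs : e.Safe W N) :
    Run W (.assign x e) N (e.cost + 1) (· = N.setReg x (e.nev N)) := by
  intro b hb s hr
  refine ⟨_, _, N.setReg x (e.nev N), .assign s x e, le_rfl, ?_, ⟨?_, fun _ _ => rfl⟩, rfl⟩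
  · rw [Expr.eval_eq hr e (hb ▸ hs)]
    exact hr.setReg x _
  · intro y hy
    simp only [Cmd.writesReg, beq_eq_false_iff_ne] at hy
    simp [NState.setReg_reg, hy]

theorem Run.put {a : ℕ} {i : Expr} (hi : i.Safe W N) (hlt : i.nev N < W) (hs : e.Safe W N) :
    Run W (.put a i e) N (i.cost + e.cost + 1) (· = N.setMem a (i.nev N) (e.nev N)) := by
  intro b hb s hr
  refine ⟨_, _, N.setMem a (i.nev N) (e.nev N), .put s a i e, le_rfl, ?_, ⟨fun _ _ => rfl, ?_⟩, rfl⟩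
  · rw [Expr.eval_eq hr e (hb ▸ hs), Expr.eval_eq hr i (hb ▸ hi)]
    exact hr.setMem a _ (hb ▸ hlt)
  · intro a' ha
    simp only [Cmd.writesMem, beq_eq_false_iff_ne] at ha
    exact N.setMem_mem_of_ne _ _ _ _ ha

/-- A loop that is executed `n` times. The invariant `I k` holds after `k` iterations, each of which
may assume that the loop has changed nothing but the registers and arrays to which it writes. -/
theorem Run.while (n : ℕ) (τ : ℕ → ℕ) (I : ℕ → NState → Prop) (h0 : I 0 N)
    (hI : ∀ k < n, ∀ N', Frame (.while e c) N N' → I k N' →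
      e.Safe W N' ∧ e.nev N' < W ∧ e.nev N' ≠ 0 ∧ Run W c N' (τ k) (I (k + 1)))
    (hn : ∀ N', Frame (.while e c) N N' → I n N' → e.Safe W N' ∧ e.nev N' = 0) :
    Run W (.while e c) N (∑ k ∈ Finset.range n, (τ k + e.cost + 1) + e.cost + 1) (I n) := by
  intro b hb
  have key : ∀ m k, k + m = n → ∀ N', Frame (.while e c) N N' → I k N' → ∀ s : State b,
      Represents s N' → ∃ t s' N'', Exec (.while e c) s t s' ∧
        t ≤ ∑ k ∈ Finset.Ico k n, (τ k + e.cost + 1) + e.cost + 1 ∧ Represents s' N'' ∧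
        Frame (.while e c) N N'' ∧ I n N'' := by
    intro m
    induction m with
    | zero =>
      rintro k rfl N' hF hk s hs
      obtain ⟨g1, g2⟩ := hn N' hF hk
      refine ⟨_, s, N', .while_false ?_, by omega, hs, hF, hk⟩
      rw [Expr.eval_eq hs e (hb ▸ g1), g2]
      rfl
    | succ m ih =>
      intro k hk N' hF hIk s hs
      obtain ⟨g1, g2, g3, g4⟩ := hI k (by omega) N' hF hIk
      obtain ⟨t, s', N'', r1, r2, r3, r4, r5⟩ := g4 b hb s hs
      obtain ⟨t', s'', N3, u1, u2, u3, u4, u5⟩ :=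
        ih (k + 1) (by omega) N'' (hF.trans ⟨r4.reg, r4.mem⟩) r5 s' r3
      refine ⟨_, s'', N3, .while_true ?_ r1 u1, ?_, u3, u4, u5⟩
      · rw [Expr.eval_eq hs e (hb ▸ g1)]
        exact mt (ofNat_inj (hb ▸ g2) (by positivity)).1 g3
      · rw [Finset.sum_eq_sum_Ico_succ_bot (by omega)]
        omega
  intro s hs
  obtain ⟨t, s', N', h⟩ := key n 0 (by omega) N (.refl _ _) h0 s hs
  rw [← Finset.range_eq_Ico] at h
  exact ⟨t, s', N', h⟩

/-- `for x = 0, …, y - 1`, where the bound is the value of the register `y`. -/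
def Cmd.for (x y : ℕ) (c : Cmd) : Cmd :=
  .seq (.assign x (.lit 0))
    (.while (.op .lt (.var x) (.var y)) (.seq c (.assign x (.op .add (.var x) (.lit 1)))))

/-- The time bound may depend on the iteration. -/
theorem Run.for_sum {x y : ℕ} (n : ℕ) (τ : ℕ → ℕ) (I : ℕ → NState → Prop) (hy : N.reg y = n)
    (hn : n < W) (hxy : x ≠ y) (hx : c.writesReg x = false) (hyc : c.writesReg y = false)
    (h0 : I 0 (N.setReg x 0))
    (hI : ∀ k < n, ∀ N', Frame (.for x y c) N N' → N'.reg x = k → I k N' →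
      Run W c N' (τ k) fun N'' => Frame c N' N'' → I (k + 1) (N''.setReg x (k + 1))) :
    Run W (.for x y c) N (∑ k ∈ Finset.range n, (τ k + 8) + 6) (I n) := by
  have hw : ∀ N', Frame (.while (.op .lt (.var x) (.var y))
      (.seq c (.assign x (.op .add (.var x) (.lit 1))))) (N.setReg x 0) N' →
      Frame (.for x y c) N N' ∧ N'.reg y = n := by
    intro N' hF
    constructor
    · constructor
      · intro z hz
        have hzx : z ≠ x := by
          rintro rfl
          simp [Cmd.for, Cmd.writesReg] at hz
        rw [hF.reg z (by simpa [Cmd.for, Cmd.writesReg, hzx] using hz), NState.setReg_reg, if_neg hzx]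
      · intro a ha
        rw [hF.mem a (by simpa [Cmd.for, Cmd.writesMem] using ha), NState.setReg_mem]
    · rw [hF.reg y (by simp [Cmd.writesReg, hyc, hxy.symm]), NState.setReg_reg, if_neg hxy.symm, hy]
  have := Run.while (W := W) (N := N.setReg x 0) (e := .op .lt (.var x) (.var y))
    (c := .seq c (.assign x (.op .add (.var x) (.lit 1)))) n (fun k => τ k + 4)
    (fun k N' => N'.reg x = k ∧ I k N') ⟨by simp [NState.setReg_reg], h0⟩ ?_ ?_
  · refine Run.conseq (Run.seq (T' := ∑ k ∈ Finset.range n, (τ k + 8) + 4)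
      ((Run.assign (by trivial)).conseq le_rfl ?_)) ?_ fun _ _ h => h
    · rintro N' - rfl -
      exact this.conseq le_rfl fun N' _ h => h.2
    · simp only [Expr.cost]
      omega
  · rintro k hk N' hF ⟨hkx, hIk⟩
    obtain ⟨hF', hyN⟩ := hw N' hF
    refine ⟨⟨trivial, trivial, ?_⟩, ?_, ?_, ?_⟩
    · simp only [Op.Safe, Expr.nev, hkx, hyN]
      omega
    · simp only [Expr.nev, Op.nev, hkx, hyN, if_pos hk]
      omega
    · simp [Expr.nev, Op.nev, hkx, hyN, hk]
    · refine Run.seq ((hI k hk N' hF' hkx hIk).conseq le_rfl ?_)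
      intro N'' hF'' h _
      refine (Run.assign (by exact ⟨trivial, trivial, trivial⟩)).conseq (by simp [Expr.cost]) ?_
      rintro N3 - rfl
      have : N''.reg x = k := by rw [hF''.reg x hx, hkx]
      simp only [Expr.nev, Op.nev, this]
      exact ⟨by simp [NState.setReg_reg], h hF''⟩
  · rintro N' hF ⟨hkx, hIk⟩
    obtain ⟨hF', hyN⟩ := hw N' hF
    refine ⟨⟨trivial, trivial, ?_⟩, ?_⟩
    · simp only [Op.Safe, Expr.nev, hkx, hyN]
      omega
    · simp [Expr.nev, Op.nev, hkx, hyN]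

theorem Run.for {x y : ℕ} (n τ : ℕ) (I : ℕ → NState → Prop) (hy : N.reg y = n)
    (hn : n < W) (hxy : x ≠ y) (hx : c.writesReg x = false) (hyc : c.writesReg y = false)
    (h0 : I 0 (N.setReg x 0))
    (hI : ∀ k < n, ∀ N', Frame (.for x y c) N N' → N'.reg x = k → I k N' →
      Run W c N' τ fun N'' => Frame c N' N'' → I (k + 1) (N''.setReg x (k + 1)))
    (hT : n * (τ + 8) + 6 ≤ T) :
    Run W (.for x y c) N T (I n) :=
  (Run.for_sum n (fun _ => τ) I hy hn hxy hx hyc h0 hI).conseq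
    (by simpa using hT) fun _ _ h => h

/-! ### Symbolic evaluation of programs without loops -/

/-- The program contains no loop. -/
def Cmd.loopFree : Cmd → Bool
  | .skip => true
  | .assign _ _ => true
  | .put _ _ _ => true
  | .seq c d => c.loopFree && d.loopFree
  | .ite _ c d => c.loopFree && d.loopFree
  | .while _ _ => false

/-- The effect of a program without loops. -/
def Cmd.run : Cmd → NState → NState
  | .skip, N => N
  | .assign x e, N => N.setReg x (e.nev N)
  | .put a i e, N => N.setMem a (i.nev N) (e.nev N)
  | .seq c d, N => d.run (c.run N)
  | .ite e c d, N => if e.nev N = 0 then d.run N else c.run N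
  | .while _ _, N => N

/-- The execution of a program without loops on words agrees with the one on natural numbers. -/
def Cmd.Safe (W : ℕ) : Cmd → NState → Prop
  | .skip, _ => True
  | .assign _ e, N => e.Safe W N
  | .put _ i e, N => i.Safe W N ∧ i.nev N < W ∧ e.Safe W N
  | .seq c d, N => c.Safe W N ∧ d.Safe W (c.run N)
  | .ite e c d, N => e.Safe W N ∧ e.nev N < W ∧
      (e.nev N ≠ 0 → c.Safe W N) ∧ (e.nev N = 0 → d.Safe W N)
  | .while _ _, _ => True

/-- A bound for the number of steps of a program without loops. -/
def Cmd.bound : Cmd → ℕ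
  | .skip => 1
  | .assign _ e => e.cost + 1
  | .put _ i e => i.cost + e.cost + 1
  | .seq c d => c.bound + d.bound
  | .ite e c d => e.cost + 1 + (c.bound + d.bound)
  | .while _ _ => 0

/-- A program without loops is executed symbolically. -/
theorem Run.straight (hl : c.loopFree = true) (hs : c.Safe W N) :
    Run W c N c.bound (· = c.run N) := by
  induction c generalizing N with
  | skip => exact Run.skip
  | assign x e => exact Run.assign hs
  | put a i e => exact Run.put hs.1 hs.2.1 hs.2.2
  | seq c d ihc ihd =>
    simp only [Cmd.loopFree, Bool.and_eq_true] at hl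
    refine Run.seq ((ihc hl.1 hs.1).conseq le_rfl ?_)
    rintro N' - rfl -
    exact ihd hl.2 hs.2
  | ite e c d ihc ihd =>
    simp only [Cmd.loopFree, Bool.and_eq_true] at hl
    refine Run.ite (T := c.bound + d.bound) hs.1 hs.2.1 (fun h => ?_) (fun h => ?_) ?_
    · exact (ihc hl.1 (hs.2.2.1 h)).conseq (Nat.le_add_right _ d.bound)
        fun N' _ h' => by simp [Cmd.run, h, h']
    · exact (ihd hl.2 (hs.2.2.2 h)).conseq (Nat.le_add_left _ c.bound)
        fun N' _ h' => by simp [Cmd.run, h, h']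
    · simp only [Cmd.bound]; omega
  | _ => simp [Cmd.loopFree] at hl

/-- Execution of a loop-free program before another one. -/
theorem Run.seq_straight (hl : c.loopFree = true) (hs : c.Safe W N)
    (h : Frame c N (c.run N) → Run W d (c.run N) T Q) (hT : c.bound + T ≤ T') :
    Run W (.seq c d) N T' Q := by
  refine Run.conseq (Run.seq ((Run.straight hl hs).conseq le_rfl ?_)) hT fun _ _ h => h
  rintro N' - rfl hF
  exact h hF

end RAM

/-! ### The variables of a straight line program -/

namespace SLP

variable {α : Type} (S : SLP α)

/-- The string derived from the `i`-th variable; empty if there is no such variable. -/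
def str (i : ℕ) : List α := if h : i < S.size then S.val ⟨i, h⟩ else []

/-- The `i`-th assignment is `X_i = a`. -/
def IsLetter (i : ℕ) (a : α) : Prop := ∃ h : i < S.size, S.rule ⟨i, h⟩ = .letter a

/-- The `i`-th assignment is `X_i = X_l X_r`. -/
def IsPair (i l r : ℕ) : Prop :=
  ∃ (h : i < S.size) (l' r' : Fin i), S.rule ⟨i, h⟩ = .pair l' r' ∧ l'.1 = l ∧ r'.1 = r

variable {S}

theorem isLetter_or_isPair {i : ℕ} (h : i < S.size) :
    (∃ a, S.IsLetter i a) ∨ ∃ l r, S.IsPair i l r := by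
  cases hr : S.rule ⟨i, h⟩ with
  | letter a => exact .inl ⟨a, h, hr⟩
  | pair l r => exact .inr ⟨l, r, h, l, r, hr, rfl, rfl⟩

theorem IsPair.lt {i l r : ℕ} (h : S.IsPair i l r) : l < i ∧ r < i ∧ i < S.size := by
  obtain ⟨h, l', r', -, rfl, rfl⟩ := h
  exact ⟨l'.2, r'.2, h⟩

theorem IsLetter.str_eq {i : ℕ} {a : α} (h : S.IsLetter i a) : S.str i = [a] := by
  obtain ⟨h, hr⟩ := h
  rw [str, dif_pos h, SLP.val, hr]

theorem IsPair.str_eq {i l r : ℕ} (h : S.IsPair i l r) : S.str i = S.str l ++ S.str r := by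
  obtain ⟨h, l', r', hr, rfl, rfl⟩ := h
  rw [str, dif_pos h, SLP.val, hr, str, dif_pos (l'.2.trans h), str, dif_pos (r'.2.trans h)]

theorem text_eq_str : S.text = S.str (S.size - 1) := by
  rw [str, dif_pos (Nat.sub_lt S.size_pos Nat.one_pos)]
  rfl

variable [DecidableEq α] (S)

/-- The part of the weighted frequency of `P` in `X_i` that is not due to its children. -/
noncomputable def ownFreq (c : Counts) (i : ℕ) (P : List α) : ℕ :=
  if h : i < S.size then
    match S.rule ⟨i, h⟩ with
    | .letter a => freq c [a] P
    | .pair l r => crossFreq c (S.str l) (S.str r) P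
  else 0

variable {S}

theorem IsLetter.ownFreq_eq {i : ℕ} {a : α} (h : S.IsLetter i a) (c : Counts) (P : List α) :
    S.ownFreq c i P = freq c [a] P := by
  obtain ⟨h, hr⟩ := h
  rw [ownFreq, dif_pos h, hr]

theorem IsPair.ownFreq_eq {i l r : ℕ} (h : S.IsPair i l r) (c : Counts) (P : List α) :
    S.ownFreq c i P = crossFreq c (S.str l) (S.str r) P := by
  obtain ⟨h, l', r', hr, rfl, rfl⟩ := h
  rw [ownFreq, dif_pos h, hr]

theorem ownFreq_zero (i : ℕ) (P : List α) : S.ownFreq 0 i P = 0 := by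
  by_cases h : i < S.size
  · rcases isLetter_or_isPair h with ⟨a, ha⟩ | ⟨l, r, hp⟩
    · rw [ha.ownFreq_eq, freq_zero]
    · simp [hp.ownFreq_eq, crossFreq, Counts.weight, Counts.zero_def]
  · rw [ownFreq, dif_neg h]

/-- The state of the top-down computation of the counts, after the variables `X_i` with `m ≤ i`
have passed their counts on to their children. The frequencies are preserved: the variables `X_i`
with `i < m` stand for their whole strings, the others only for what their children do not
account for. -/
structure CountInv (S : SLP α) (q m : ℕ) (reach : ℕ → ℕ) (cnt : ℕ → Counts) : Prop where
  infix_text : ∀ i < S.size, reach i ≠ 0 → S.str i <:+: S.text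
  reach_le : ∀ i, reach i ≤ 1
  cnt_zero : ∀ i, reach i = 0 → cnt i = 0
  closed : ∀ i l r, m ≤ i → reach i ≠ 0 → S.IsPair i l r → reach l ≠ 0 ∧ reach r ≠ 0
  sum_eq : ∀ P : List α, P.length = q →
    ∑ i ∈ Finset.range m, freq (cnt i) (S.str i) P +
      ∑ i ∈ Finset.Ico m S.size, S.ownFreq (cnt i) i P = nOcc S.text P

variable {q m : ℕ} {reach : ℕ → ℕ} {cnt : ℕ → Counts}

theorem CountInv.init (hq : 1 ≤ q) (h1 : ∀ i, reach i = if i = S.size - 1 then 1 else 0)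
    (h2 : ∀ i, cnt i = if i = S.size - 1 then ⟨1, 0, 0, 0⟩ else 0) :
    CountInv S q S.size reach cnt where
  infix_text i hi h := by
    rw [h1] at h
    obtain rfl : i = S.size - 1 := by by_contra hne; simp [hne] at h
    rw [text_eq_str]
  reach_le i := by rw [h1]; split_ifs <;> omega
  cnt_zero i h := by
    rw [h1] at h
    rw [h2, if_neg (by rintro rfl; simp at h)]
  closed i l r hi _ hp := absurd hp.lt.2.2 (by omega)
  sum_eq P hP := by
    have hP0 : P ≠ [] := by rintro rfl; simp at hP; omega
    rw [Finset.Ico_self, Finset.sum_empty, add_zero,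
      Finset.sum_eq_single_of_mem (S.size - 1) (by have := S.size_pos; simp; omega)]
    · rw [h2, if_pos rfl, freq_text hP0, text_eq_str]
    · intro i _ hne
      rw [h2, if_neg hne, freq_zero]

/-- A letter has no children, so its frequency is its own. -/
theorem CountInv.step_letter {a : α} (h : CountInv S q (m + 1) reach cnt) (ha : S.IsLetter m a) :
    CountInv S q m reach cnt where
  infix_text := h.infix_text
  reach_le := h.reach_le
  cnt_zero := h.cnt_zero
  closed i l r hi hr hp := by
    rcases Nat.eq_or_lt_of_le hi with rfl | hi
    · obtain ⟨_, h1⟩ := ha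
      obtain ⟨_, _, _, h2, _⟩ := hp
      rw [h1] at h2
      cases h2
    · exact h.closed i l r hi hr hp
  sum_eq P hP := by
    have hm := ha.1
    rw [← h.sum_eq P hP, Finset.sum_range_succ, Finset.sum_eq_sum_Ico_succ_bot hm, ha.ownFreq_eq,
      ha.str_eq]
    omega

/-- A variable that does not occur in the derivation of the text is skipped. -/
theorem CountInv.step_zero (h : CountInv S q (m + 1) reach cnt) (hm : m < S.size)
    (hr : reach m = 0) : CountInv S q m reach cnt where
  infix_text := h.infix_text
  reach_le := h.reach_le
  cnt_zero := h.cnt_zero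
  closed i l r hi hr' hp := by
    rcases Nat.eq_or_lt_of_le hi with rfl | hi
    · exact absurd hr hr'
    · exact h.closed i l r hi hr' hp
  sum_eq P hP := by
    rw [← h.sum_eq P hP, Finset.sum_range_succ, Finset.sum_eq_sum_Ico_succ_bot hm,
      h.cnt_zero m hr, freq_zero, ownFreq_zero]
    omega

/-- The counts of `X_m = X_l X_r` are added to those of its children, which may coincide. -/
theorem CountInv.step_pair {l r : ℕ} (hq : 1 ≤ q) (h : CountInv S q (m + 1) reach cnt)
    (hp : S.IsPair m l r) (hm : reach m ≠ 0) {reach' : ℕ → ℕ} {cnt' : ℕ → Counts}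
    (h1 : ∀ i, reach' i = if i = l ∨ i = r then 1 else reach i)
    (h2 : ∀ i, cnt' i = cnt i + (if i = l then (cnt m).left else 0) +
      (if i = r then (cnt m).right else 0)) :
    CountInv S q m reach' cnt' := by
  obtain ⟨hl, hr, hlt⟩ := hp.lt
  have hsub := h.infix_text m hlt hm
  rw [hp.str_eq] at hsub
  have h0 : ∀ c : Counts, c + 0 = c := fun c => rfl
  have hmono : ∀ i, reach i ≠ 0 → reach' i ≠ 0 := by
    intro i hi
    rw [h1]
    split_ifs <;> omega
  refine ⟨?_, ?_, ?_, ?_, ?_⟩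
  · intro i hi hri
    rw [h1] at hri
    split_ifs at hri with hc
    · rcases hc with rfl | rfl
      · exact (List.prefix_append _ _).isInfix.trans hsub
      · exact (List.suffix_append _ _).isInfix.trans hsub
    · exact h.infix_text i hi hri
  · intro i
    rw [h1]
    have := h.reach_le i
    split_ifs <;> omega
  · intro i hi
    rw [h1] at hi
    split_ifs at hi with hc
    rw [not_or] at hc
    rw [h2, if_neg hc.1, if_neg hc.2, h0, h0, h.cnt_zero i hi]
  · intro i l' r' hi hri hp'
    rcases Nat.eq_or_lt_of_le hi with rfl | hi
    · obtain ⟨_, a, b, e, rfl, rfl⟩ := hp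
      obtain ⟨_, a', b', e', rfl, rfl⟩ := hp'
      rw [e] at e'
      cases e'
      simp [h1]
    · have : reach i ≠ 0 := by rwa [h1, if_neg (by omega)] at hri
      exact (h.closed i l' r' hi this hp').imp (hmono _) (hmono _)
  · intro P hP
    have hP0 : P ≠ [] := by rintro rfl; simp at hP; omega
    have e1 : ∀ i, m ≤ i → cnt' i = cnt i := fun i hi => by
      rw [h2, if_neg (by omega), if_neg (by omega), h0, h0]
    have e2 : ∀ i ∈ Finset.range m, freq (cnt' i) (S.str i) P = freq (cnt i) (S.str i) P +
        (if i = l then freq (cnt m).left (S.str l) P else 0) +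
        (if i = r then freq (cnt m).right (S.str r) P else 0) := by
      intro i _
      rw [h2, freq_add, freq_add]
      congr 1
      · congr 1
        split_ifs with hc
        · rw [hc]
        · exact freq_zero _ _
      · split_ifs with hc
        · rw [hc]
        · exact freq_zero _ _
    have e3 : ∑ i ∈ Finset.Ico m S.size, S.ownFreq (cnt' i) i P =
        ∑ i ∈ Finset.Ico m S.size, S.ownFreq (cnt i) i P :=
      Finset.sum_congr rfl fun i hi => by rw [e1 i (Finset.mem_Ico.1 hi).1]
    rw [← h.sum_eq P hP, e3, Finset.sum_congr rfl e2, Finset.sum_add_distrib,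
      Finset.sum_add_distrib, Finset.sum_ite_eq', Finset.sum_ite_eq', if_pos (by simpa using hl),
      if_pos (by simpa using hr), Finset.sum_range_succ, Finset.sum_eq_sum_Ico_succ_bot hlt,
      hp.ownFreq_eq, hp.str_eq, freq_append hP0]
    omega

end SLP

/-! ### The program: lengths and counts of the variables -/

namespace RAM

instance : Add Expr := ⟨.op .add⟩
instance : Sub Expr := ⟨.op .sub⟩
instance : Mul Expr := ⟨.op .mul⟩
instance (n : ℕ) : OfNat Expr n := ⟨.lit n⟩

theorem Expr.add_def (e f : Expr) : e + f = .op .add e f := rfl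
theorem Expr.sub_def (e f : Expr) : e - f = .op .sub e f := rfl
theorem Expr.mul_def (e f : Expr) : e * f = .op .mul e f := rfl
theorem Expr.ofNat_def (n : ℕ) : (OfNat.ofNat n : Expr) = .lit n := rfl

attribute [simp] Expr.add_def Expr.sub_def Expr.mul_def Expr.ofNat_def Expr.nev Expr.Safe Expr.cost
  Op.nev Op.Safe Cmd.run Cmd.Safe Cmd.bound Cmd.loopFree NState.setReg_reg NState.setReg_mem
  NState.setMem_reg NState.setMem_mem

/-- Sequential composition. -/
infixr:60 " ;; " => Cmd.seq

/-! Names of registers. They are notations for numerals, so that distinct names are told apart by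
computation. The number of variables is held in `rN`, the length of the `q`-grams in `rQ`, the
current variable in `rI` and its children in `rL` and `rR`, the current item in `rM` while the list
is built, and afterwards the number of items; `rQQ`, `rH` and `rB` hold `2 * q`, `2 * (q - 1)` and
`3 * (q - 1)`. In the grouping, `rI` is the current class and `rT` the current position. -/

notation "rN" => (0 : ℕ)
notation "rQ" => (1 : ℕ)
notation "rI" => (2 : ℕ)
notation "rL" => (3 : ℕ)
notation "rR" => (4 : ℕ)
notation "rD" => (5 : ℕ)
notation "rQQ" => (6 : ℕ)
notation "rB" => (7 : ℕ)
notation "rM" => (8 : ℕ)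
notation "rX" => (9 : ℕ)
notation "rU" => (10 : ℕ)
notation "rV" => (11 : ℕ)
notation "rK" => (12 : ℕ)
notation "rP" => (13 : ℕ)
notation "rH" => (14 : ℕ)
notation "rT" => (15 : ℕ)

/-! Names of arrays. The first six hold the input. For the variables there are the length `aLen`, the
mark `aReach` of those in the derivation of the text, the four counts `aTT`, `aTF`, `aFT`, `aFF`, and
rows of `2 * q` letters in `aPre` and `aSuf`; `aSuf` is stored backwards. The items have their
letters in rows of `aGram` and their multiplicities in `aVal`. The other arrays serve to detect
repeated clusters (`aStamp`), to group the items, and to add up multiplicities (`aSum`). -/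

notation "aKind" => (0 : ℕ)
notation "aFst" => (1 : ℕ)
notation "aSnd" => (2 : ℕ)
notation "aBeg" => (3 : ℕ)
notation "aEnd" => (4 : ℕ)
notation "aNum" => (5 : ℕ)
notation "aLen" => (6 : ℕ)
notation "aReach" => (7 : ℕ)
notation "aTT" => (8 : ℕ)
notation "aTF" => (9 : ℕ)
notation "aFT" => (10 : ℕ)
notation "aFF" => (11 : ℕ)
notation "aPre" => (12 : ℕ)
notation "aSuf" => (13 : ℕ)
notation "aStamp" => (14 : ℕ)
notation "aGram" => (15 : ℕ)
notation "aVal" => (16 : ℕ)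
notation "aNew" => (17 : ℕ)
notation "aOld" => (18 : ℕ)
notation "aHead" => (19 : ℕ)
notation "aNext" => (20 : ℕ)
notation "aRep" => (21 : ℕ)
notation "aSum" => (22 : ℕ)

variable {σ : ℕ}

/-- The input, over the natural numbers. The given values are those at the positions to be looked up,
and they are assumed for the factors of the text only, since for other variables they may have been
reduced. -/
structure Input (S : SLP (Fin σ)) (q : ℕ) (N : NState) : Prop where
  size : N.reg rN = S.size
  gram : N.reg rQ = q
  letter : ∀ i a, S.IsLetter i a → N.mem aKind i = 0 ∧ N.mem aFst i = a.1
  pair : ∀ i l r, S.IsPair i l r → N.mem aKind i = 1 ∧ N.mem aFst i = l ∧ N.mem aSnd i = r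
  cover : ∀ i l r, S.IsPair i l r → S.str i <:+: S.text → ∀ o < 3 * (q - 1),
    ValidLookup q (S.str l).length (S.str i).length o →
    IsLongestCover q (S.str i) (lookupPos q (S.str l).length o)
      (N.mem aBeg (3 * q * i + (o + 1))) (N.mem aEnd (3 * q * i + (o + 1))) ∧
    N.mem aNum (3 * q * i + (o + 1)) =
      nOcc (slice (S.str i) (N.mem aBeg (3 * q * i + (o + 1)))
        (N.mem aEnd (3 * q * i + (o + 1)))) (lookupGram q (S.str l).length (S.str i) o)

theorem Input.of_frame {S : SLP (Fin σ)} {q : ℕ} {c : Cmd} {N N' : NState} (h : Input S q N)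
    (hF : Frame c N N')
    (hw : c.writesReg rN = false ∧ c.writesReg rQ = false ∧ ∀ a < 6, c.writesMem a = false) :
    Input S q N' := by
  have hm : ∀ a < 6, N'.mem a = N.mem a := fun a ha => hF.mem a (hw.2.2 a ha)
  refine ⟨?_, ?_, ?_, ?_, ?_⟩
  · rw [hF.reg _ hw.1, h.size]
  · rw [hF.reg _ hw.2.1, h.gram]
  · rw [hm 0 (by decide), hm 1 (by decide)]
    exact h.letter
  · rw [hm 0 (by decide), hm 1 (by decide), hm 2 (by decide)]
    exact h.pair
  · rw [hm 3 (by decide), hm 4 (by decide), hm 5 (by decide)]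
    exact h.cover

/-- The lengths of the variables, bottom-up. They are computed for all variables; only sums are
involved, so words that overflow do no harm. -/
def lenCmd : Cmd :=
  .for rI rN (.ite (.get aKind (.var rI))
    (.put aLen (.var rI) (.get aLen (.get aFst (.var rI)) + .get aLen (.get aSnd (.var rI))))
    (.put aLen (.var rI) 1))

theorem lenCmd_run {W : ℕ} {S : SLP (Fin σ)} {q : ℕ} {N : NState} (h : Input S q N)
    (hW : S.size + 2 ≤ W) :
    Run W lenCmd N (30 * S.size + 6) fun N' => ∀ i < S.size, N'.mem aLen i = (S.str i).length := by
  refine Run.for S.size 22 (fun k N' => ∀ i < k, N'.mem aLen i = (S.str i).length) h.size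
    (by omega) (by decide) (by decide) (by decide) (by simp) ?_ (by omega)
  intro k hk N' hF hreg hI
  have hin := h.of_frame hF (by decide)
  rcases SLP.isLetter_or_isPair hk with ⟨a, ha⟩ | ⟨l, r, hp⟩
  · obtain ⟨h1, h2⟩ := hin.letter k a ha
    refine (Run.straight (by decide) (by simp [hreg, h1]; omega)).conseq (by simp) ?_
    rintro N'' - rfl -
    intro i hi
    by_cases hik : i = k
    · simp [hreg, h1, hik, ha.str_eq]
    · simp [hreg, h1, hik, hI i (by omega)]
  · obtain ⟨h1, h2, h3⟩ := hin.pair k l r hp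
    obtain ⟨hl, hr, -⟩ := hp.lt
    refine (Run.straight (by decide) (by simp [hreg, h1, h2, h3]; omega)).conseq (by simp) ?_
    rintro N'' - rfl -
    intro i hi
    by_cases hik : i = k
    · simp [hreg, h1, h2, h3, hik, hp.str_eq, hI l hl, hI r hr]
    · simp [hreg, h1, hik, hI i (by omega)]

/-- The counts of the variable `X_i` in the state `N`. -/
def countsOf (N : NState) (i : ℕ) : Counts :=
  ⟨N.mem aTT i, N.mem aTF i, N.mem aFT i, N.mem aFF i⟩

/-- A variable passes its counts on to its children. -/
def passCmd : Cmd :=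
  .assign rL (.get aFst (.var rI)) ;;
  .assign rR (.get aSnd (.var rI)) ;;
  .put aReach (.var rL) 1 ;;
  .put aReach (.var rR) 1 ;;
  .put aTF (.var rL) (.get aTF (.var rL) + (.get aTT (.var rI) + .get aTF (.var rI))) ;;
  .put aFF (.var rL) (.get aFF (.var rL) + (.get aFT (.var rI) + .get aFF (.var rI))) ;;
  .put aFT (.var rR) (.get aFT (.var rR) + (.get aTT (.var rI) + .get aFT (.var rI))) ;;
  .put aFF (.var rR) (.get aFF (.var rR) + (.get aTF (.var rI) + .get aFF (.var rI)))

theorem passCmd_run {N : NState} {m l r : ℕ} (hI : N.reg rI = m) (h1 : N.mem aFst m = l)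
    (h2 : N.mem aSnd m = r) (hl : l < m) (hr : r < m) :
    (∀ i, (passCmd.run N).mem aReach i = if i = l ∨ i = r then 1 else N.mem aReach i) ∧
    ∀ i, countsOf (passCmd.run N) i = countsOf N i +
      (if i = l then (countsOf N m).left else 0) +
      (if i = r then (countsOf N m).right else 0) := by
  have e1 : m ≠ l := by omega
  have e2 : m ≠ r := by omega
  have hTT : ∀ i, (passCmd.run N).mem aTT i = N.mem aTT i := by
    intro i
    simp [passCmd]
  have hTF : ∀ i, (passCmd.run N).mem aTF i =
      if i = l then N.mem aTF l + (N.mem aTT m + N.mem aTF m) else N.mem aTF i := by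
    intro i
    simp [passCmd, hI, h1, h2, e1]
  have hFT : ∀ i, (passCmd.run N).mem aFT i =
      if i = r then N.mem aFT r + (N.mem aTT m + N.mem aFT m) else N.mem aFT i := by
    intro i
    simp [passCmd, hI, h1, h2, e1]
  have hFF : ∀ i, (passCmd.run N).mem aFF i =
      N.mem aFF i + (if i = l then N.mem aFT m + N.mem aFF m else 0) +
        (if i = r then N.mem aTF m + N.mem aFF m else 0) := by
    intro i
    simp [passCmd, hI, h1, h2, e1]
    split_ifs <;> simp_all
  constructor
  · intro i
    simp [passCmd, hI, h1, h2]
    split_ifs <;> simp_all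
  · intro i
    simp only [countsOf, hTT, hTF, hFT, hFF]
    split_ifs <;> simp_all [Counts.add_def, Counts.left, Counts.right, Counts.zero_def]

/-- The step of the top-down computation for one variable. -/
def countStepCmd : Cmd :=
  .assign rI (.var rN - (.var rK + 1)) ;;
  .ite (.get aReach (.var rI)) (.ite (.get aKind (.var rI)) passCmd .skip) .skip

/-- The counts of the variables, top-down. -/
def countCmd : Cmd :=
  .put aTT (.var rN - 1) 1 ;; .put aReach (.var rN - 1) 1 ;; .for rK rN countStepCmd

theorem countStepCmd_run {W : ℕ} {S : SLP (Fin σ)} {q m : ℕ} {N : NState} (hq : 1 ≤ q)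
    (h : Input S q N) (hW : S.size + 2 ≤ W) (hm : S.size = N.reg rK + 1 + m)
    (hI : SLP.CountInv S q (m + 1) (N.mem aReach) (countsOf N)) :
    Run W countStepCmd N 80 fun N' => SLP.CountInv S q m (N'.mem aReach) (countsOf N') := by
  unfold countStepCmd
  refine Run.seq_straight (T := 72) (by decide) (by simp [h.size, hm]) (fun hF3 => ?_)
    (by simp)
  have hN3 : ∀ a, (Cmd.run (.assign rI (.var rN - (.var rK + 1))) N).mem a = N.mem a := by
    simp
  have hI3 : (Cmd.run (.assign rI (.var rN - (.var rK + 1))) N).reg rI = m := by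
    simp [h.size, hm]
  have hin := h.of_frame hF3 (by decide)
  generalize Cmd.run (.assign rI (.var rN - (.var rK + 1))) N = N' at *
  have hle := hI.reach_le m
  have hc : countsOf N' = countsOf N := by
    funext i; simp only [countsOf, hN3]
  rw [← hN3, ← hc] at hI
  rw [← hN3] at hle
  have hmn : m < S.size := by omega
  refine Run.ite (T := 68) ?_ ?_ (fun hr => ?_) (fun hr => ?_) ?_
  · simp [hI3]; omega
  · simp [hI3]; omega
  · simp only [Expr.nev, hI3] at hr
    rcases SLP.isLetter_or_isPair hmn with ⟨a, ha⟩ | ⟨l, r, hp⟩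
    · obtain ⟨h1, -⟩ := hin.letter m a ha
      refine Run.ite (T := 1) ?_ ?_ (fun hr => ?_) (fun hr => ?_) ?_
      · simp [hI3]; omega
      · simp [hI3, h1]; omega
      · simp [hI3, h1] at hr
      · refine Run.skip.conseq le_rfl ?_
        rintro _ - rfl
        exact hI.step_letter ha
      · simp
    · obtain ⟨h1, h4, h5⟩ := hin.pair m l r hp
      obtain ⟨hl, hr', -⟩ := hp.lt
      refine Run.ite (T := 65) ?_ ?_ (fun _ => ?_) (fun hr => ?_) ?_
      · simp [hI3]; omega
      · simp [hI3, h1]; omega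
      · refine (Run.straight (by decide) ?_).conseq (by simp [passCmd]) ?_
        · simp [passCmd, hI3, h4, h5]
          omega
        · rintro _ - rfl
          have hpass := passCmd_run hI3 h4 h5 hl hr'
          exact hI.step_pair hq hp hr hpass.1 hpass.2
      · simp [hI3, h1] at hr
      · simp
  · simp only [Expr.nev, hI3] at hr
    refine Run.skip.conseq (by omega) ?_
    rintro _ - rfl
    exact hI.step_zero hmn hr
  · simp

theorem countCmd_run {W : ℕ} {S : SLP (Fin σ)} {q : ℕ} {N : NState} (hq : 1 ≤ q) (h : Input S q N)
    (hW : S.size + 2 ≤ W) (hz : ∀ a, 7 ≤ a → a ≤ 11 → ∀ i, N.mem a i = 0) :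
    Run W countCmd N (100 * S.size + 100) fun N' =>
      SLP.CountInv S q 0 (N'.mem aReach) (countsOf N') := by
  have hn := S.size_pos
  unfold countCmd
  refine Run.seq_straight (T := 100 * S.size + 50) (by decide) (by simp [h.size]; omega)
    (fun hF1 => ?_) (by simp; omega)
  have h1 := h.of_frame hF1 (by decide)
  refine Run.seq_straight (T := 100 * S.size + 40) (by decide) (by simp [h.size]; omega)
    (fun hF2 => ?_) (by simp; omega)
  have h2 := h1.of_frame hF2 (by decide)
  refine (Run.for (T := 100 * S.size + 40) S.size 80
    (fun k N' => SLP.CountInv S q (S.size - k) (N'.mem aReach) (countsOf N'))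
    h2.size (by omega) (by decide) (by decide) (by decide) ?_ ?_ (by omega)).conseq le_rfl
    fun N' _ h => by simpa using h
  · apply SLP.CountInv.init hq
    · intro i
      simp [h.size, hz]
    · intro i
      have z1 := hz aTT (by decide) (by decide) i
      have z2 := hz aTF (by decide) (by decide) i
      have z3 := hz aFT (by decide) (by decide) i
      have z4 := hz aFF (by decide) (by decide) i
      have hs := h.size
      clear hz
      by_cases hi : i = S.size - 1 <;> simp [countsOf, hi, hs, z1, z2, z3, z4, Counts.zero_def]
      subst hi
      simp [z2, z3, z4]
  · intro k hk N' hF hreg hI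
    have hin := h2.of_frame hF (by decide)
    obtain ⟨m, hm⟩ : ∃ m, S.size = k + 1 + m := ⟨S.size - (k + 1), by omega⟩
    rw [show S.size - k = m + 1 by omega] at hI
    rw [show S.size - (k + 1) = m by omega]
    exact (countStepCmd_run hq hin hW (by rw [hreg, hm]) hI).conseq le_rfl fun N'' _ h _ => h

/-- The input, together with the lengths and the counts of the variables. -/
structure Counted (S : SLP (Fin σ)) (q : ℕ) (N : NState) : Prop where
  input : Input S q N
  len : ∀ i < S.size, N.mem aLen i = (S.str i).length
  inv : SLP.CountInv S q 0 (N.mem aReach) (countsOf N)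

theorem Counted.of_frame {S : SLP (Fin σ)} {q : ℕ} {c : Cmd} {N N' : NState} (h : Counted S q N)
    (hF : Frame c N N')
    (hw : c.writesReg rN = false ∧ c.writesReg rQ = false ∧ ∀ a < 12, c.writesMem a = false) :
    Counted S q N' := by
  have hm : ∀ a < 12, N'.mem a = N.mem a := fun a ha => hF.mem a (hw.2.2 a ha)
  refine ⟨h.input.of_frame hF ⟨hw.1, hw.2.1, fun a ha => hw.2.2 a (by omega)⟩, ?_, ?_⟩
  · rw [hm 6 (by decide)]
    exact h.len
  · have : countsOf N' = countsOf N := by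
      funext i
      simp only [countsOf, hm 8 (by decide), hm 9 (by decide), hm 10 (by decide), hm 11 (by decide)]
    rw [this, hm 7 (by decide)]
    exact h.inv

theorem Counted.len_le {S : SLP (Fin σ)} {q i : ℕ} {N : NState} (h : Counted S q N)
    (hi : i < S.size) (hr : N.mem aReach i ≠ 0) : (S.str i).length ≤ S.text.length :=
  (h.inv.infix_text i hi hr).length_le

/-! ### The program: prefixes and suffixes of the variables -/

/-- The letter of `w` at the 0-based position `d`; `0` if there is no such letter. -/
def letterAt (w : List (Fin σ)) (d : ℕ) : ℕ := (w.map Fin.val).getD d 0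

theorem letterAt_append (u v : List (Fin σ)) (d : ℕ) :
    letterAt (u ++ v) d = if d < u.length then letterAt u d else letterAt v (d - u.length) := by
  simp only [letterAt, List.map_append]
  split_ifs with h
  · rw [List.getD_append _ _ _ _ (by simpa using h)]
  · rw [List.getD_append_right _ _ _ _ (by simpa using h), List.length_map]

theorem letterAt_singleton (a : Fin σ) (d : ℕ) : letterAt [a] d = if d = 0 then a.1 else 0 := by
  cases d <;> simp [letterAt]

theorem letterAt_of_lt {w : List (Fin σ)} {d : ℕ} (h : d < w.length) : letterAt w d = w[d].1 := by
  simp [letterAt, h]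

theorem mul_add_lt_mul {i k Z d : ℕ} (hi : i < k) (hd : d < Z) : i * Z + d < k * Z := by
  have := Nat.mul_le_mul_right Z (Nat.succ_le_of_lt hi)
  rw [Nat.succ_mul] at this
  omega

/-- One letter of the prefix and of the suffix of `X_i = X_l X_r`. -/
def affixStepCmd : Cmd :=
  .ite (.op .lt (.var rD) (.get aLen (.var rL)))
    (.put aPre (.var rI * .var rQQ + .var rD) (.get aPre (.var rL * .var rQQ + .var rD)))
    (.put aPre (.var rI * .var rQQ + .var rD)
      (.get aPre (.var rR * .var rQQ + (.var rD - .get aLen (.var rL))))) ;;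
  .ite (.op .lt (.var rD) (.get aLen (.var rR)))
    (.put aSuf (.var rI * .var rQQ + .var rD) (.get aSuf (.var rR * .var rQQ + .var rD)))
    (.put aSuf (.var rI * .var rQQ + .var rD)
      (.get aSuf (.var rL * .var rQQ + (.var rD - .get aLen (.var rR)))))

/-- The first and the last `2q` letters of every variable in the derivation of the text, bottom-up.
Shorter strings are padded with zeros, which never get into a `q`-gram. -/
def affixCmd : Cmd :=
  .assign rQQ (2 * .var rQ) ;;
  .for rI rN
    (.ite (.get aReach (.var rI))
      (.ite (.get aKind (.var rI))
        (.assign rL (.get aFst (.var rI)) ;; .assign rR (.get aSnd (.var rI)) ;;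
          .for rD rQQ affixStepCmd)
        (.put aPre (.var rI * .var rQQ) (.get aFst (.var rI)) ;;
          .put aSuf (.var rI * .var rQQ) (.get aFst (.var rI)))) .skip)

/-- The prefix and the suffix of the string `w` are stored in the `i`-th rows, up to length `z`. -/
def Affixes (q : ℕ) (N : NState) (i z : ℕ) (w : List (Fin σ)) : Prop :=
  ∀ d < z, N.mem aPre (i * (2 * q) + d) = letterAt w d ∧
    N.mem aSuf (i * (2 * q) + d) = letterAt w.reverse d

/-- The prefixes and suffixes of the first `k` variables are stored, and `z` letters of those
of the next one; the rest of the arrays is empty. -/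
structure AffixInv (S : SLP (Fin σ)) (q k z : ℕ) (N : NState) : Prop where
  done : ∀ i < k, N.mem aReach i ≠ 0 → Affixes q N i (2 * q) (S.str i)
  current : Affixes q N k z (S.str k)
  empty : ∀ c, k * (2 * q) + z ≤ c → N.mem aPre c = 0 ∧ N.mem aSuf c = 0

theorem AffixInv.next {S : SLP (Fin σ)} {q k : ℕ} {N : NState} (h : AffixInv S q k (2 * q) N) :
    AffixInv S q (k + 1) 0 N where
  done i hi hr := by
    rcases Nat.lt_succ_iff_lt_or_eq.1 hi with hi | rfl
    · exact h.done i hi hr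
    · exact h.current
  current d hd := absurd hd (by omega)
  empty c hc := h.empty c (by rw [Nat.succ_mul] at hc; omega)

theorem affixStepCmd_run {W : ℕ} {S : SLP (Fin σ)} {q i l r d : ℕ} {N : NState}
    (h : Counted S q N) (hW : S.text.length + 2 * (q * S.size) < W) (hI : N.reg rI = i)
    (hL : N.reg rL = l) (hR : N.reg rR = r) (hD : N.reg rD = d) (hQQ : N.reg rQQ = 2 * q)
    (hp : S.IsPair i l r) (hr : N.mem aReach i ≠ 0) (hd : d < 2 * q) (ha : AffixInv S q i d N) :
    Run W affixStepCmd N 72 (AffixInv S q i (d + 1)) := by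
  obtain ⟨hli, hri, hin⟩ := hp.lt
  obtain ⟨hrl, hrr⟩ := h.inv.closed i l r (Nat.zero_le _) hr hp
  have hZ : S.size * (2 * q) = 2 * (q * S.size) := by ring
  have hidx : ∀ j < S.size, ∀ d < 2 * q, j * (2 * q) + d < W := fun j hj d hd => by
    have := mul_add_lt_mul hj hd
    omega
  have hll := h.len_le (hli.trans hin) hrl
  have hlr := h.len_le (hri.trans hin) hrr
  have lenl := h.len l (hli.trans hin)
  have lenr := h.len r (hri.trans hin)
  have hpl : ∀ d < 2 * q, _ := ha.done l hli hrl
  have hpr : ∀ d < 2 * q, _ := ha.done r hri hrr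
  have i1 := hidx i hin d hd
  have i2 := hidx l (hli.trans hin) d hd
  have i3 := hidx r (hri.trans hin) d hd
  have i4 : ∀ x, l * (2 * q) + (d - x) < W := fun x => by omega
  have i5 : ∀ x, r * (2 * q) + (d - x) < W := fun x => by omega
  have i6 := hidx l (hli.trans hin) 0 (by omega)
  have i7 := hidx r (hri.trans hin) 0 (by omega)
  have i8 := Nat.le_mul_of_pos_right l (show 0 < 2 * q by omega)
  have i9 := Nat.le_mul_of_pos_right r (show 0 < 2 * q by omega)
  refine (Run.straight (by decide) ?_).conseq (by simp [affixStepCmd]) ?_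
  · have j1 : l < W := by omega
    have j2 : r < W := by omega
    have j3 : d < W := by omega
    have j4 : (S.str l).length < W := by omega
    have j5 : (S.str r).length < W := by omega
    by_cases h1 : d < (S.str l).length <;> by_cases h2 : d < (S.str r).length <;>
      simp [affixStepCmd, hI, hL, hR, hD, hQQ, lenl, lenr, h1, h2, i1, i2, i3, i4, i5, j1, j2, j3,
        j4, j5] <;> omega
  · rintro _ - rfl
    have e1 : ∀ c, (affixStepCmd.run N).mem aPre c =
        if c = i * (2 * q) + d then letterAt (S.str i) d else N.mem aPre c := by
      intro c
      rw [hp.str_eq, letterAt_append]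
      by_cases h1 : d < (S.str l).length <;> by_cases h2 : d < (S.str r).length <;>
        simp [affixStepCmd, hI, hL, hR, hD, hQQ, lenl, lenr, h1, h2, (hpl d hd).1,
          (hpr (d - (S.str l).length) (by omega)).1]
    have e2 : ∀ c, (affixStepCmd.run N).mem aSuf c =
        if c = i * (2 * q) + d then letterAt (S.str i).reverse d else N.mem aSuf c := by
      intro c
      rw [hp.str_eq, List.reverse_append, letterAt_append, List.length_reverse]
      by_cases h1 : d < (S.str l).length <;> by_cases h2 : d < (S.str r).length <;>
        simp [affixStepCmd, hI, hL, hR, hD, hQQ, lenl, lenr, h1, h2, (hpr d hd).2,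
          (hpl (d - (S.str r).length) (by omega)).2]
    have e3 : (affixStepCmd.run N).mem aReach = N.mem aReach := by
      funext c
      by_cases h1 : d < (S.str l).length <;> by_cases h2 : d < (S.str r).length <;>
        simp [affixStepCmd, hI, hL, hR, hD, hQQ, lenl, lenr, h1, h2]
    refine ⟨?_, ?_, ?_⟩
    · intro j hj hrj d' hd'
      have := mul_add_lt_mul hj hd'
      rw [e3] at hrj
      rw [e1, e2, if_neg (by omega), if_neg (by omega)]
      exact ha.done j hj hrj d' hd'
    · intro d' hd'
      rw [e1, e2]
      by_cases hdd : d' = d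
      · simp [hdd]
      · rw [if_neg (by omega), if_neg (by omega)]
        exact ha.current d' (by omega)
    · intro c hc
      rw [e1, e2, if_neg (by omega), if_neg (by omega)]
      exact ha.empty c (by omega)

theorem affixCmd_run {W : ℕ} {S : SLP (Fin σ)} {q : ℕ} {N : NState} (hq : 1 ≤ q)
    (h : Counted S q N) (hW : S.text.length + 2 * (q * S.size) < W)
    (hz : ∀ i, N.mem aPre i = 0 ∧ N.mem aSuf i = 0) :
    Run W affixCmd N (300 * (q * S.size) + 100) fun N' => N'.reg rQQ = 2 * q ∧
      ∀ i < S.size, N'.mem aReach i ≠ 0 → Affixes q N' i (2 * q) (S.str i) := by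
  have hsq : S.size ≤ q * S.size := Nat.le_mul_of_pos_left _ hq
  have hqs : q ≤ q * S.size := Nat.le_mul_of_pos_right _ S.size_pos
  refine Run.seq_straight (T := 300 * (q * S.size) + 50) (by decide) (by simp)
    (fun hF => ?_) (by simp; omega)
  have h1 := h.of_frame hF (by decide)
  have hQQ : (Cmd.run (.assign rQQ (2 * .var rQ)) N).reg rQQ = 2 * q := by simp [h.input.gram]
  have hz1 : ∀ i, (Cmd.run (.assign rQQ (2 * .var rQ)) N).mem aPre i = 0 ∧
      (Cmd.run (.assign rQQ (2 * .var rQ)) N).mem aSuf i = 0 := by simpa using hz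
  generalize Cmd.run (.assign rQQ (2 * .var rQ)) N = N1 at *
  refine (Run.for (T := 300 * (q * S.size) + 50) S.size (160 * q + 40)
    (fun k N' => AffixInv S q k 0 N')
    h1.input.size (by omega) (by decide) (by decide) (by decide) ?_ ?_ ?_).conseq le_rfl
    fun N' hF h => ⟨by rw [hF.reg _ (by decide), hQQ], h.done⟩
  · exact ⟨fun i hi => absurd hi (by omega), fun d hd => absurd hd (by omega),
      fun c _ => hz1 c⟩
  · intro k hk N' hF hreg hI
    have h2 := h1.of_frame hF (by decide)
    have hQQ' : N'.reg rQQ = 2 * q := by rw [hF.reg _ (by decide), hQQ]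
    have hZ : S.size * (2 * q) = 2 * (q * S.size) := by ring
    have hkW := mul_add_lt_mul hk (show 0 < 2 * q by omega)
    have hle := h2.inv.reach_le k
    refine Run.ite (T := 160 * q + 35) (by simp [hreg]; omega) (by simp [hreg]; omega) (fun hr => ?_)
      (fun hr => ?_) (by simp; omega)
    · simp only [Expr.nev, hreg] at hr
      rcases SLP.isLetter_or_isPair hk with ⟨a, ha⟩ | ⟨l, r, hp⟩
      · obtain ⟨h3, h4⟩ := h2.input.letter k a ha
        refine Run.ite (T := 12) (by simp [hreg]; omega) (by simp [hreg, h3]; omega)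
          (fun hr => absurd hr (by simp [hreg, h3])) (fun _ => ?_) (by simp)
        refine (Run.straight (by decide) ?_).conseq (by simp) ?_
        · simp [hreg, hQQ']
          omega
        · rintro _ - rfl -
          refine AffixInv.next ⟨fun i hi hri d hd => ?_, fun d hd => ?_, fun c hc => ?_⟩
          · have := mul_add_lt_mul hi hd
            simp [hreg, hQQ', show i * (2 * q) + d ≠ k * (2 * q) by omega]
            exact hI.done i hi (by simpa using hri) d hd
          · have := hI.empty (k * (2 * q) + d) (by omega)
            simp [hreg, hQQ', h4, ha.str_eq, letterAt_singleton, this]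
          · simp [hreg, hQQ', show c ≠ k * (2 * q) by omega]
            exact hI.empty c (by omega)
      · obtain ⟨h3, h4, h5⟩ := h2.input.pair k l r hp
        refine Run.ite (T := 160 * q + 30) (by simp [hreg]; omega) (by simp [hreg, h3]; omega)
          (fun _ => ?_) (fun hr => absurd hr (by simp [hreg, h3])) (by simp; omega)
        refine Run.seq_straight (T := 160 * q + 25) (by decide) (by simp [hreg]; omega)
          (fun hF3 => ?_) (by simp; omega)
        refine Run.seq_straight (T := 160 * q + 20) (by decide) (by simp [hreg]; omega)
          (fun hF4 => ?_) (by simp; omega)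
        have h6 := (h2.of_frame hF3 (by decide)).of_frame hF4 (by decide)
        refine (Run.for (T := 160 * q + 20) (2 * q) 72
          (fun d N' => AffixInv S q k d N') (by simp [hQQ']) (by omega) (by decide) (by decide)
          (by decide) ?_ ?_ (by omega)).conseq le_rfl fun N' _ h _ => ?_
        · exact ⟨hI.done, hI.current, hI.empty⟩
        · intro d hd N3 hF5 hregd hId
          have h7 := h6.of_frame hF5 (by decide)
          refine (affixStepCmd_run (l := l) (r := r) h7 hW ?_ ?_ ?_ hregd ?_ hp ?_ hd hId).conseq
            le_rfl fun N4 _ h _ => ⟨h.done, h.current, h.empty⟩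
          · rw [hF5.reg _ (by decide)]; simp [hreg]
          · rw [hF5.reg _ (by decide)]; simp [hreg, h4]
          · rw [hF5.reg _ (by decide)]; simp [hreg, h5]
          · rw [hF5.reg _ (by decide)]; simp [hQQ']
          · rw [hF5.mem _ (by decide)]; simpa using hr
        · have := h.next
          exact ⟨this.done, this.current, this.empty⟩
    · simp only [Expr.nev, hreg] at hr
      refine Run.skip.conseq (by omega) ?_
      rintro _ - rfl -
      refine ⟨fun i hi hri => ?_, fun d hd => absurd hd (by omega), fun c hc => ?_⟩
      · rcases Nat.lt_succ_iff_lt_or_eq.1 hi with hi | rfl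
        · exact hI.done i hi hri
        · exact absurd hr hri
      · rw [Nat.succ_mul] at hc
        exact hI.empty c (by omega)
  · have : S.size * (160 * q + 40 + 8) = 160 * (q * S.size) + 48 * S.size := by ring
    omega

/-! ### The program: the list of weighted `q`-grams -/

theorem Occ_nonempty_iff {α : Type} [DecidableEq α] {w P : List α} (hP : P ≠ []) :
    (Occ w P).Nonempty ↔ P <:+: w := by
  constructor
  · rintro ⟨k, hk⟩
    exact ((mem_Occ hP).1 hk).2.isInfix.trans (List.drop_suffix _ _).isInfix
  · rintro ⟨s, t, rfl⟩
    refine ⟨s.length + 1, (mem_Occ hP).2 ⟨by omega, ?_⟩⟩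
    simp

theorem nOcc_le_length {α : Type} [DecidableEq α] (w P : List α) : nOcc w P ≤ w.length := by
  refine Finset.sup_le fun A hA => ?_
  simp only [Finset.mem_filter, Finset.mem_powerset] at hA
  calc A.card ≤ (Finset.Icc 1 w.length).card :=
        Finset.card_le_card (hA.1.trans (Finset.filter_subset _ _))
    _ = w.length := by simp

theorem nOcc_pos {α : Type} [DecidableEq α] {w P : List α} (h : (Occ w P).Nonempty) :
    0 < nOcc w P := by
  obtain ⟨k, hk⟩ := h
  have : ({k} : Finset ℕ).card ≤ nOcc w P :=
    card_le_maxSep (by simpa using hk) (by simp [NonOverlapping])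
  rwa [Finset.card_singleton] at this

theorem letterAt_reverse {u : List (Fin σ)} {d : ℕ} (h : d < u.length) :
    letterAt u.reverse d = letterAt u (u.length - 1 - d) := by
  rw [letterAt_of_lt (by simpa using h), letterAt_of_lt (by omega), List.getElem_reverse]

theorem letterAt_lookupGram {q o t : ℕ} {u v : List (Fin σ)}
    (hv : ValidLookup q u.length (u ++ v).length o) (ht : t < q) :
    letterAt (lookupGram q u.length (u ++ v) o) t =
      if o + 1 + t < 2 * (q - 1) + 1 then letterAt u.reverse (2 * (q - 1) - (o + 1 + t))
      else letterAt v (o + 1 + t - 2 * (q - 1) - 1) := by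
  unfold ValidLookup at hv
  have hl : (u ++ v).length = u.length + v.length := List.length_append
  have h1 : letterAt (lookupGram q u.length (u ++ v) o) t =
      letterAt (u ++ v) (lookupPos q u.length o - 1 + t) := by
    have e : lookupPos q u.length o + q - 1 + 1 - lookupPos q u.length o = q := by
      unfold lookupPos; omega
    have hlt : lookupPos q u.length o - 1 + t < (u ++ v).length := by
      unfold lookupPos; omega
    rw [lookupGram, slice, e, letterAt_of_lt hlt, letterAt_of_lt (by
      simp only [List.length_take, List.length_drop]
      omega)]
    simp only [List.getElem_take, List.getElem_drop]
  rw [h1, letterAt_append]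
  unfold lookupPos
  split_ifs with h2 h3 h3
  · rw [letterAt_reverse (by omega)]
    congr 1
    omega
  · omega
  · omega
  · congr 1
    omega

/-- A list of strings with multiplicities. -/
abbrev WList (σ : ℕ) := List (List (Fin σ) × ℕ)

/-- The total multiplicity of the string `P` in a list. -/
def total (L : WList σ) (P : List (Fin σ)) : ℕ := (L.map fun p => if p.1 = P then p.2 else 0).sum

theorem total_concat (L : WList σ) (g : List (Fin σ)) (v : ℕ) (P : List (Fin σ)) :
    total (L ++ [(g, v)]) P = total L P + if g = P then v else 0 := by
  simp [total]

/-- The memory holds the list `L` of `q`-grams with multiplicities. -/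
structure Items (q : ℕ) (L : WList σ) (N : NState) : Prop where
  count : N.reg rM = L.length
  gram : ∀ k p, L[k]? = some p → ∀ t < q, N.mem aGram (k * q + t) = letterAt p.1 t
  val : ∀ k p, L[k]? = some p → N.mem aVal k = p.2

theorem Items.concat {q : ℕ} {L : WList σ} {N N' : NState} (h : Items q L N) (g : List (Fin σ))
    (v : ℕ) (h1 : N'.reg rM = L.length + 1) (h2 : ∀ c < L.length * q, N'.mem aGram c = N.mem aGram c)
    (h3 : ∀ t < q, N'.mem aGram (L.length * q + t) = letterAt g t)
    (h4 : ∀ k < L.length, N'.mem aVal k = N.mem aVal k) (h5 : N'.mem aVal L.length = v) :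
    Items q (L ++ [(g, v)]) N' where
  count := by rw [h1]; simp
  gram k p hk t ht := by
    rcases lt_trichotomy k L.length with hlt | rfl | hlt
    · rw [List.getElem?_append_left hlt] at hk
      rw [h2 _ (mul_add_lt_mul hlt ht)]
      exact h.gram k p hk t ht
    · simp at hk
      rw [h3 t ht, ← hk]
    · rw [List.getElem?_eq_none (by simp; omega)] at hk
      cases hk
  val k p hk := by
    rcases lt_trichotomy k L.length with hlt | rfl | hlt
    · rw [List.getElem?_append_left hlt] at hk
      rw [h4 _ hlt]
      exact h.val k p hk
    · simp at hk
      rw [h5, ← hk]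
    · rw [List.getElem?_eq_none (by simp; omega)] at hk
      cases hk

theorem Items.congr {q : ℕ} {L : WList σ} {N N' : NState} (h : Items q L N)
    (h1 : N'.reg rM = N.reg rM) (h2 : N'.mem aGram = N.mem aGram) (h3 : N'.mem aVal = N.mem aVal) :
    Items q L N' where
  count := h1.trans h.count
  gram := by rw [h2]; exact h.gram
  val := by rw [h3]; exact h.val

/-- One letter of the current `q`-gram. -/
def gramStepCmd : Cmd :=
  .ite (.op .lt (.var rK + 1 + .var rD) (.var rH + 1))
    (.put aGram (.var rM * .var rQ + .var rD)
      (.get aSuf (.var rL * .var rQQ + (.var rH - (.var rK + 1 + .var rD)))))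
    (.put aGram (.var rM * .var rQ + .var rD)
      (.get aPre (.var rR * .var rQQ + (.var rK + 1 + .var rD - .var rH - 1))))

/-- `1` if the cluster that begins at `rU` is at least `q - 1` positions away from the left border. -/
def leftExpr : Expr := 1 - .op .lt (.var rU) (.var rQ)

/-- `1` if the cluster that ends at `rV` is at least `q - 1` positions away from the right border. -/
def rightExpr : Expr := 1 - .op .lt (.get aLen (.var rI)) (.var rV + (.var rQ - 1))

/-- The multiplicity of the current cluster, `0` if it has been found before. Stamps are `i + 1`, so
they distinguish the variables from each other and from empty cells. -/
def valueExpr : Expr :=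
  (1 - .op .eq (.get aStamp (.var rU)) (.var rI + 1)) *
    ((.get aTT (.var rI) + leftExpr * .get aFT (.var rI) + rightExpr * .get aTF (.var rI) +
      leftExpr * rightExpr * .get aFF (.var rI)) * .get aNum (.var rP))

/-- The position to be looked up is the position of a `q`-gram. -/
def validExpr : Expr :=
  .op .lt (.var rH) (.var rK + 1 + .get aLen (.var rL)) *
    .op .lt (.var rK + 1 + .get aLen (.var rL) + .var rQ) (.get aLen (.var rI) + 2 + .var rH)

/-- Reads the data of the current lookup and computes its multiplicity. -/
def readCmd : Cmd :=
  .assign rP (3 * .var rQ * .var rI + (.var rK + 1)) ;;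
  .assign rU (.get aBeg (.var rP)) ;;
  .assign rV (.get aEnd (.var rP)) ;;
  .put aVal (.var rM) valueExpr ;;
  .put aStamp (.var rU) (.var rI + 1)

/-- One lookup. -/
def lookupCmd : Cmd :=
  .ite validExpr (readCmd ;; .for rD rQ gramStepCmd ;; .assign rM (.var rM + 1)) .skip

/-- The item of a variable `X_i = a`, needed only for `q = 1`. -/
def letterCmd : Cmd :=
  .put aGram (.var rM * .var rQ) (.get aFst (.var rI)) ;;
  .put aVal (.var rM) (.get aTT (.var rI) + .get aTF (.var rI) + .get aFT (.var rI) +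
    .get aFF (.var rI)) ;;
  .assign rM (.var rM + 1)

/-- The list of the `q`-grams of all lookups. -/
def itemCmd : Cmd :=
  .assign rM 0 ;; .assign rH (2 * (.var rQ - 1)) ;; .assign rB (3 * (.var rQ - 1)) ;;
  .for rI rN
    (.ite (.get aReach (.var rI))
      (.ite (.get aKind (.var rI))
        (.assign rL (.get aFst (.var rI)) ;; .assign rR (.get aSnd (.var rI)) ;;
          .for rK rB lookupCmd)
        (.ite (.op .eq (.var rQ) 1) letterCmd .skip)) .skip)

/-- The state of the registers and tables during the lookups for `X_i = X_l X_r`. -/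
structure LookupState (S : SLP (Fin σ)) (q i l r : ℕ) (N : NState) : Prop where
  counted : Counted S q N
  affixes : ∀ i < S.size, N.mem aReach i ≠ 0 → Affixes q N i (2 * q) (S.str i)
  pair : S.IsPair i l r
  reach : N.mem aReach i ≠ 0
  hI : N.reg rI = i
  hL : N.reg rL = l
  hR : N.reg rR = r
  hH : N.reg rH = 2 * (q - 1)
  hQQ : N.reg rQQ = 2 * q

theorem LookupState.of_frame {S : SLP (Fin σ)} {q i l r : ℕ} {c : Cmd} {N N' : NState}
    (h : LookupState S q i l r N) (hF : Frame c N N')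
    (hw : (∀ x ∈ [rN, rQ, rI, rL, rR, rH, rQQ], c.writesReg x = false) ∧
      ∀ a < 14, c.writesMem a = false) :
    LookupState S q i l r N' := by
  have hr : ∀ x ∈ [rN, rQ, rI, rL, rR, rH, rQQ], N'.reg x = N.reg x :=
    fun x hx => hF.reg x (hw.1 x hx)
  have hm : ∀ a < 14, N'.mem a = N.mem a := fun a ha => hF.mem a (hw.2 a ha)
  refine ⟨h.counted.of_frame hF ⟨hw.1 _ (by simp), hw.1 _ (by simp), fun a ha => hw.2 a (by omega)⟩,
    ?_, h.pair, ?_, ?_, ?_, ?_, ?_, ?_⟩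
  · unfold Affixes
    rw [hm 7 (by decide), hm 12 (by decide), hm 13 (by decide)]
    exact h.affixes
  · rw [hm 7 (by decide)]
    exact h.reach
  · rw [hr _ (by simp), h.hI]
  · rw [hr _ (by simp), h.hL]
  · rw [hr _ (by simp), h.hR]
  · rw [hr _ (by simp), h.hH]
  · rw [hr _ (by simp), h.hQQ]

theorem gramStepCmd_run {W : ℕ} {S : SLP (Fin σ)} {q i l r o m t : ℕ} {N : NState}
    (h : LookupState S q i l r N) (hW : S.text.length + 2 * (q * S.size) + 4 * q < W)
    (hK : N.reg rK = o) (hM : N.reg rM = m) (hD : N.reg rD = t) (hmW : m * q + t < W)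
    (ho : o < 3 * (q - 1)) (hv : ValidLookup q (S.str l).length (S.str i).length o) (ht : t < q) :
    Run W gramStepCmd N 50 fun N' => N' = N.setMem aGram (m * q + t)
      (letterAt (lookupGram q (S.str l).length (S.str i) o) t) := by
  obtain ⟨hli, hri, hin⟩ := h.pair.lt
  obtain ⟨hrl, hrr⟩ := h.counted.inv.closed i l r (Nat.zero_le _) h.reach h.pair
  have hZ : S.size * (2 * q) = 2 * (q * S.size) := by ring
  have hidx : ∀ j < S.size, ∀ d < 2 * q, j * (2 * q) + d < W := fun j hj d hd => by
    have := mul_add_lt_mul hj hd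
    omega
  have hpl : ∀ d < 2 * q, _ := h.affixes l (hli.trans hin) hrl
  have hpr : ∀ d < 2 * q, _ := h.affixes r (hri.trans hin) hrr
  have hQ := h.counted.input.gram
  have hI := h.hI
  have hL := h.hL
  have hR := h.hR
  have hH := h.hH
  have hQQ := h.hQQ
  have i1 := hidx l (hli.trans hin) (2 * (q - 1) - (o + 1 + t)) (by omega)
  have i2 := hidx r (hri.trans hin) (o + 1 + t - 2 * (q - 1) - 1) (by omega)
  have j1 := (hpl (2 * (q - 1) - (o + 1 + t)) (by omega)).2
  have j2 := (hpr (o + 1 + t - 2 * (q - 1) - 1) (by omega)).1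
  rw [h.pair.str_eq] at hv ⊢
  rw [letterAt_lookupGram hv ht]
  by_cases hc : o + 1 + t < 2 * (q - 1) + 1
  · refine (Run.straight (by decide) ?_).conseq (by simp [gramStepCmd]) ?_
    · simp [gramStepCmd, hQ, hL, hH, hQQ, hK, hM, hD, hc, hmW, i1]
      omega
    · rintro _ - rfl
      simp only [gramStepCmd, Cmd.run, Expr.nev, Op.nev, Expr.add_def, Expr.mul_def, Expr.sub_def,
        Expr.ofNat_def, hQ, hL, hH, hQQ, hK, hM, hD, hc, j1, if_true, one_ne_zero, if_false]
  · refine (Run.straight (by decide) ?_).conseq (by simp [gramStepCmd]) ?_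
    · simp [gramStepCmd, hQ, hR, hH, hQQ, hK, hM, hD, hc, hmW, i2]
      omega
    · rintro _ - rfl
      simp only [gramStepCmd, Cmd.run, Expr.nev, Op.nev, Expr.add_def, Expr.mul_def, Expr.sub_def,
        Expr.ofNat_def, hQ, hR, hH, hQQ, hK, hM, hD, hc, j2, if_true, if_false]

theorem gramCmd_run {W : ℕ} {S : SLP (Fin σ)} {q i l r o m : ℕ} {N : NState}
    (h : LookupState S q i l r N) (hW : S.text.length + 2 * (q * S.size) + 4 * q < W)
    (hK : N.reg rK = o) (hM : N.reg rM = m) (hmW : m * q + q < W)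
    (ho : o < 3 * (q - 1)) (hv : ValidLookup q (S.str l).length (S.str i).length o) :
    Run W (.for rD rQ gramStepCmd) N (58 * q + 6) fun N' =>
      (∀ c < m * q, N'.mem aGram c = N.mem aGram c) ∧
      ∀ t < q, N'.mem aGram (m * q + t) =
        letterAt (lookupGram q (S.str l).length (S.str i) o) t := by
  refine Run.for q 50 (fun t N' => (∀ c < m * q, N'.mem aGram c = N.mem aGram c) ∧
      ∀ t' < t, N'.mem aGram (m * q + t') =
        letterAt (lookupGram q (S.str l).length (S.str i) o) t')
    h.counted.input.gram (by omega) (by decide) (by decide) (by decide) ?_ ?_ (by omega)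
  · exact ⟨fun _ _ => rfl, fun t ht => absurd ht (by omega)⟩
  · rintro t ht N' hF hD ⟨hI1, hI2⟩
    have h' := h.of_frame hF (by decide)
    have hK' : N'.reg rK = o := by rw [hF.reg _ (by decide), hK]
    have hM' : N'.reg rM = m := by rw [hF.reg _ (by decide), hM]
    refine (gramStepCmd_run h' hW hK' hM' hD (by omega) ho hv ht).conseq le_rfl ?_
    rintro _ - rfl -
    constructor
    · intro c hc
      simp [show c ≠ m * q + t by omega, hI1 c hc]
    · intro t' ht'
      by_cases e : t' = t
      · simp [e]
      · simp [e, hI2 t' (by omega)]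

open Classical in
/-- The multiplicity of the `o`-th lookup for `X_i = X_l X_r`: the number of non-overlapping
occurrences in the cluster that it finds, times the weight of the cluster; `0` if an earlier lookup
has found the cluster. -/
noncomputable def lookupValue (S : SLP (Fin σ)) (q i l : ℕ) (N : NState) (o : ℕ) : ℕ :=
  if ValidLookup q (S.str l).length (S.str i).length o ∧
      FreshLookup q (S.str l).length (S.str i).length (fun o => N.mem aBeg (3 * q * i + (o + 1))) o
  then (countsOf N i).weight q (S.str i).length (N.mem aBeg (3 * q * i + (o + 1)))
    (N.mem aEnd (3 * q * i + (o + 1)) - (q - 1)) * N.mem aNum (3 * q * i + (o + 1)) else 0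

theorem lookupValue_congr {S : SLP (Fin σ)} {q i l : ℕ} {N N' : NState}
    (h1 : countsOf N' = countsOf N) (h2 : ∀ a ∈ [aBeg, aEnd, aNum], N'.mem a = N.mem a) :
    lookupValue S q i l N' = lookupValue S q i l N := by
  funext o
  unfold lookupValue
  rw [h1, h2 aBeg (by simp), h2 aEnd (by simp), h2 aNum (by simp)]

/-- The list `L` after the first `o` lookups for `X_i = X_l X_r`. -/
structure LookupInv (S : SLP (Fin σ)) (q i l o : ℕ) (N : NState) (L : WList σ) : Prop where
  items : Items q L N
  length_le : L.length ≤ 3 * q * i + o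
  mem : ∀ p ∈ L, p.1.length = q ∧ p.1 <:+: S.text
  total_eq : ∀ P : List (Fin σ), P.length = q → total L P =
    ∑ j ∈ Finset.range i, S.ownFreq (countsOf N j) j P +
    ∑ o' ∈ Finset.range o,
      if lookupGram q (S.str l).length (S.str i) o' = P then lookupValue S q i l N o' else 0
  stamp_le : ∀ x, N.mem aStamp x ≤ i + 1
  stamp_eq : ∀ x, N.mem aStamp x = i + 1 ↔ ∃ o' < o,
    ValidLookup q (S.str l).length (S.str i).length o' ∧ N.mem aBeg (3 * q * i + (o' + 1)) = x

theorem LookupInv.congr {S : SLP (Fin σ)} {q i l o : ℕ} {N N' : NState} {L : WList σ}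
    (h : LookupInv S q i l o N L) (h1 : N'.reg rM = N.reg rM) (h2 : N'.mem = N.mem) :
    LookupInv S q i l o N' L := by
  have e1 : countsOf N' = countsOf N := by
    funext j
    simp only [countsOf, h2]
  have e2 : lookupValue S q i l N' = lookupValue S q i l N :=
    lookupValue_congr e1 fun a _ => by rw [h2]
  exact ⟨h.items.congr h1 (by rw [h2]) (by rw [h2]), h.length_le, h.mem,
    by rw [e1, e2]; exact h.total_eq, by rw [h2]; exact h.stamp_le, by rw [h2]; exact h.stamp_eq⟩

theorem LookupState.cover {S : SLP (Fin σ)} {q i l r o : ℕ} {N : NState}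
    (h : LookupState S q i l r N) (ho : o < 3 * (q - 1))
    (hv : ValidLookup q (S.str l).length (S.str i).length o) :
    IsLongestCover q (S.str i) (lookupPos q (S.str l).length o)
      (N.mem aBeg (3 * q * i + (o + 1))) (N.mem aEnd (3 * q * i + (o + 1))) ∧
    N.mem aNum (3 * q * i + (o + 1)) =
      nOcc (slice (S.str i) (N.mem aBeg (3 * q * i + (o + 1)))
        (N.mem aEnd (3 * q * i + (o + 1)))) (lookupGram q (S.str l).length (S.str i) o) :=
  h.counted.input.cover i l r h.pair
    (h.counted.inv.infix_text i h.pair.lt.2.2 h.reach) o ho hv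

theorem IsLongestCover.le_length {α : Type} [DecidableEq α] {w : List α} {q m o x y : ℕ}
    (hq : 1 ≤ q) (hv : ValidLookup q m w.length o)
    (h : IsLongestCover q w (lookupPos q m o) x y) :
    x ≤ w.length ∧ y ≤ w.length ∧ q - 1 ≤ y := by
  obtain ⟨⟨h1, ⟨f, hf, rfl⟩, -⟩, -⟩ := h
  unfold ValidLookup at hv
  have hl := (slice_mem_Occ (w := w) (j := lookupPos q m o) hq
    (by unfold lookupPos; omega) (by unfold lookupPos; omega)).1
  have h2 := le_length_of_mem_Occ h1
  have h3 := le_length_of_mem_Occ hf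
  rw [hl] at h2 h3
  omega

theorem readCmd_run {W : ℕ} {S : SLP (Fin σ)} {q i l r o m : ℕ} {N : NState} (hq : 1 ≤ q)
    (h : LookupState S q i l r N) (hW : S.text.length + 4 * (q * S.size) < W)
    (hK : N.reg rK = o) (hM : N.reg rM = m) (hmW : m < W) (ho : o < 3 * (q - 1))
    (hv : ValidLookup q (S.str l).length (S.str i).length o)
    (hle : ∀ x, N.mem aStamp x ≤ i + 1)
    (hst : ∀ x, N.mem aStamp x = i + 1 ↔ ∃ o' < o,
      ValidLookup q (S.str l).length (S.str i).length o' ∧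
        N.mem aBeg (3 * q * i + (o' + 1)) = x) :
    readCmd.Safe W N ∧
    (∀ k, (readCmd.run N).mem aVal k =
      if k = m then lookupValue S q i l N o else N.mem aVal k) ∧
    ∀ c, (readCmd.run N).mem aStamp c =
      if c = N.mem aBeg (3 * q * i + (o + 1)) then i + 1 else N.mem aStamp c := by
  classical
  obtain ⟨hli, hri, hin⟩ := h.pair.lt
  obtain ⟨hcov, -⟩ := h.cover ho hv
  obtain ⟨hx, hy, hqy⟩ := IsLongestCover.le_length hq hv hcov
  have hlen := h.counted.len i hin
  have hlt := h.counted.len_le hin h.reach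
  have hQ := h.counted.input.gram
  have hI := h.hI
  have hz : 3 * q * i + (o + 1) < W := by
    have := mul_add_lt_mul (Z := 3 * q) (d := o + 1) hin (by omega)
    have e : S.size * (3 * q) = 3 * (q * S.size) := by ring
    have e' : i * (3 * q) = 3 * q * i := by ring
    omega
  have hiW : i + 1 < W := by
    have := Nat.le_mul_of_pos_left S.size hq
    omega
  have hqW : q < W := by
    have := Nat.le_mul_of_pos_right q S.size_pos
    omega
  have hyW : N.mem aEnd (3 * q * i + (o + 1)) + (q - 1) < W := by
    have := Nat.le_mul_of_pos_right q S.size_pos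
    omega
  have hfr : FreshLookup q (S.str l).length (S.str i).length
      (fun o => N.mem aBeg (3 * q * i + (o + 1))) o ↔
      N.mem aStamp (N.mem aBeg (3 * q * i + (o + 1))) ≠ i + 1 := by
    rw [ne_eq, hst]
    unfold FreshLookup
    push Not
    rfl
  have hsW := hle (N.mem aBeg (3 * q * i + (o + 1)))
  unfold lookupValue
  rw [hfr]
  generalize hzz : 3 * q * i + (o + 1) = z at *
  generalize hxx : N.mem aBeg z = x at *
  generalize hyy : N.mem aEnd z = y at *
  refine ⟨?_, ?_, ?_⟩
  · simp [readCmd, valueExpr, leftExpr, rightExpr, hQ, hI, hK, hM, hzz, hxx, hyy, hlen]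
    and_intros <;> first | omega | (split_ifs <;> omega)
  · intro k
    have e1 : (y - (q - 1) + 2 * (q - 1) ≤ (S.str i).length) ↔
        ¬ ((S.str i).length < y + (q - 1)) := by omega
    have e2 : q ≤ x ↔ ¬ x < q := by omega
    simp only [Counts.weight, e1, e2]
    by_cases c1 : x < q <;> by_cases c2 : (S.str i).length < y + (q - 1) <;>
      by_cases c3 : N.mem aStamp x = i + 1 <;>
      simp [readCmd, valueExpr, leftExpr, rightExpr, hQ, hI, hK, hM, hzz, hxx, hyy, hlen, c1, c2,
        c3, hv, countsOf]
  · intro c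
    simp [readCmd, hQ, hI, hK, hzz, hxx]

theorem LookupInv.skip {S : SLP (Fin σ)} {q i l o : ℕ} {N : NState} {L : WList σ}
    (h : LookupInv S q i l o N L) (hv : ¬ ValidLookup q (S.str l).length (S.str i).length o) :
    LookupInv S q i l (o + 1) N L where
  items := h.items
  length_le := h.length_le.trans (by omega)
  mem := h.mem
  total_eq P hP := by
    have h0 : lookupValue S q i l N o = 0 := if_neg fun g => hv g.1
    rw [h.total_eq P hP, Finset.sum_range_succ, h0, ite_self, add_zero]
  stamp_le := h.stamp_le
  stamp_eq x := by
    rw [h.stamp_eq]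
    constructor
    · rintro ⟨o', ho', h1⟩
      exact ⟨o', by omega, h1⟩
    · rintro ⟨o', ho', h1⟩
      rcases Nat.lt_succ_iff_lt_or_eq.1 ho' with h2 | rfl
      · exact ⟨o', h2, h1⟩
      · exact absurd h1.1 hv

theorem LookupInv.concat {S : SLP (Fin σ)} {q i l r o : ℕ} {N N' : NState} {L : WList σ}
    (hq : 1 ≤ q) (hp : S.IsPair i l r) (hi : S.str i <:+: S.text)
    (h : LookupInv S q i l o N L)
    (hv : ValidLookup q (S.str l).length (S.str i).length o)
    (hs : ∀ a < 14, N'.mem a = N.mem a)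
    (h1 : N'.reg rM = L.length + 1)
    (h2 : ∀ c < L.length * q, N'.mem aGram c = N.mem aGram c)
    (h3 : ∀ t < q, N'.mem aGram (L.length * q + t) =
      letterAt (lookupGram q (S.str l).length (S.str i) o) t)
    (h4 : ∀ k, N'.mem aVal k = if k = L.length then lookupValue S q i l N o else N.mem aVal k)
    (h5 : ∀ c, N'.mem aStamp c =
      if c = N.mem aBeg (3 * q * i + (o + 1)) then i + 1 else N.mem aStamp c) :
    LookupInv S q i l (o + 1) N'
      (L ++ [(lookupGram q (S.str l).length (S.str i) o, lookupValue S q i l N o)]) := by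
  have e1 : countsOf N' = countsOf N := by
    funext j
    simp only [countsOf, hs 8 (by decide), hs 9 (by decide), hs 10 (by decide), hs 11 (by decide)]
  have e2 : lookupValue S q i l N' = lookupValue S q i l N :=
    lookupValue_congr e1 fun a ha => hs a (by simp at ha; omega)
  refine ⟨?_, ?_, ?_, ?_, ?_, ?_⟩
  · refine h.items.concat _ _ h1 h2 h3 (fun k hk => ?_) ?_
    · rw [h4, if_neg hk.ne]
    · rw [h4, if_pos rfl]
  · have := h.length_le
    simp
    omega
  · intro p hpL
    rcases List.mem_append.1 hpL with hpL | hpL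
    · exact h.mem p hpL
    · obtain rfl := List.mem_singleton.1 hpL
      rw [hp.str_eq] at hv ⊢
      obtain ⟨g1, g2⟩ := lookup_spec hq hv
      refine ⟨g1, ?_⟩
      have hne : lookupGram q (S.str l).length (S.str l ++ S.str r) o ≠ [] := by
        intro e
        rw [e] at g1
        simp at g1
        omega
      rw [hp.str_eq] at hi
      exact ((Occ_nonempty_iff hne).1 ⟨_, g2⟩).trans hi
  · intro P hP
    rw [total_concat, h.total_eq P hP, e1, e2, Finset.sum_range_succ, add_assoc]
  · intro x
    have := h.stamp_le x
    rw [h5]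
    split_ifs <;> omega
  · intro x
    rw [h5, hs aBeg (by decide)]
    constructor
    · intro hx
      split_ifs at hx with hc
      · exact ⟨o, by omega, hv, hc.symm⟩
      · obtain ⟨o', g1, g2⟩ := (h.stamp_eq x).1 hx
        exact ⟨o', by omega, g2⟩
    · rintro ⟨o', g1, g2⟩
      split_ifs with hc
      · rfl
      · refine (h.stamp_eq x).2 ⟨o', ?_, g2⟩
        rcases Nat.lt_succ_iff_lt_or_eq.1 g1 with g3 | rfl
        · exact g3
        · exact absurd g2.2.symm hc

theorem lookupCmd_run {W : ℕ} {S : SLP (Fin σ)} {q i l r o : ℕ} {N : NState} {L : WList σ}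
    (hq : 1 ≤ q) (h : LookupState S q i l r N)
    (hW : 4 * S.text.length + 40 * (q * q * S.size) + 4 * σ < W)
    (hK : N.reg rK = o) (ho : o < 3 * (q - 1)) (hI : LookupInv S q i l o N L) :
    Run W lookupCmd N (58 * q + 150) fun N' => ∃ L', LookupInv S q i l (o + 1) N' L' := by
  obtain ⟨hli, hri, hin⟩ := h.pair.lt
  obtain ⟨hrl, hrr⟩ := h.counted.inv.closed i l r (Nat.zero_le _) h.reach h.pair
  have hqn : q * S.size ≤ q * q * S.size :=
    Nat.mul_le_mul_right _ (Nat.le_mul_of_pos_left q hq)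
  have hqq := Nat.le_mul_of_pos_right q S.size_pos
  have hss := Nat.le_mul_of_pos_left S.size hq
  have hlen := h.counted.len i hin
  have hlt := h.counted.len_le hin h.reach
  have hlenl := h.counted.len l (hli.trans hin)
  have hltl := h.counted.len_le (hli.trans hin) hrl
  have hIi := h.hI
  have hL := h.hL
  have hH := h.hH
  have hQ := h.counted.input.gram
  have hM := hI.items.count
  have hMl : L.length < 3 * (q * S.size) := by
    have h1 := hI.length_le
    have h2 := mul_add_lt_mul (Z := 3 * q) (d := o) hin (by omega)
    have e : S.size * (3 * q) = 3 * (q * S.size) := by ring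
    have e' : i * (3 * q) = 3 * q * i := by ring
    omega
  have hMq : L.length * q + q < W := by
    have h1 := Nat.mul_le_mul_right q hMl.le
    have e : 3 * (q * S.size) * q = 3 * (q * q * S.size) := by ring
    omega
  have hnev : validExpr.nev N =
      if ValidLookup q (S.str l).length (S.str i).length o then 1 else 0 := by
    unfold ValidLookup
    simp only [validExpr, Expr.nev, Op.nev, Expr.mul_def, Expr.add_def, Expr.ofNat_def, hH, hK, hIi,
      hL, hQ, hlen, hlenl]
    by_cases c1 : 2 * (q - 1) < o + 1 + (S.str l).length <;>
      by_cases c2 : o + 1 + (S.str l).length + q < (S.str i).length + 2 + 2 * (q - 1) <;>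
      simp [c1, c2]
  refine Run.ite (T := 58 * q + 90) ?_ ?_ (fun hv => ?_) (fun hv => ?_) (by simp [validExpr]; omega)
  · simp [validExpr, hH, hK, hIi, hL, hQ, hlen, hlenl]
    omega
  · rw [hnev]
    split_ifs <;> omega
  · have hv : ValidLookup q (S.str l).length (S.str i).length o := by
      by_contra hcon
      rw [hnev, if_neg hcon] at hv
      exact hv rfl
    obtain ⟨g1, g2, g3⟩ := readCmd_run (W := W) hq h (by omega) hK hM (by omega) ho hv
      hI.stamp_le hI.stamp_eq
    refine Run.seq_straight (T := 58 * q + 10) (by decide) g1 (fun hF1 => ?_)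
      (by simp [readCmd, valueExpr, leftExpr, rightExpr]; omega)
    generalize readCmd.run N = N1 at *
    have h1 := h.of_frame hF1 (by decide)
    have hK1 : N1.reg rK = o := by rw [hF1.reg _ (by decide), hK]
    have hM1 : N1.reg rM = L.length := by rw [hF1.reg _ (by decide), hM]
    refine Run.conseq (Run.seq (T := 58 * q + 6) (T' := 4)
      ((gramCmd_run h1 (by omega) hK1 hM1 hMq ho hv).conseq le_rfl ?_)) (by omega)
      fun _ _ h => h
    rintro N2 hF2 ⟨f1, f2⟩ -
    refine (Run.straight (by decide) (by simp)).conseq (by simp) ?_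
    rintro _ - rfl
    refine ⟨_, hI.concat hq h.pair (h.counted.inv.infix_text i hin h.reach) hv ?_ ?_ ?_ ?_ ?_ ?_⟩
    · intro a ha
      have w1 : readCmd.writesMem a = false := by
        revert a
        decide
      have w2 : (Cmd.for rD rQ gramStepCmd).writesMem a = false := by
        revert a
        decide
      simp only [Cmd.run, NState.setReg_mem]
      rw [hF2.mem a w2, hF1.mem a w1]
    · simp [hF2.reg rM (by decide), hM1]
    · intro c hc
      simp only [Cmd.run, NState.setReg_mem]
      rw [f1 c hc, hF1.mem aGram (by decide)]
    · intro t ht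
      simp only [Cmd.run, NState.setReg_mem]
      exact f2 t ht
    · intro k
      simp only [Cmd.run, NState.setReg_mem]
      rw [hF2.mem aVal (by decide), g2]
    · intro c
      simp only [Cmd.run, NState.setReg_mem]
      rw [hF2.mem aStamp (by decide), g3]
  · have hv' : ¬ ValidLookup q (S.str l).length (S.str i).length o := by
      intro hcon
      rw [hnev, if_pos hcon] at hv
      exact one_ne_zero hv
    refine Run.skip.conseq (by omega) ?_
    rintro _ - rfl
    exact ⟨L, hI.skip hv'⟩

/-- The list `L` after the variables `X_i` with `i < k` have been treated. -/
structure ItemInv (S : SLP (Fin σ)) (q k : ℕ) (N : NState) (L : WList σ) : Prop where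
  items : Items q L N
  length_le : L.length ≤ 3 * q * k
  mem : ∀ p ∈ L, p.1.length = q ∧ p.1 <:+: S.text
  total_eq : ∀ P : List (Fin σ), P.length = q → total L P =
    ∑ j ∈ Finset.range k, S.ownFreq (countsOf N j) j P
  stamp_le : ∀ x, N.mem aStamp x ≤ k

theorem ItemInv.congr {S : SLP (Fin σ)} {q k : ℕ} {N N' : NState} {L : WList σ}
    (h : ItemInv S q k N L) (h1 : N'.reg rM = N.reg rM) (h2 : N'.mem = N.mem) :
    ItemInv S q k N' L := by
  have e1 : countsOf N' = countsOf N := by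
    funext j
    simp only [countsOf, h2]
  exact ⟨h.items.congr h1 (by rw [h2]) (by rw [h2]), h.length_le, h.mem,
    by rw [e1]; exact h.total_eq, by rw [h2]; exact h.stamp_le⟩

theorem ItemInv.skip {S : SLP (Fin σ)} {q k : ℕ} {N : NState} {L : WList σ}
    (h : ItemInv S q k N L)
    (h0 : ∀ P : List (Fin σ), P.length = q → S.ownFreq (countsOf N k) k P = 0) :
    ItemInv S q (k + 1) N L where
  items := h.items
  length_le := h.length_le.trans (Nat.mul_le_mul_left _ (by omega))
  mem := h.mem
  total_eq P hP := by rw [h.total_eq P hP, Finset.sum_range_succ, h0 P hP, add_zero]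
  stamp_le x := (h.stamp_le x).trans (by omega)

theorem ItemInv.lookupInv {S : SLP (Fin σ)} {q i l : ℕ} {N : NState} {L : WList σ}
    (h : ItemInv S q i N L) : LookupInv S q i l 0 N L where
  items := h.items
  length_le := h.length_le
  mem := h.mem
  total_eq P hP := by simpa using h.total_eq P hP
  stamp_le x := (h.stamp_le x).trans (by omega)
  stamp_eq x := by
    have := h.stamp_le x
    constructor
    · intro hx
      omega
    · rintro ⟨o', ho', -⟩
      omega

/-- After all lookups for `X_i = X_l X_r`, the list has grown by its own frequencies. -/
theorem LookupInv.itemInv {S : SLP (Fin σ)} {q i l r : ℕ} {N : NState} {L : WList σ} (hq : 1 ≤ q)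
    (hs : LookupState S q i l r N) (h : LookupInv S q i l (3 * (q - 1)) N L) :
    ItemInv S q (i + 1) N L where
  items := h.items
  length_le := by
    have := h.length_le
    have e : 3 * q * (i + 1) = 3 * q * i + 3 * q := by ring
    omega
  mem := h.mem
  stamp_le := h.stamp_le
  total_eq P hP := by
    classical
    have hc := fun o ho hv => hs.cover (o := o) ho hv
    rw [h.total_eq P hP, Finset.sum_range_succ, hs.pair.ownFreq_eq]
    congr 1
    simp only [lookupValue]
    rw [hs.pair.str_eq] at hc ⊢
    rw [crossFreq_eq hq (countsOf N i) (S.str l) (S.str r) P hP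
      (fun o => N.mem aBeg (3 * q * i + (o + 1))) (fun o => N.mem aEnd (3 * q * i + (o + 1)))
      (fun o ho hv => (hc o ho hv).1), Finset.sum_filter]
    refine Finset.sum_congr rfl fun o ho => ?_
    by_cases h1 : ValidLookup q (S.str l).length (S.str l ++ S.str r).length o ∧
      FreshLookup q (S.str l).length (S.str l ++ S.str r).length
        (fun o => N.mem aBeg (3 * q * i + (o + 1))) o <;>
    by_cases h2 : lookupGram q (S.str l).length (S.str l ++ S.str r) o = P
    · rw [if_pos h2, if_pos h1, if_pos ⟨h1, h2⟩,
        (hc o (Finset.mem_range.1 ho) h1.1).2]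
    · rw [if_neg h2, if_neg fun g => h2 g.2]
    · rw [if_pos h2, if_neg h1, if_neg fun g => h1 g.1]
    · rw [if_neg h2, if_neg fun g => h2 g.2]

theorem letterCmd_run {W : ℕ} {S : SLP (Fin σ)} {q i : ℕ} {a : Fin σ} {N : NState} {L : WList σ}
    (hq : q = 1) (h : Counted S q N) (hi : N.reg rI = i) (ha : S.IsLetter i a)
    (hinf : S.str i <:+: S.text) (hI : ItemInv S q i N L) (hW : 3 * S.size < W) :
    Run W letterCmd N 40 fun N' => ∃ L', ItemInv S q (i + 1) N' L' := by
  subst hq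
  have hin := ha.1
  have hM := hI.items.count
  have hl := hI.length_le
  have hQ := h.input.gram
  obtain ⟨-, h2⟩ := h.input.letter i a ha
  refine (Run.straight (by decide) ?_).conseq (by simp [letterCmd]) ?_
  · simp [letterCmd, hi, hM, hQ]
    omega
  · rintro _ - rfl
    set N' := letterCmd.run N with hN'
    have e1 : countsOf N' = countsOf N := by
      funext j
      simp [hN', letterCmd, countsOf]
    refine ⟨L ++ [([a], (countsOf N i).tt + (countsOf N i).tf + (countsOf N i).ft +
      (countsOf N i).ff)], ?_, ?_, ?_, ?_, ?_⟩
    · refine hI.items.concat _ _ ?_ ?_ ?_ ?_ ?_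
      · simp [hN', letterCmd, hM]
      · intro c hc
        simp [hN', letterCmd, hM, hQ, show c ≠ L.length by omega]
      · intro t ht
        obtain rfl : t = 0 := by omega
        simp [hN', letterCmd, hM, hQ, hi, h2, letterAt_singleton]
      · intro k hk
        simp [hN', letterCmd, hM, hk.ne]
      · simp [hN', letterCmd, hM, hi, countsOf]
    · simp
      omega
    · intro p hp
      rcases List.mem_append.1 hp with hp | hp
      · exact hI.mem p hp
      · obtain rfl := List.mem_singleton.1 hp
        rw [ha.str_eq] at hinf
        exact ⟨rfl, hinf⟩
    · intro P hP
      rw [total_concat, hI.total_eq P hP, e1, Finset.sum_range_succ, ha.ownFreq_eq,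
        freq_singleton _ _ (by rintro rfl; simp at hP)]
      simp only [eq_comm]
    · intro x
      have := hI.stamp_le x
      simp [hN', letterCmd]
      omega

theorem itemCmd_run {W : ℕ} {S : SLP (Fin σ)} {q : ℕ} {N : NState} (hq : 1 ≤ q)
    (h : Counted S q N) (hW : 4 * S.text.length + 40 * (q * q * S.size) + 4 * σ < W)
    (haff : ∀ i < S.size, N.mem aReach i ≠ 0 → Affixes q N i (2 * q) (S.str i))
    (hQQ : N.reg rQQ = 2 * q) (hz : ∀ x, N.mem aStamp x = 0) :
    Run W itemCmd N (1000 * (q * q * S.size) + 300) fun N' => ∃ L : WList σ, Items q L N' ∧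
      L.length ≤ 3 * (q * S.size) ∧ (∀ p ∈ L, p.1.length = q ∧ p.1 <:+: S.text) ∧
      ∀ P, P.length = q → total L P = nOcc S.text P := by
  have hqn : q * S.size ≤ q * q * S.size :=
    Nat.mul_le_mul_right _ (Nat.le_mul_of_pos_left q hq)
  have hqq := Nat.le_mul_of_pos_right q S.size_pos
  have hss := Nat.le_mul_of_pos_left S.size hq
  have hQ := h.input.gram
  unfold itemCmd
  refine Run.seq_straight (T := 1000 * (q * q * S.size) + 200) (by decide) (by simp)
    (fun hF1 => ?_) (by simp; omega)
  have h1 := h.of_frame hF1 (by decide)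
  refine Run.seq_straight (T := 1000 * (q * q * S.size) + 150) (by decide) (by simp [hQ, hq])
    (fun hF2 => ?_) (by simp; omega)
  have h2 := h1.of_frame hF2 (by decide)
  refine Run.seq_straight (T := 1000 * (q * q * S.size) + 100) (by decide) (by simp [hQ, hq])
    (fun hF3 => ?_) (by simp; omega)
  have h3 := h2.of_frame hF3 (by decide)
  set N1 := Cmd.run (.assign rB (3 * (.var rQ - 1))) (Cmd.run (.assign rH (2 * (.var rQ - 1)))
    (Cmd.run (.assign rM 0) N)) with hN1
  have m1 : N1.mem = N.mem := by simp [hN1]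
  have r1 : N1.reg rM = 0 := by simp [hN1]
  have r2 : N1.reg rH = 2 * (q - 1) := by simp [hN1, hQ]
  have r3 : N1.reg rB = 3 * (q - 1) := by simp [hN1, hQ]
  have r4 : N1.reg rQQ = 2 * q := by simp [hN1, hQQ]
  clear_value N1
  refine (Run.for (T := 1000 * (q * q * S.size) + 100) S.size (174 * (q * q) + 480 * q + 60)
    (fun k N' => ∃ L, ItemInv S q k N' L) h3.input.size (by omega) (by decide) (by decide)
    (by decide) ?_ ?_ ?_).conseq le_rfl ?_
  · refine ⟨[], ⟨by simp [r1, NState.setReg_reg], by simp, by simp⟩, by simp, by simp, ?_, ?_⟩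
    · simp [total]
    · intro x
      simp [m1, hz]
  · rintro k hk N' hF hreg ⟨L, hI⟩
    have h4 := h3.of_frame hF (by decide)
    have hle := h4.inv.reach_le k
    have step : ∀ N'' : NState, (∃ L', ItemInv S q (k + 1) N'' L') →
        Frame (.ite (.get aReach (.var rI))
      (.ite (.get aKind (.var rI))
        (.assign rL (.get aFst (.var rI)) ;; .assign rR (.get aSnd (.var rI)) ;;
          .for rK rB lookupCmd)
        (.ite (.op .eq (.var rQ) 1) letterCmd .skip)) .skip) N' N'' →
        ∃ L', ItemInv S q (k + 1) (N''.setReg rI (k + 1)) L' := by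
      rintro N'' ⟨L', h'⟩ -
      exact ⟨L', h'.congr (by simp) (by simp)⟩
    refine Run.conseq (T := 174 * (q * q) + 480 * q + 60)
      (Q := fun N'' => ∃ L', ItemInv S q (k + 1) N'' L') ?_ le_rfl fun N'' _ h => step N'' h
    refine Run.ite (T := 174 * (q * q) + 480 * q + 55) (by simp [hreg]; omega)
      (by simp [hreg]; omega) (fun hr => ?_) (fun hr => ?_) (by simp; omega)
    · simp only [Expr.nev, hreg] at hr
      rcases SLP.isLetter_or_isPair hk with ⟨a, ha⟩ | ⟨l, r, hp⟩
      · obtain ⟨e1, e2⟩ := h4.input.letter k a ha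
        refine Run.ite (T := 52) (by simp [hreg]; omega) (by simp [hreg, e1]; omega)
          (fun hr => absurd hr (by simp [hreg, e1])) (fun _ => ?_) (by simp)
        refine Run.ite (T := 40) (by simp [h4.input.gram]; omega) ?_ (fun hc => ?_) (fun hc => ?_)
          (by simp)
        · simp [h4.input.gram]
          split_ifs <;> omega
        · have hq1 : q = 1 := by
            by_contra hcon
            simp [h4.input.gram, hcon] at hc
          exact letterCmd_run hq1 h4 hreg ha (h4.inv.infix_text k hk hr) hI (by omega)
        · have hq1 : q ≠ 1 := by
            intro hcon
            simp [h4.input.gram, hcon] at hc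
          refine Run.skip.conseq (by omega) ?_
          rintro _ - rfl
          refine ⟨L, hI.skip fun P hP => ?_⟩
          rw [ha.ownFreq_eq, freq_singleton _ _ (by rintro rfl; simp at hP; omega), if_neg]
          rintro rfl
          simp at hP
          omega
      · obtain ⟨e1, e2, e3⟩ := h4.input.pair k l r hp
        refine Run.ite (T := 174 * (q * q) + 480 * q + 50) (by simp [hreg]; omega)
          (by simp [hreg, e1]; omega) (fun _ => ?_) (fun hr => absurd hr (by simp [hreg, e1]))
          (by simp; omega)
        refine Run.seq_straight (T := 174 * (q * q) + 480 * q + 40) (by decide)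
          (by simp [hreg]; omega) (fun hF4 => ?_) (by simp; omega)
        refine Run.seq_straight (T := 174 * (q * q) + 480 * q + 30) (by decide)
          (by simp [hreg]; omega) (fun hF5 => ?_) (by simp; omega)
        have h6 := (h4.of_frame hF4 (by decide)).of_frame hF5 (by decide)
        set N2 := Cmd.run (.assign rR (.get aSnd (.var rI)))
          (Cmd.run (.assign rL (.get aFst (.var rI))) N') with hN2
        have m2 : N2.mem = N'.mem := by simp [hN2]
        have hrM : N2.reg rM = N'.reg rM := by simp [hN2]
        have hls : LookupState S q k l r N2 := by
          refine ⟨h6, ?_, hp, by rwa [m2], ?_, ?_, ?_, ?_, ?_⟩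
          · unfold Affixes
            rw [m2, hF.mem aReach (by decide), hF.mem aPre (by decide), hF.mem aSuf (by decide), m1]
            exact haff
          · simp [hN2, hreg]
          · simp [hN2, hreg, e2]
          · simp [hN2, hreg, e3]
          · simp [hN2, hF.reg rH (by decide), r2]
          · simp [hN2, hF.reg rQQ (by decide), r4]
        have hB : N2.reg rB = 3 * (q - 1) := by simp [hN2, hF.reg rB (by decide), r3]
        clear_value N2
        have hI2 : LookupInv S q k l 0 N2 L := (hI.congr hrM m2).lookupInv
        refine (Run.for (T := 174 * (q * q) + 480 * q + 30) (3 * (q - 1)) (58 * q + 150)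
          (fun o N3 => ∃ L', LookupInv S q k l o N3 L') hB (by omega) (by decide) (by decide)
          (by decide) ⟨L, hI2.congr (by simp [NState.setReg_reg]) (by simp)⟩ ?_ ?_).conseq le_rfl ?_
        · rintro o ho N3 hF6 hro ⟨L', hL'⟩
          refine (lookupCmd_run hq (hls.of_frame hF6 (by decide)) hW hro ho hL').conseq le_rfl ?_
          rintro N4 - ⟨L2, hL2⟩ -
          exact ⟨L2, hL2.congr (by simp) (by simp)⟩
        · have : 3 * (q - 1) * (58 * q + 150 + 8) ≤ 3 * q * (58 * q + 158) :=
            Nat.mul_le_mul_right _ (by omega)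
          have e : 3 * q * (58 * q + 158) = 174 * (q * q) + 474 * q := by ring
          omega
        · rintro N3 hF6 ⟨L', hL'⟩
          exact ⟨L', hL'.itemInv hq (hls.of_frame hF6 (by decide))⟩
    · simp only [Expr.nev, hreg] at hr
      refine Run.skip.conseq (by omega) ?_
      rintro _ - rfl
      refine ⟨L, hI.skip fun P _ => ?_⟩
      rw [h4.inv.cnt_zero k hr, SLP.ownFreq_zero]
  · have e : S.size * (174 * (q * q) + 480 * q + 60 + 8) =
        174 * (q * q * S.size) + 480 * (q * S.size) + 68 * S.size := by ring
    omega
  · rintro N' hF ⟨L, hI⟩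
    have h4 := h3.of_frame hF (by decide)
    refine ⟨L, hI.items, ?_, hI.mem, fun P hP => ?_⟩
    · have := hI.length_le
      rwa [mul_assoc] at this
    · have := h4.inv.sum_eq P hP
      rw [Finset.range_zero, Finset.sum_empty, zero_add, ← Finset.range_eq_Ico] at this
      rw [hI.total_eq P hP, this]

end RAM

namespace RAM

/-! ### The program: grouping equal `q`-grams -/

/-- Empties the lists of all classes. -/
def clearCmd : Cmd := .for rK rM (.put aHead (.var rK) 0)

/-- Saves the current classes and links the members of each class to a list. -/
def linkCmd : Cmd :=
  .for rK rM
    (.put aOld (.var rK) (.get aNew (.var rK)) ;;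
     .put aNext (.var rK) (.get aHead (.get aNew (.var rK))) ;;
     .put aHead (.get aNew (.var rK)) (.var rK + 1))

/-- Puts one member of the class `rI` into its new class. The table `aRep` proposes a
representative for the letter `rV`; whether it lies in the class and has this letter is checked, so
stale proposals do no harm. -/
def refineStepCmd : Cmd :=
  .assign rU (.var rP - 1) ;;
  .assign rV (.get aGram (.var rU * .var rQ + .var rT)) ;;
  .assign rX (.get aRep (.var rV)) ;;
  .ite (.op .eq (.get aOld (.var rX)) (.var rI) *
      .op .eq (.get aGram (.var rX * .var rQ + .var rT)) (.var rV))
    (.put aNew (.var rU) (.var rX))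
    (.put aNew (.var rU) (.var rU) ;; .put aRep (.var rV) (.var rU)) ;;
  .assign rP (.get aNext (.var rU))

/-- Splits all classes according to the letter at position `rT`. -/
def refineCmd : Cmd :=
  .for rI rM (.assign rP (.get aHead (.var rI)) ;; .while (.var rP) refineStepCmd)

/-- Computes for every `q`-gram of the list the representative of the `q`-grams equal to it. -/
def groupCmd : Cmd := .for rT rQ (clearCmd ;; linkCmd ;; refineCmd)

/-- The elements of `l` are linked by `next`, with `p` as a pointer to the first one. A pointer to
`k` is `k + 1`, and `0` is the null pointer. -/
def Linked (next : ℕ → ℕ) : ℕ → List ℕ → Prop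
  | p, [] => p = 0
  | p, k :: l => p = k + 1 ∧ Linked next (next k) l

theorem Linked.congr {next next' : ℕ → ℕ} {l : List ℕ} {p : ℕ} (h : Linked next p l)
    (he : ∀ k ∈ l, next' k = next k) : Linked next' p l := by
  induction l generalizing p with
  | nil => exact h
  | cons k l ih =>
    refine ⟨h.1, ?_⟩
    rw [he k (by simp)]
    exact ih h.2 fun j hj => he j (by simp [hj])

/-- The members `k < m` of the class `c`, the last one first. -/
def members (cls : ℕ → ℕ) (m c : ℕ) : List ℕ := ((List.range m).filter fun k => cls k = c).reverse

theorem mem_members {cls : ℕ → ℕ} {m c k : ℕ} : k ∈ members cls m c ↔ k < m ∧ cls k = c := by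
  simp [members]

theorem members_succ (cls : ℕ → ℕ) (m c : ℕ) :
    members cls (m + 1) c = if cls m = c then m :: members cls m c else members cls m c := by
  unfold members
  rw [List.range_succ, List.filter_append, List.reverse_append]
  split_ifs with h <;> simp [h]

theorem members_congr {cls cls' : ℕ → ℕ} {m c : ℕ} (h : ∀ k < m, cls k = cls' k) :
    members cls m c = members cls' m c := by
  unfold members
  congr 1
  refine List.filter_congr fun k hk => ?_
  rw [h k (List.mem_range.1 hk)]

theorem sum_length_members {cls : ℕ → ℕ} {m n : ℕ} (h : ∀ k < m, cls k < n) :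
    ∑ c ∈ Finset.range n, (members cls m c).length = m := by
  induction m with
  | zero => simp [members]
  | succ m ih =>
    have : ∀ c, (members cls (m + 1) c).length =
        (members cls m c).length + if cls m = c then 1 else 0 := by
      intro c
      rw [members_succ]
      split_ifs <;> simp
    simp only [this, Finset.sum_add_distrib]
    rw [ih fun k hk => h k (by omega), Finset.sum_ite_eq, if_pos (by simpa using h m (by omega))]

variable {W m q : ℕ} {N : NState}

theorem clearCmd_run (hM : N.reg rM = m) (hm : m < W) :
    Run W clearCmd N (11 * m + 6) fun N' => ∀ k < m, N'.mem aHead k = 0 := by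
  refine Run.for m 3 (fun k N' => ∀ j < k, N'.mem aHead j = 0) hM hm (by decide) (by decide)
    (by decide) (by simp) ?_ (by omega)
  intro k hk N' hF hreg hI
  refine (Run.straight (by decide) (by simp [hreg]; omega)).conseq (by simp) ?_
  rintro _ - rfl -
  intro j hj
  by_cases e : j = k
  · simp [hreg, e]
  · simp [hreg, e, hI j (by omega)]

theorem linkCmd_run (hM : N.reg rM = m) (hm : m < W) (hcls : ∀ k < m, N.mem aNew k < m)
    (hz : ∀ k < m, N.mem aHead k = 0) :
    Run W linkCmd N (40 * m + 6) fun N' => (∀ k < m, N'.mem aOld k = N.mem aNew k) ∧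
      ∀ c < m, Linked (N'.mem aNext) (N'.mem aHead c) (members (N.mem aNew) m c) := by
  refine Run.for m 30 (fun k N' => (∀ j < k, N'.mem aOld j = N.mem aNew j) ∧
      ∀ c < m, Linked (N'.mem aNext) (N'.mem aHead c) (members (N.mem aNew) k c)) hM hm
    (by decide) (by decide) (by decide) ?_ ?_ (by omega)
  · refine ⟨by simp, fun c hc => ?_⟩
    simp [members, Linked, hz c hc]
  · rintro k hk N' hF hreg ⟨hI1, hI2⟩
    have hnew : N'.mem aNew = N.mem aNew := hF.mem _ (by decide)
    have hck := hcls k hk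
    refine (Run.straight (by decide) (by simp [hreg, hnew]; omega)).conseq (by simp) ?_
    rintro _ - rfl -
    constructor
    · intro j hj
      by_cases e : j = k
      · simp [hreg, hnew, e]
      · simp [hreg, hnew, e, hI1 j (by omega)]
    · intro c hc
      rw [members_succ]
      have hlink := hI2 c hc
      have key : ∀ p, Linked (N'.mem aNext) p (members (N.mem aNew) k c) →
          Linked (((N'.setMem aOld k (N.mem aNew k)).setMem aNext k
            (N'.mem aHead (N.mem aNew k))).mem aNext) p (members (N.mem aNew) k c) := by
        intro p hp
        refine hp.congr fun j hj => ?_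
        have := (mem_members.1 hj).1
        simp [show j ≠ k by omega]
      by_cases e : N.mem aNew k = c
      · rw [if_pos e]
        constructor
        · simp [hreg, hnew, e]
        · have := key _ hlink
          simpa [hreg, hnew, e, NState.setMem_mem_of_ne] using this
      · rw [if_neg e]
        have := key _ hlink
        simpa [hreg, hnew, Ne.symm e, NState.setMem_mem_of_ne] using this

/-- The state of the splitting at position `t` when the items in `D` have been put into their new
classes and the class `c` is being split. -/
structure RefineInv (m q t c : ℕ) (D : ℕ → Prop) (N : NState) : Prop where
  new_lt : ∀ k, D k → N.mem aNew k < m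
  old_new : ∀ k, D k → N.mem aOld (N.mem aNew k) = N.mem aOld k
  gram_new : ∀ k, D k → N.mem aGram (N.mem aNew k * q + t) = N.mem aGram (k * q + t)
  new_eq : ∀ k k', D k → D k' → N.mem aOld k = N.mem aOld k' →
    N.mem aGram (k * q + t) = N.mem aGram (k' * q + t) → N.mem aNew k = N.mem aNew k'
  rep_eq : ∀ k, D k → N.mem aOld k = c → N.mem aRep (N.mem aGram (k * q + t)) = N.mem aNew k
  rep_lt : ∀ x, 0 < m → N.mem aRep x < m

/-- One more item `k` is put into the class of `v`, which agrees with it. -/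
theorem RefineInv.step {t c k v : ℕ} {D : ℕ → Prop} {N' : NState} (h : RefineInv m q t c D N)
    (hk : N.mem aOld k = c)
    (hv : v < m ∧ N.mem aOld v = c ∧ N.mem aGram (v * q + t) = N.mem aGram (k * q + t))
    (hD : ∀ j, D j → N.mem aOld j = c → N.mem aGram (j * q + t) = N.mem aGram (k * q + t) →
      N.mem aNew j = v)
    (h1 : N'.mem aOld = N.mem aOld) (h2 : N'.mem aGram = N.mem aGram)
    (h3 : ∀ j, N'.mem aNew j = if j = k then v else N.mem aNew j)
    (h4 : ∀ x, N'.mem aRep x = if x = N.mem aGram (k * q + t) then v else N.mem aRep x) :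
    RefineInv m q t c (fun j => D j ∨ j = k) N' where
  new_lt j hj := by
    rw [h3]
    split_ifs with e
    · exact hv.1
    · exact h.new_lt j (hj.resolve_right e)
  old_new j hj := by
    rw [h3, h1]
    split_ifs with e
    · rw [e, hk, hv.2.1]
    · exact h.old_new j (hj.resolve_right e)
  gram_new j hj := by
    rw [h3, h2]
    split_ifs with e
    · rw [e, hv.2.2]
    · exact h.gram_new j (hj.resolve_right e)
  new_eq j j' hj hj' e1 e2 := by
    rw [h1] at e1
    rw [h2] at e2
    rw [h3, h3]
    split_ifs with e e' e'
    · rfl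
    · subst e
      exact (hD j' (hj'.resolve_right e') (e1.symm.trans hk) e2.symm).symm
    · subst e'
      exact hD j (hj.resolve_right e) (e1.trans hk) e2
    · exact h.new_eq j j' (hj.resolve_right e) (hj'.resolve_right e') e1 e2
  rep_eq j hj e1 := by
    rw [h1] at e1
    rw [h2, h3, h4]
    split_ifs with e e' e'
    · rfl
    · exact (hD j (hj.resolve_right e') e1 e).symm
    · exact absurd (by rw [e']) e
    · exact h.rep_eq j (hj.resolve_right e') e1
  rep_lt x hm := by
    rw [h4]
    split_ifs
    · exact hv.1
    · exact h.rep_lt x hm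

theorem refineStepCmd_run {t c k : ℕ} {D : ℕ → Prop} (h : RefineInv m q t c D N) (hm : m < W)
    (hQ : N.reg rQ = q) (hT : N.reg rT = t) (hI : N.reg rI = c) (hP : N.reg rP = k + 1)
    (hk : k < m) (hc : N.mem aOld k = c) (hcm : c < m) (hold : ∀ j < m, N.mem aOld j < m)
    (hgram : ∀ j < m, j * q + t < W ∧ N.mem aGram (j * q + t) < W) :
    Run W refineStepCmd N 60 fun N' =>
      N'.reg rP = N.mem aNext k ∧ RefineInv m q t c (fun j => D j ∨ j = k) N' := by
  obtain ⟨g1, g2⟩ := hgram k hk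
  obtain ⟨v, hv⟩ : ∃ v, N.mem aRep (N.mem aGram (k * q + t)) = v := ⟨_, rfl⟩
  have hvm : v < m := hv ▸ h.rep_lt _ (by omega)
  obtain ⟨g3, g4⟩ := hgram v hvm
  have g5 := hold v hvm
  refine (Run.straight (by decide) ?_).conseq (by simp [refineStepCmd]) ?_
  · by_cases c1 : N.mem aOld v = c <;>
      by_cases c2 : N.mem aGram (v * q + t) = N.mem aGram (k * q + t) <;>
      simp [refineStepCmd, hQ, hT, hI, hP, hv, c1, c2] <;> omega
  · rintro _ - rfl
    by_cases hcheck : N.mem aOld v = c ∧ N.mem aGram (v * q + t) = N.mem aGram (k * q + t)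
    · obtain ⟨c1, c2⟩ := hcheck
      refine ⟨by simp [refineStepCmd, hQ, hT, hI, hP, hv, c1, c2], ?_⟩
      refine h.step (k := k) (v := v) hc ⟨hvm, c1, c2⟩ ?_ ?_ ?_ ?_ ?_
      · intro j hj e1 e2
        rw [← h.rep_eq j hj e1, e2, hv]
      · funext j
        simp [refineStepCmd, hQ, hT, hI, hP, hv, c1, c2]
      · funext j
        simp [refineStepCmd, hQ, hT, hI, hP, hv, c1, c2]
      · intro j
        simp [refineStepCmd, hQ, hT, hI, hP, hv, c1, c2]
      · intro x
        simp [refineStepCmd, hQ, hT, hI, hP, hv, c1, c2]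
        rintro rfl
        exact hv
    · have hz : (if N.mem aOld v = c then 1 else 0) *
          (if N.mem aGram (v * q + t) = N.mem aGram (k * q + t) then 1 else 0) = 0 := by
        split_ifs <;> simp_all
      refine ⟨by simp [refineStepCmd, hQ, hT, hI, hP, hv, hz], ?_⟩
      refine h.step (k := k) (v := k) hc ⟨hk, hc, rfl⟩ ?_ ?_ ?_ ?_ ?_
      · intro j hj e1 e2
        refine absurd ?_ hcheck
        have e3 := h.rep_eq j hj e1
        rw [e2, hv] at e3
        rw [e3, h.old_new j hj, h.gram_new j hj]
        exact ⟨e1, e2⟩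
      · funext j
        simp [refineStepCmd, hQ, hT, hI, hP, hv, hz]
      · funext j
        simp [refineStepCmd, hQ, hT, hI, hP, hv, hz]
      · intro j
        simp [refineStepCmd, hQ, hT, hI, hP, hv, hz]
      · intro x
        simp [refineStepCmd, hQ, hT, hI, hP, hv, hz]

end RAM

namespace RAM

variable {W m q : ℕ} {N : NState}

theorem RefineInv.congr {t c : ℕ} {D D' : ℕ → Prop} {N' : NState} (h : RefineInv m q t c D N)
    (hD : ∀ k, D' k → D k) (hN : N'.mem = N.mem) : RefineInv m q t c D' N' := by
  refine ⟨?_, ?_, ?_, ?_, ?_, ?_⟩ <;> rw [hN]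
  · exact fun k hk => h.new_lt k (hD k hk)
  · exact fun k hk => h.old_new k (hD k hk)
  · exact fun k hk => h.gram_new k (hD k hk)
  · exact fun k k' hk hk' => h.new_eq k k' (hD k hk) (hD k' hk')
  · exact fun k hk => h.rep_eq k (hD k hk)
  · exact h.rep_lt

theorem RefineInv.next_class {t c : ℕ} (h : RefineInv m q t c (fun k => k < m ∧ N.mem aOld k ≤ c) N) :
    RefineInv m q t (c + 1) (fun k => k < m ∧ N.mem aOld k < c + 1) N where
  new_lt k hk := h.new_lt k ⟨hk.1, by omega⟩
  old_new k hk := h.old_new k ⟨hk.1, by omega⟩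
  gram_new k hk := h.gram_new k ⟨hk.1, by omega⟩
  new_eq k k' hk hk' := h.new_eq k k' ⟨hk.1, by omega⟩ ⟨hk'.1, by omega⟩
  rep_eq k hk e := absurd hk.2 (by omega)
  rep_lt := h.rep_lt

/-- Splitting a class takes time linear in the number of its members. -/
theorem refineClass_run {t c : ℕ} (hm : m < W) (hQ : N.reg rQ = q) (hT : N.reg rT = t)
    (hI : N.reg rI = c) (hcm : c < m) (hold : ∀ j < m, N.mem aOld j < m)
    (hgram : ∀ j < m, j * q + t < W ∧ N.mem aGram (j * q + t) < W)
    (hl : Linked (N.mem aNext) (N.reg rP) (members (N.mem aOld) m c))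
    (h : RefineInv m q t c (fun k => k < m ∧ N.mem aOld k < c) N) :
    Run W (.while (.var rP) refineStepCmd) N (62 * (members (N.mem aOld) m c).length + 2)
      fun N' => RefineInv m q t (c + 1) (fun k => k < m ∧ N.mem aOld k < c + 1) N' := by
  set l := members (N.mem aOld) m c with hldef
  have hmem : ∀ k ∈ l, k < m ∧ N.mem aOld k = c := fun k hk => mem_members.1 hk
  refine (Run.while l.length (fun _ => 60) (fun j N' =>
    Linked (N.mem aNext) (N'.reg rP) (l.drop j) ∧
    RefineInv m q t c (fun k => (k < m ∧ N.mem aOld k < c) ∨ k ∈ l.take j) N') ?_ ?_ ?_).conseq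
    (by simp [Expr.cost]; omega) ?_
  · exact ⟨by simpa using hl, h.congr (by simp) rfl⟩
  · rintro j hj N' hF ⟨hI1, hI2⟩
    have mO : N'.mem aOld = N.mem aOld := hF.mem _ (by decide)
    have mG : N'.mem aGram = N.mem aGram := hF.mem _ (by decide)
    have mX : N'.mem aNext = N.mem aNext := hF.mem _ (by decide)
    rw [List.drop_eq_getElem_cons hj] at hI1
    obtain ⟨hP, hrest⟩ := hI1
    obtain ⟨hk, hc⟩ := hmem _ (List.getElem_mem hj)
    refine ⟨trivial, ?_, ?_, ?_⟩
    · simp only [Expr.nev, hP]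
      omega
    · simp only [Expr.nev, hP]
      omega
    · refine (refineStepCmd_run hI2 hm (by rw [hF.reg _ (by decide), hQ])
        (by rw [hF.reg _ (by decide), hT]) (by rw [hF.reg _ (by decide), hI]) hP hk
        (by rw [mO, hc]) hcm (by rwa [mO]) (by rwa [mG])).conseq le_rfl ?_
      rintro N'' - ⟨e1, e2⟩
      refine ⟨by rwa [e1, mX], e2.congr (fun k hk => ?_) rfl⟩
      rw [List.take_add_one, List.getElem?_eq_getElem hj] at hk
      simp only [Option.toList_some, List.mem_append, List.mem_singleton] at hk
      tauto
  · rintro N' - ⟨hI1, -⟩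
    rw [List.drop_length] at hI1
    exact ⟨trivial, hI1⟩
  · rintro N' hF ⟨-, hI⟩
    have mO : N'.mem aOld = N.mem aOld := hF.mem _ (by decide)
    have := RefineInv.next_class (N := N') (hI.congr (D' := fun k => k < m ∧ N'.mem aOld k ≤ c)
      (fun k hk => ?_) rfl)
    · rwa [mO] at this
    · rw [mO] at hk
      rw [List.take_length]
      rcases Nat.lt_or_eq_of_le hk.2 with g | g
      · exact .inl ⟨hk.1, g⟩
      · exact .inr (mem_members.2 ⟨hk.1, g⟩)

/-- The classes partition the items, so a round takes linear time. -/
theorem refineCmd_run {t : ℕ} (hm : m < W) (hM : N.reg rM = m) (hQ : N.reg rQ = q)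
    (hT : N.reg rT = t) (hold : ∀ j < m, N.mem aOld j < m)
    (hgram : ∀ j < m, j * q + t < W ∧ N.mem aGram (j * q + t) < W)
    (hl : ∀ c < m, Linked (N.mem aNext) (N.mem aHead c) (members (N.mem aOld) m c))
    (hrep : ∀ x, 0 < m → N.mem aRep x < m) :
    Run W refineCmd N (76 * m + 6) fun N' => RefineInv m q t m (· < m) N' := by
  refine (Run.for_sum m (fun c => 62 * (members (N.mem aOld) m c).length + 6)
    (fun c N' => RefineInv m q t c (fun k => k < m ∧ N.mem aOld k < c) N') hM hm (by decide)
    (by decide) (by decide) ?_ ?_).conseq ?_ ?_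
  · exact ⟨fun k hk => absurd hk.2 (by omega), fun k hk => absurd hk.2 (by omega),
      fun k hk => absurd hk.2 (by omega), fun k k' hk => absurd hk.2 (by omega),
      fun k hk => absurd hk.2 (by omega), hrep⟩
  · intro c hc N' hF hreg hI
    have mO : N'.mem aOld = N.mem aOld := hF.mem _ (by decide)
    have mG : N'.mem aGram = N.mem aGram := hF.mem _ (by decide)
    have mX : N'.mem aNext = N.mem aNext := hF.mem _ (by decide)
    have mH : N'.mem aHead = N.mem aHead := hF.mem _ (by decide)
    refine Run.seq_straight (T := 62 * (members (N.mem aOld) m c).length + 2) (by decide)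
      (by simp [hreg]; omega) (fun hF2 => ?_) (by simp; omega)
    have mA : (Cmd.run (.assign rP (.get aHead (.var rI))) N').mem = N'.mem := rfl
    have := refineClass_run (W := W) (N := Cmd.run (.assign rP (.get aHead (.var rI))) N')
      (t := t) (c := c) (q := q) hm (by rw [hF2.reg _ (by decide), hF.reg _ (by decide), hQ])
      (by rw [hF2.reg _ (by decide), hF.reg _ (by decide), hT])
      (by rw [hF2.reg _ (by decide), hreg]) hc (by rwa [mA, mO]) (by rwa [mA, mG])
      (by rw [mA, mX, mO]; simpa [hreg, mH] using hl c hc)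
      (by rw [mA, mO]; exact hI.congr (fun _ h => h) rfl)
    rw [mA, mO] at this
    exact this.conseq le_rfl fun N'' _ h _ => h.congr (fun _ h => h) rfl
  · rw [Finset.sum_add_distrib, Finset.sum_add_distrib, ← Finset.mul_sum, sum_length_members hold]
    simp
    omega
  · intro N' _ h
    exact h.congr (fun k hk => ⟨hk, hold k hk⟩) rfl

/-- The items `k < m` are grouped by their first `t` letters: `aNew` maps every item to a
representative of its group. -/
structure GroupInv (m q t : ℕ) (N : NState) : Prop where
  new_lt : ∀ k < m, N.mem aNew k < m
  new_new : ∀ k < m, N.mem aNew (N.mem aNew k) = N.mem aNew k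
  new_eq : ∀ k < m, ∀ k' < m, N.mem aNew k = N.mem aNew k' ↔
    ∀ s < t, N.mem aGram (k * q + s) = N.mem aGram (k' * q + s)
  rep_lt : ∀ x, 0 < m → N.mem aRep x < m

theorem groupCmd_run (hmq : m * q + q < W) (hq : 1 ≤ q) (hM : N.reg rM = m) (hQ : N.reg rQ = q)
    (hgram : ∀ j < m, ∀ t < q, N.mem aGram (j * q + t) < W)
    (hz : ∀ x, N.mem aNew x = 0 ∧ N.mem aRep x = 0) :
    Run W groupCmd N (q * (127 * m + 30) + 6) (GroupInv m q q) := by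
  have hmW : m < W := by
    have := Nat.le_mul_of_pos_right m hq
    omega
  refine Run.for q (127 * m + 18) (fun t N' => GroupInv m q t N') hQ (by omega) (by decide)
    (by decide) (by decide) ?_ ?_ (by nlinarith)
  · refine ⟨fun k hk => ?_, ?_, ?_, ?_⟩ <;> simp [hz]
    omega
  · intro t ht N' hF hreg hI
    have hM1 : N'.reg rM = m := by rw [hF.reg _ (by decide), hM]
    have hQ1 : N'.reg rQ = q := by rw [hF.reg _ (by decide), hQ]
    have mG1 : N'.mem aGram = N.mem aGram := hF.mem _ (by decide)
    refine Run.conseq (Run.seq (T := 11 * m + 6) (T' := 116 * m + 12)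
      ((clearCmd_run hM1 hmW).conseq le_rfl ?_)) (by omega) fun _ _ h => h
    intro N1 hF1 hz1 _
    have hM2 : N1.reg rM = m := by rw [hF1.reg _ (by decide), hM1]
    have mN1 : N1.mem aNew = N'.mem aNew := hF1.mem _ (by decide)
    refine Run.conseq (Run.seq (T := 40 * m + 6) (T' := 76 * m + 6)
      ((linkCmd_run hM2 hmW (by rw [mN1]; exact hI.new_lt) hz1).conseq le_rfl ?_)) (by omega)
      fun _ _ h => h
    rintro N2 hF2 ⟨hold, hlink⟩ -
    rw [mN1] at hold hlink
    have mG2 : N2.mem aGram = N.mem aGram := by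
      rw [hF2.mem _ (by decide), hF1.mem _ (by decide), mG1]
    have mR2 : N2.mem aRep = N'.mem aRep := by
      rw [hF2.mem _ (by decide), hF1.mem _ (by decide)]
    refine (refineCmd_run (t := t) (q := q) hmW (by rw [hF2.reg _ (by decide), hM2])
      (by rw [hF2.reg _ (by decide), hF1.reg _ (by decide), hQ1])
      (by rw [hF2.reg _ (by decide), hF1.reg _ (by decide), hreg])
      (fun j hj => by rw [hold j hj]; exact hI.new_lt j hj)
      (fun j hj => ⟨by have := mul_add_lt_mul hj ht; omega, by rw [mG2]; exact hgram j hj t ht⟩)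
      (fun c hc => by rw [members_congr hold]; exact hlink c hc)
      (by rw [mR2]; exact hI.rep_lt)).conseq le_rfl ?_
    intro N3 hF3 h _
    have mO3 : N3.mem aOld = N2.mem aOld := hF3.mem _ (by decide)
    have mG3 : N3.mem aGram = N'.mem aGram := by rw [hF3.mem _ (by decide), mG2, mG1]
    have key : ∀ k < m, ∀ k' < m, N3.mem aNew k = N3.mem aNew k' ↔
        N3.mem aOld k = N3.mem aOld k' ∧
          N3.mem aGram (k * q + t) = N3.mem aGram (k' * q + t) := by
      intro k hk k' hk'
      constructor
      · intro e
        rw [← h.old_new k hk, ← h.old_new k' hk', ← h.gram_new k hk, ← h.gram_new k' hk', e]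
        exact ⟨rfl, rfl⟩
      · rintro ⟨e1, e2⟩
        exact h.new_eq k k' hk hk' e1 e2
    refine ⟨h.new_lt, fun k hk => ?_, fun k hk k' hk' => ?_, h.rep_lt⟩
    · exact h.new_eq _ _ (h.new_lt k hk) hk (h.old_new k hk) (h.gram_new k hk)
    · simp only [NState.setReg_mem]
      rw [key k hk k' hk', mO3, hold k hk, hold k' hk', hI.new_eq k hk k' hk', mG3]
      constructor
      · rintro ⟨e1, e2⟩ s hs
        rcases Nat.lt_succ_iff_lt_or_eq.1 hs with hs | rfl
        · exact e1 s hs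
        · exact e2
      · exact fun e => ⟨fun s hs => e s (by omega), e t (by omega)⟩

end RAM

namespace RAM

variable {σ : ℕ}

/-! ### The program: output -/

/-- The sums of the multiplicities over the groups. -/
def sumCmd : Cmd :=
  .for rK rM (.put aSum (.get aNew (.var rK))
    (.get aSum (.get aNew (.var rK)) + .get aVal (.var rK)))

/-- Copies the `q`-gram `rK` to the output. -/
def copyCmd : Cmd :=
  .for rD rQ (.put aKind (.var rX * .var rQ + .var rD)
    (.get aGram (.var rK * .var rQ + .var rD)))

/-- The output. It overwrites the input, which is no longer needed. -/
def outCmd : Cmd :=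
  .assign rX 0 ;;
  .for rK rM
    (.ite (.op .eq (.get aNew (.var rK)) (.var rK))
      (.put aFst (.var rX) (.get aSum (.var rK)) ;; copyCmd ;; .assign rX (.var rX + 1)) .skip) ;;
  .assign rN (.var rX)

/-- The representatives among the first `k` items. -/
def representatives (cls : ℕ → ℕ) (k : ℕ) : List ℕ := (List.range k).filter fun j => cls j = j

theorem representatives_succ (cls : ℕ → ℕ) (k : ℕ) : representatives cls (k + 1) =
    if cls k = k then representatives cls k ++ [k] else representatives cls k := by
  unfold representatives
  rw [List.range_succ, List.filter_append]
  split_ifs with h <;> simp [h]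

theorem mem_representatives {cls : ℕ → ℕ} {k j : ℕ} :
    j ∈ representatives cls k ↔ j < k ∧ cls j = j := by
  simp [representatives]

theorem length_representatives_le (cls : ℕ → ℕ) (k : ℕ) : (representatives cls k).length ≤ k := by
  simpa [representatives] using List.length_filter_le (fun j => decide (cls j = j)) (List.range k)

variable {W m q : ℕ} {N : NState}

theorem sumCmd_run (hM : N.reg rM = m) (hm : m < W) (hcls : ∀ k < m, N.mem aNew k < m)
    (hz : ∀ x, N.mem aSum x = 0) :
    Run W sumCmd N (40 * m + 6) fun N' => ∀ c, N'.mem aSum c =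
      ∑ j ∈ Finset.range m, if N.mem aNew j = c then N.mem aVal j else 0 := by
  refine Run.for m 30 (fun k N' => ∀ c, N'.mem aSum c =
    ∑ j ∈ Finset.range k, if N.mem aNew j = c then N.mem aVal j else 0) hM hm (by decide)
    (by decide) (by decide) (by simp [hz]) ?_ (by omega)
  intro k hk N' hF hreg hI
  have mN : N'.mem aNew = N.mem aNew := hF.mem _ (by decide)
  have mV : N'.mem aVal = N.mem aVal := hF.mem _ (by decide)
  have := hcls k hk
  refine (Run.straight (by decide) (by simp [hreg, mN]; omega)).conseq (by simp) ?_
  rintro _ - rfl -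
  intro c
  rw [Finset.sum_range_succ, ← hI c]
  by_cases e : c = N.mem aNew k
  · simp [hreg, mN, mV, e]
  · simp [hreg, mN, e, Ne.symm e]

theorem copyCmd_run {x k : ℕ} (hQ : N.reg rQ = q) (hX : N.reg rX = x) (hK : N.reg rK = k)
    (hx : x * q + q < W) (hk : k * q + q < W) :
    Run W copyCmd N (20 * q + 6) fun N' =>
      (∀ c < x * q, N'.mem aKind c = N.mem aKind c) ∧
      ∀ t < q, N'.mem aKind (x * q + t) = N.mem aGram (k * q + t) := by
  refine Run.for q 12 (fun d N' => (∀ c < x * q, N'.mem aKind c = N.mem aKind c) ∧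
      ∀ t < d, N'.mem aKind (x * q + t) = N.mem aGram (k * q + t)) hQ (by omega) (by decide)
    (by decide) (by decide) ⟨fun _ _ => rfl, fun t ht => absurd ht (by omega)⟩ ?_ (by omega)
  rintro d hd N' hF hreg ⟨hI1, hI2⟩
  have mG : N'.mem aGram = N.mem aGram := hF.mem _ (by decide)
  have r1 : N'.reg rQ = q := by rw [hF.reg _ (by decide), hQ]
  have r2 : N'.reg rX = x := by rw [hF.reg _ (by decide), hX]
  have r3 : N'.reg rK = k := by rw [hF.reg _ (by decide), hK]
  refine (Run.straight (by decide) (by simp [hreg, r1, r2, r3]; omega)).conseq (by simp) ?_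
  rintro _ - rfl -
  constructor
  · intro c hc
    simp [hreg, r1, r2, r3, show c ≠ x * q + d by omega, hI1 c hc]
  · intro t ht
    by_cases e : t = d
    · simp [hreg, r1, r2, r3, e, mG]
    · simp [hreg, r1, r2, r3, e, hI2 t (by omega)]

/-- The representatives among the first `k` items have been written to the output. -/
structure OutInv (q k : ℕ) (N₀ N : NState) : Prop where
  count : N.reg rX = (representatives (N₀.mem aNew) k).length
  freq : ∀ i r, (representatives (N₀.mem aNew) k)[i]? = some r → N.mem aFst i = N₀.mem aSum r
  gram : ∀ i r, (representatives (N₀.mem aNew) k)[i]? = some r → ∀ t < q,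
    N.mem aKind (i * q + t) = N₀.mem aGram (r * q + t)

theorem outCmd_run (hM : N.reg rM = m) (hQ : N.reg rQ = q) (hmq : m * q + q < W) (hq : 1 ≤ q)
    (hcls : ∀ k < m, N.mem aNew k < m) :
    Run W outCmd N (m * (20 * q + 50) + 50) fun N' =>
      N'.reg rN = (representatives (N.mem aNew) m).length ∧ OutInv q m N N' := by
  have hmW : m < W := by
    have := Nat.le_mul_of_pos_right m hq
    omega
  unfold outCmd
  refine Run.seq_straight (T := m * (20 * q + 50) + 20) (by decide) (by simp) (fun hF1 => ?_)
    (by simp; omega)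
  have r1 : (Cmd.run (.assign rX 0) N).reg rX = 0 := by simp
  have m1 : (Cmd.run (.assign rX 0) N).mem = N.mem := rfl
  have hM1 : (Cmd.run (.assign rX 0) N).reg rM = m := by simp [hM]
  have hQ1 : (Cmd.run (.assign rX 0) N).reg rQ = q := by simp [hQ]
  generalize Cmd.run (.assign rX 0) N = N1 at *
  refine Run.conseq (Run.seq (T := m * (20 * q + 50) + 6) (T' := 2)
    ((Run.for m (20 * q + 42) (fun k N' => OutInv q k N N') hM1 hmW (by decide)
    (by decide) (by decide) ?_ ?_ (by nlinarith)).conseq le_rfl ?_)) (by omega) fun _ _ h => h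
  · exact ⟨by simp [representatives, NState.setReg_reg, r1], by simp [representatives],
      by simp [representatives]⟩
  · intro k hk N' hF hreg hI
    have mN : N'.mem aNew = N.mem aNew := by rw [hF.mem _ (by decide), m1]
    have mS : N'.mem aSum = N.mem aSum := by rw [hF.mem _ (by decide), m1]
    have mG : N'.mem aGram = N.mem aGram := by rw [hF.mem _ (by decide), m1]
    have hck := hcls k hk
    have hXk := length_representatives_le (N.mem aNew) k
    have hQ2 : N'.reg rQ = q := by rw [hF.reg _ (by decide), hQ1]
    have hkq : k * q ≤ m * q := Nat.mul_le_mul_right _ hk.le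
    have hXq : (representatives (N.mem aNew) k).length * q ≤ m * q :=
      Nat.mul_le_mul_right _ (by omega)
    refine Run.conseq (T := 20 * q + 42) (Q := OutInv q (k + 1) N) ?_ le_rfl
      fun N'' _ h _ => ⟨by simpa [NState.setReg_reg] using h.count, h.freq, h.gram⟩
    refine Run.ite (T := 20 * q + 20) (by simp [hreg, mN]; omega) ?_ (fun hc => ?_) (fun hc => ?_)
      (by simp; omega)
    · simp [hreg, mN]
      split_ifs <;> omega
    · have hrep : N.mem aNew k = k := by
        by_contra hcon
        simp [hreg, mN, hcon] at hc
      have hX := hI.count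
      refine Run.seq_straight (T := 20 * q + 12) (by decide) (by simp [hreg, hX]; omega)
        (fun hF2 => ?_) (by simp; omega)
      refine Run.conseq (Run.seq (T := 20 * q + 6) (T' := 4)
        ((copyCmd_run (q := q) (x := (representatives (N.mem aNew) k).length) (k := k)
          (by simp [hQ2]) (by simp [hX]) (by simp [hreg]) (by omega) (by omega)).conseq
          le_rfl ?_)) (by omega) fun _ _ h => h
      rintro N2 hF3 ⟨g1, g2⟩ -
      refine (Run.straight (by decide) (by simp)).conseq (by simp) ?_
      rintro _ - rfl
      have f1 : ∀ i, N2.mem aFst i = if i = (representatives (N.mem aNew) k).length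
          then N.mem aSum k else N'.mem aFst i := by
        intro i
        rw [hF3.mem aFst (by decide)]
        simp [hX, hreg, mS]
      have f2 : ∀ i, (Cmd.run (.put aFst (.var rX) (.get aSum (.var rK))) N').mem aKind i =
          N'.mem aKind i := by simp
      have f3 : ∀ i, (Cmd.run (.put aFst (.var rX) (.get aSum (.var rK))) N').mem aGram i =
          N.mem aGram i := by simp [mG]
      have f4 : N2.reg rX = (representatives (N.mem aNew) k).length := by
        rw [hF3.reg rX (by decide), ← hX]
        simp
      have hget : ∀ i r, (representatives (N.mem aNew) (k + 1))[i]? = some r →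
          (i < (representatives (N.mem aNew) k).length ∧
            (representatives (N.mem aNew) k)[i]? = some r) ∨
          (i = (representatives (N.mem aNew) k).length ∧ r = k) := by
        intro i r h
        rw [representatives_succ, if_pos hrep] at h
        rcases lt_trichotomy i (representatives (N.mem aNew) k).length with hlt | rfl | hlt
        · rw [List.getElem?_append_left hlt] at h
          exact .inl ⟨hlt, h⟩
        · simp at h
          exact .inr ⟨rfl, h.symm⟩
        · rw [List.getElem?_eq_none (by simp; omega)] at h
          cases h
      refine ⟨?_, ?_, ?_⟩
      · rw [representatives_succ, if_pos hrep]
        simp [f4]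
      · intro i r h
        simp only [Cmd.run, NState.setReg_mem]
        rcases hget i r h with ⟨hlt, h⟩ | ⟨rfl, rfl⟩
        · rw [f1, if_neg hlt.ne, hI.freq i r h]
        · rw [f1, if_pos rfl]
      · intro i r h t ht
        simp only [Cmd.run, NState.setReg_mem]
        rcases hget i r h with ⟨hlt, h⟩ | ⟨rfl, rfl⟩
        · rw [g1 _ (mul_add_lt_mul hlt ht), f2, hI.gram i r h t ht]
        · rw [g2 t ht, f3]
    · have hrep : N.mem aNew k ≠ k := by
        intro hcon
        simp [hreg, mN, hcon] at hc
      refine Run.skip.conseq (by omega) ?_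
      rintro _ - rfl
      have e : representatives (N.mem aNew) (k + 1) = representatives (N.mem aNew) k := by
        rw [representatives_succ, if_neg hrep]
      exact ⟨by rw [e]; exact hI.count, by rw [e]; exact hI.freq, by rw [e]; exact hI.gram⟩
  · rintro N2 - hI -
    refine (Run.straight (by decide) (by simp)).conseq (by simp) ?_
    rintro _ - rfl
    have := hI.count
    exact ⟨by simpa using this, by simpa using this, by simpa using hI.freq,
      by simpa using hI.gram⟩

end RAM

namespace RAM

variable {σ : ℕ}

/-! ### The whole program -/

theorem letterAt_ext {w w' : List (Fin σ)} (hl : w.length = w'.length)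
    (h : ∀ t < w.length, letterAt w t = letterAt w' t) : w = w' := by
  refine List.ext_getElem hl fun t h1 h2 => ?_
  have := h t h1
  rw [letterAt_of_lt h1, letterAt_of_lt h2] at this
  exact Fin.ext this

/-- The `k`-th string of a list. -/
def gramOf (L : WList σ) (k : ℕ) : List (Fin σ) := (L.getD k ([], 0)).1

theorem getElem?_eq_some_getD {L : WList σ} {k : ℕ} (hk : k < L.length) :
    L[k]? = some (L.getD k ([], 0)) := by
  simp [hk]

theorem total_eq_sum (L : WList σ) (P : List (Fin σ)) :
    total L P = ∑ k ∈ Finset.range L.length,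
      if gramOf L k = P then (L.getD k ([], 0)).2 else 0 := by
  induction L using List.reverseRecOn with
  | nil => simp [total]
  | append_singleton L p ih =>
    rw [total_concat L p.1 p.2, ih, List.length_append, List.length_singleton,
      Finset.sum_range_succ]
    congr 1
    · refine Finset.sum_congr rfl fun k hk => ?_
      have hk := Finset.mem_range.1 hk
      have e : (L ++ [p]).getD k ([], 0) = L.getD k ([], 0) := List.getD_append _ _ _ _ hk
      have e' : gramOf (L ++ [p]) k = gramOf L k := congrArg Prod.fst e
      rw [e', e]
    · have e : (L ++ [p]).getD L.length ([], 0) = p := by simp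
      have e' : gramOf (L ++ [p]) L.length = p.1 := congrArg Prod.fst e
      rw [e', e]

/-- The output, over the natural numbers: the memory holds a list of representatives of the
`q`-grams of the text, and the sums of the multiplicities of the items they represent. -/
theorem output_of_groups {S : SLP (Fin σ)} {q : ℕ} (hq : 1 ≤ q) {L : WList σ} {N₀ : NState}
    (hmem : ∀ p ∈ L, p.1.length = q ∧ p.1 <:+: S.text)
    (htot : ∀ P, P.length = q → total L P = nOcc S.text P)
    (hgram : ∀ k < L.length, ∀ t < q, N₀.mem aGram (k * q + t) = letterAt (gramOf L k) t)
    (hnew : GroupInv L.length q q N₀)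
    (hsum : ∀ c, N₀.mem aSum c = ∑ j ∈ Finset.range L.length,
      if N₀.mem aNew j = c then (L.getD j ([], 0)).2 else 0) :
    ((representatives (N₀.mem aNew) L.length).map (gramOf L)).Nodup ∧
    (∀ P : List (Fin σ), P ∈ (representatives (N₀.mem aNew) L.length).map (gramOf L) ↔
      P.length = q ∧ (Occ S.text P).Nonempty) ∧
    ∀ r ∈ representatives (N₀.mem aNew) L.length, N₀.mem aSum r = nOcc S.text (gramOf L r) := by
  have hne : ∀ P : List (Fin σ), P.length = q → P ≠ [] := by
    rintro P hP rfl
    simp at hP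
    omega
  have hg : ∀ k < L.length, (gramOf L k).length = q ∧ gramOf L k <:+: S.text := fun k hk =>
    hmem _ (List.mem_of_getElem? (getElem?_eq_some_getD hk))
  have heq : ∀ k < L.length, ∀ k' < L.length,
      N₀.mem aNew k = N₀.mem aNew k' ↔ gramOf L k = gramOf L k' := by
    intro k hk k' hk'
    rw [hnew.new_eq k hk k' hk']
    constructor
    · intro h
      refine letterAt_ext ((hg k hk).1.trans (hg k' hk').1.symm) fun t ht => ?_
      rw [(hg k hk).1] at ht
      rw [← hgram k hk t ht, ← hgram k' hk' t ht, h t ht]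
    · intro h s hs
      rw [hgram k hk s hs, hgram k' hk' s hs, h]
  refine ⟨?_, fun P => ?_, fun r hr => ?_⟩
  · refine List.Nodup.map_on ?_ (List.nodup_range.filter _)
    intro r hr r' hr' e
    obtain ⟨h1, h2⟩ := mem_representatives.1 hr
    obtain ⟨h3, h4⟩ := mem_representatives.1 hr'
    rw [← h2, ← h4]
    exact (heq r h1 r' h3).2 e
  · constructor
    · intro hP
      obtain ⟨r, hr, rfl⟩ := List.mem_map.1 hP
      obtain ⟨g1, g2⟩ := hg r (mem_representatives.1 hr).1
      exact ⟨g1, (Occ_nonempty_iff (hne _ g1)).2 g2⟩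
    · rintro ⟨hP, hocc⟩
      have hpos := nOcc_pos hocc
      rw [← htot P hP, total_eq_sum] at hpos
      obtain ⟨k, hk, hk'⟩ := Finset.exists_ne_zero_of_sum_ne_zero hpos.ne'
      have hk := Finset.mem_range.1 hk
      have hgk : gramOf L k = P := by
        by_contra hcon
        exact hk' (if_neg hcon)
      have hlt := hnew.new_lt k hk
      refine List.mem_map.2 ⟨N₀.mem aNew k, mem_representatives.2 ⟨hlt, hnew.new_new k hk⟩, ?_⟩
      rw [← hgk]
      exact (heq _ hlt k hk).1 (hnew.new_new k hk)
  · obtain ⟨h1, h2⟩ := mem_representatives.1 hr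
    rw [hsum, ← htot _ (hg r h1).1, total_eq_sum]
    refine Finset.sum_congr rfl fun j hj => ?_
    have h3 := heq j (Finset.mem_range.1 hj) r h1
    rw [h2] at h3
    simp only [h3]

/-- The program that computes all non-overlapping `q`-gram frequencies. -/
def frequencyCmd : Cmd :=
  lenCmd ;; countCmd ;; affixCmd ;; itemCmd ;; groupCmd ;; sumCmd ;; outCmd

/-- Every time bound `T'` is a generous budget for the parts of the program that remain. -/
theorem frequencyCmd_run {W : ℕ} {S : SLP (Fin σ)} {q : ℕ} {N : NState} (hq : 1 ≤ q)
    (h : Input S q N) (hW : 4 * S.text.length + 40 * (q * q * S.size) + 4 * σ < W)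
    (hz : ∀ a, 6 ≤ a → ∀ i, N.mem a i = 0) :
    Run W frequencyCmd N (10000 * (q * q * S.size)) fun N' => ∃ (L : WList σ) (N₀ : NState),
      L.length ≤ 3 * (q * S.size) ∧
      ((representatives (N₀.mem aNew) L.length).map (gramOf L)).Nodup ∧
      (∀ P : List (Fin σ), P ∈ (representatives (N₀.mem aNew) L.length).map (gramOf L) ↔
        P.length = q ∧ (Occ S.text P).Nonempty) ∧
      N'.reg rN = (representatives (N₀.mem aNew) L.length).length ∧
      ∀ i r, (representatives (N₀.mem aNew) L.length)[i]? = some r →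
        N'.mem aFst i = nOcc S.text (gramOf L r) ∧
        ∀ t < q, N'.mem aKind (i * q + t) = letterAt (gramOf L r) t := by
  have hqn : q * S.size ≤ q * q * S.size :=
    Nat.mul_le_mul_right _ (Nat.le_mul_of_pos_left q hq)
  have hqq := Nat.le_mul_of_pos_right q S.size_pos
  have hss := Nat.le_mul_of_pos_left S.size hq
  have hn := S.size_pos
  unfold frequencyCmd
  refine Run.conseq (Run.seq (T := 30 * S.size + 6) (T' := 9800 * (q * q * S.size))
    ((lenCmd_run h (by omega)).conseq le_rfl ?_)) (by omega) fun _ _ h => h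
  intro N1 hF1 hlen _
  have hin1 := h.of_frame hF1 (by decide)
  have hz1 : ∀ a, 7 ≤ a → ∀ i, N1.mem a i = 0 := fun a ha i => by
    rw [hF1.mem a (by simp [lenCmd, Cmd.for, Cmd.writesMem]; omega), hz a (by omega)]
  refine Run.conseq (Run.seq (T := 100 * S.size + 100) (T' := 9500 * (q * q * S.size))
    ((countCmd_run hq hin1 (by omega) fun a ha _ => hz1 a ha).conseq le_rfl ?_)) (by omega)
    fun _ _ h => h
  intro N2 hF2 hinv _
  have hc2 : Counted S q N2 := ⟨hin1.of_frame hF2 (by decide), fun i hi => by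
    rw [hF2.mem aLen (by decide), hlen i hi], hinv⟩
  have hz2 : ∀ a, 12 ≤ a → ∀ i, N2.mem a i = 0 := fun a ha i => by
    rw [hF2.mem a (by
      simp [countCmd, countStepCmd, passCmd, Cmd.for, Cmd.writesMem]; omega), hz1 a (by omega)]
  refine Run.conseq (Run.seq (T := 300 * (q * S.size) + 100) (T' := 9000 * (q * q * S.size))
    ((affixCmd_run hq hc2 (by omega) fun i =>
      ⟨hz2 _ (by decide) i, hz2 _ (by decide) i⟩).conseq le_rfl ?_)) (by omega)
    fun _ _ h => h
  rintro N3 hF3 ⟨hQQ, haff⟩ -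
  have hc3 := hc2.of_frame hF3 (by decide)
  have hz3 : ∀ a, 14 ≤ a → ∀ i, N3.mem a i = 0 := fun a ha i => by
    rw [hF3.mem a (by simp [affixCmd, affixStepCmd, Cmd.for, Cmd.writesMem]; omega),
      hz2 a (by omega)]
  refine Run.conseq (Run.seq (T := 1000 * (q * q * S.size) + 300) (T' := 7500 * (q * q * S.size))
    ((itemCmd_run hq hc3 hW haff hQQ (hz3 _ (by decide))).conseq le_rfl ?_)) (by omega)
    fun _ _ h => h
  rintro N4 hF4 ⟨L, hL, hlenL, hmemL, htot⟩ -
  have hQ4 : N4.reg rQ = q := by rw [hF4.reg _ (by decide), hc3.input.gram]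
  have hz4 : ∀ a, 17 ≤ a → ∀ i, N4.mem a i = 0 := fun a ha i => by
    rw [hF4.mem a (by
      simp [itemCmd, letterCmd, lookupCmd, readCmd, gramStepCmd, Cmd.for, Cmd.writesMem]; omega),
      hz3 a (by omega)]
  have hmq : L.length * q ≤ 3 * (q * q * S.size) := by
    have e : 3 * (q * S.size) * q = 3 * (q * q * S.size) := by ring
    exact (Nat.mul_le_mul_right q hlenL).trans e.le
  have hgram4 : ∀ k < L.length, ∀ t < q, N4.mem aGram (k * q + t) = letterAt (gramOf L k) t :=
    fun k hk t ht => hL.gram k _ (getElem?_eq_some_getD hk) t ht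
  have hgW : ∀ k < L.length, ∀ t < q, N4.mem aGram (k * q + t) < W := by
    intro k hk t ht
    have hl := (hmemL _ (List.mem_of_getElem? (getElem?_eq_some_getD hk))).1
    rw [hgram4 k hk t ht, letterAt_of_lt (by rw [gramOf, hl]; exact ht)]
    refine lt_of_lt_of_le (Fin.is_lt _) ?_
    omega
  refine Run.conseq (Run.seq (T := q * (127 * L.length + 30) + 6)
    (T' := 6500 * (q * q * S.size))
    ((groupCmd_run (m := L.length) (q := q) (by omega) hq hL.count hQ4 hgW fun x =>
      ⟨hz4 _ (by decide) x, hz4 _ (by decide) x⟩).conseq le_rfl ?_)) ?_ fun _ _ h => h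
  swap
  · have e : q * (127 * L.length + 30) = 127 * (L.length * q) + 30 * q := by ring
    omega
  intro N5 hF5 hG _
  have hM5 : N5.reg rM = L.length := by rw [hF5.reg _ (by decide), hL.count]
  have hz5 : ∀ x, N5.mem aSum x = 0 := fun x => by
    rw [hF5.mem _ (by decide), hz4 _ (by decide)]
  refine Run.conseq (Run.seq (T := 40 * L.length + 6) (T' := 6000 * (q * q * S.size))
    ((sumCmd_run hM5 (by omega) hG.new_lt hz5).conseq le_rfl ?_)) (by omega) fun _ _ h => h
  intro N6 hF6 hsum _
  have mN6 : N6.mem aNew = N5.mem aNew := hF6.mem _ (by decide)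
  have mG6 : N6.mem aGram = N4.mem aGram := by
    rw [hF6.mem _ (by decide), hF5.mem _ (by decide)]
  have mR6 : N6.mem aRep = N5.mem aRep := hF6.mem _ (by decide)
  have mV5 : N5.mem aVal = N4.mem aVal := hF5.mem _ (by decide)
  have mG5 : N6.mem aGram = N5.mem aGram := hF6.mem _ (by decide)
  have hG6 : GroupInv L.length q q N6 := by
    refine ⟨?_, ?_, ?_, ?_⟩
    · rw [mN6]; exact hG.new_lt
    · rw [mN6]; exact hG.new_new
    · rw [mN6, mG5]; exact hG.new_eq
    · rw [mR6]; exact hG.rep_lt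
  obtain ⟨g1, g2, g3⟩ := output_of_groups hq hmemL htot (N₀ := N6)
    (by rw [mG6]; exact hgram4) hG6 (fun c => by
      rw [hsum c, mN6, mV5]
      refine Finset.sum_congr rfl fun j hj => ?_
      rw [hL.val j _ (getElem?_eq_some_getD (Finset.mem_range.1 hj))])
  refine (outCmd_run (m := L.length) (q := q) (by rw [hF6.reg _ (by decide), hM5])
    (by rw [hF6.reg _ (by decide), hF5.reg _ (by decide), hQ4]) (by omega) hq
    hG6.new_lt).conseq ?_ ?_
  · have e : L.length * (20 * q + 50) = 20 * (L.length * q) + 50 * L.length := by ring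
    omega
  · rintro N7 - ⟨hcount, hout⟩
    refine ⟨L, N6, hlenL, g1, g2, hcount, fun i r hr => ⟨?_, fun t ht => ?_⟩⟩
    · rw [hout.freq i r hr, g3 r (List.mem_of_getElem? hr)]
    · rw [hout.gram i r hr t ht, mG6]
      exact hgram4 r (mem_representatives.1 (List.mem_of_getElem? hr)).1 t ht

/-- The numbers in the words of `s`. -/
def State.toNState {b : ℕ} (s : State b) : NState :=
  ⟨fun x => (s.reg x).toNat, fun a i => (s.mem a (BitVec.ofNat b i)).toNat⟩

theorem represents_toNState {b : ℕ} (s : State b) : Represents s s.toNState where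
  reg x := by simp [State.toNState]
  mem a i _ := by simp [State.toNState]

theorem input_of_isInput {b : ℕ} {S : SLP (Fin σ)} {q : ℕ} {s : State b} (hq : 1 ≤ q)
    (hW : S.text.length + 3 * (q * S.size) + σ < 2 ^ b) (h : IsInput S q s) :
    Input S q s.toNState := by
  have hqq := Nat.le_mul_of_pos_right q S.size_pos
  have hss := Nat.le_mul_of_pos_left S.size hq
  have hmod : ∀ v : ℕ, v < 2 ^ b → (BitVec.ofNat b v).toNat = v := fun v hv => by
    rw [BitVec.toNat_ofNat, Nat.mod_eq_of_lt hv]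
  refine ⟨?_, ?_, ?_, ?_, ?_⟩
  · simp only [State.toNState, h.size_eq]
    exact hmod _ (by omega)
  · simp only [State.toNState, h.q_eq]
    exact hmod _ (by omega)
  · rintro i a ⟨hi, hr⟩
    obtain ⟨h1, h2⟩ := h.letter_rule ⟨i, hi⟩ a hr
    simp only [State.toNState, h1, h2]
    exact ⟨hmod _ (by omega), hmod _ (by omega)⟩
  · rintro i _ _ ⟨hi, l, r, hr, rfl, rfl⟩
    obtain ⟨h1, h2, h3⟩ := h.pair_rule ⟨i, hi⟩ l r hr
    have hl := l.2
    have hr := r.2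
    simp only [State.toNState, h1, h2, h3]
    exact ⟨hmod _ (by omega), hmod _ (by omega), hmod _ (by omega)⟩
  · intro i l' r' hp hinf o ho hv
    obtain ⟨hi, l, r, hr, rfl, rfl⟩ := hp
    have hsi : S.str i = S.val ⟨i, hi⟩ := by rw [SLP.str, dif_pos hi]
    have hsl : S.str l = S.val ⟨l, l.2.trans hi⟩ := by rw [SLP.str, dif_pos (l.2.trans hi)]
    have hlen := hinf.length_le
    have hv' := hv
    unfold ValidLookup at hv'
    obtain ⟨x, y, g1, g2, g3, g4⟩ := h.given ⟨i, hi⟩ l r hr (by rw [← hsi]; omega)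
      (lookupPos q (S.str l).length o) (S.str l).length (by rw [hsl])
      (by unfold lookupPos; omega) (by unfold lookupPos; omega) (by unfold lookupPos; omega)
      (by rw [← hsi]; unfold lookupPos; omega)
    have hidx : lookupPos q (S.str l).length o + 2 * (q - 1) - (S.str l).length = o + 1 := by
      unfold lookupPos
      omega
    rw [← hsi] at g1 g4
    simp only [hidx] at g2 g3 g4
    obtain ⟨hx, hy, -⟩ := IsLongestCover.le_length hq hv g1
    have hnum := nOcc_le_length (slice (S.str i) x y) (lookupGram q (S.str l).length (S.str i) o)
    have hsl : (slice (S.str i) x y).length ≤ (S.str i).length := by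
      simp only [slice, List.length_take, List.length_drop]
      omega
    simp only [State.toNState, g2, g3, g4]
    rw [hmod x (by omega), hmod y (by omega)]
    exact ⟨g1, hmod _ (by unfold lookupGram at hnum; omega)⟩

end RAM

theorem mainTheorem2 :
    ∃ (prog : RAM.Cmd) (C K : ℕ),
      ∀ (σ : ℕ) (S : SLP (Fin σ)) (q b : ℕ), 1 ≤ q →
        K * (S.text.length + q ^ 2 * S.size + σ) ≤ 2 ^ b →
        ∀ s : RAM.State b, IsInput S q s →
          ∃ (t : ℕ) (s' : RAM.State b),
            RAM.Exec prog s t s' ∧ t ≤ C * (q ^ 2 * S.size) ∧ IsOutput S q s' := by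
  -- `50` makes `2 ^ b` larger than `4 * |T| + 40 * q ^ 2 * n + 4 * σ`, a generous bound for the
  -- numbers that are compared or used as addresses; the step bounds of the parts of the program
  -- add up to less than `10000 * q ^ 2 * n`.
  refine ⟨RAM.frequencyCmd, 10000, 50, fun σ S q b hq hK s hs => ?_⟩
  have hqn : q * S.size ≤ q * q * S.size :=
    Nat.mul_le_mul_right _ (Nat.le_mul_of_pos_left q hq)
  have hss := Nat.le_mul_of_pos_left S.size hq
  have hn := S.size_pos
  rw [pow_two] at hK ⊢
  have hin := RAM.input_of_isInput hq (by omega) hs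
  obtain ⟨t, s', N', hex, ht, hrep, -, L, N₀, hlen, hnd, hmem, hcount, hout⟩ :=
    RAM.frequencyCmd_run (W := 2 ^ b) hq hin (by omega) (fun a ha i => by
      simp [RAM.State.toNState, hs.mem_zero a ha]) b rfl s (RAM.represents_toNState s)
  refine ⟨t, s', hex, ht, _, hnd, hmem, ?_, fun k hk => ?_⟩
  · rw [hrep.reg, hcount, List.length_map]
  · rw [List.length_map] at hk
    obtain ⟨h1, h2⟩ := hout k _ (List.getElem?_eq_getElem hk)
    have hkL := hk.trans_le (RAM.length_representatives_le _ _)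
    have hkq : k * q + q ≤ 3 * (q * q * S.size) := by
      have h3 : (k + 1) * q ≤ 3 * (q * S.size) * q := Nat.mul_le_mul_right _ (by omega)
      have e : 3 * (q * S.size) * q = 3 * (q * q * S.size) := by ring
      rw [Nat.succ_mul] at h3
      omega
    simp only [List.getElem_map]
    have hl : (RAM.gramOf L (RAM.representatives (N₀.mem aNew) L.length)[k]).length = q :=
      ((hmem _).1 (List.mem_map_of_mem (List.getElem_mem hk))).1
    constructor
    · intro t ht
      rw [hrep.mem _ _ (by omega), h2 t (by omega), RAM.letterAt_of_lt ht]
    · rw [hrep.mem _ _ (by omega), h1]
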